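/- Work over $\mathbb{C}$. Let $0\le r\le n$ be integers and let $\mathcal{Q}$ be the tautological quotient bundle on $\mathbb{P}^{n-r}$, i.e. $\mathcal{Q}=\mathcal{O}^{\oplus (n-r+1)}/\mathcal{O}(-1)$, where the fibre of $\mathcal{O}(-1)$ at a point $[y]$ is the line spanned by $y$. Let $\mathcal{Q}(0,1)=\mathcal{Q}\boxtimes\mathcal{O}_{\mathbb{P}^n}(1)$ on $\mathbb{P}^{n-r}\times\mathbb{P}^n$. Then there is a non-empty Zariski open subset $U\subset H^0(\mathbb{P}^{n-r}\times\mathbb{P}^n,\mathcal{Q}(0,1))$ such that for every $s\in U$ and every linear subspace $\mathbb{P}^{r-1}\subset\mathbb{P}^n$ (with $\mathbb{P}^{-1}=\emptyset$) the blow-up of $\mathbb{P}^n$ along $\mathbb{P}^{r-1}$ exists and is isomorphic, as a scheme over $\mathbb{C}$, to the zero scheme of $s$: \[ \mathrm{Bl}_{\mathbb{P}^{r-1}}\mathbb{P}^n\;\cong\;\mathscr{Z}(s)\subset\mathbb{P}^{n-r}\times\mathbb{P}^n . \] -/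

import Mathlib

open CategoryTheory AlgebraicGeometry
open scoped Kronecker

noncomputable section

namespace BlowUpLinear

/-! ### Restriction of functions -/

/-- Restriction of functions from an open subset `U` to a smaller open subset `V`. -/
def res {X : Scheme.{0}} {U V : X.Opens} (h : V ≤ U) : Γ(X, U) →+* Γ(X, V) :=
  (X.presheaf.map (homOfLE h).op).hom

theorem res_comp {X : Scheme.{0}} {U V W : X.Opens} (h : V ≤ U) (h' : W ≤ V) :
    (res h').comp (res h) = res (h'.trans h) := by
  unfold res
  rw [← CommRingCat.hom_comp, ← Functor.map_comp]
  rfl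

theorem res_res {X : Scheme.{0}} {U V W : X.Opens} (h : V ≤ U) (h' : W ≤ V) (a : Γ(X, U)) :
    res h' (res h a) = res (h'.trans h) a :=
  RingHom.congr_fun (res_comp h h') a

theorem map_res_res {X : Scheme.{0}} {U V W : X.Opens} (h : V ≤ U) (h' : W ≤ V)
    {m n : Type} (M : Matrix m n Γ(X, U)) :
    (M.map (res h)).map (res h') = M.map (res (h'.trans h)) := by
  ext; simp [res_res]

/-- Pull-back of functions along a morphism of schemes. -/
def pull {X Y : Scheme.{0}} (f : X ⟶ Y) {U : Y.Opens} {V : X.Opens} (h : V ≤ f ⁻¹ᵁ U) :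
    Γ(Y, U) →+* Γ(X, V) :=
  (f.appLE U V h).hom

theorem res_pull {X Y : Scheme.{0}} (f : X ⟶ Y) {U : Y.Opens} {V V' : X.Opens}
    (h : V ≤ f ⁻¹ᵁ U) (h' : V' ≤ V) (a : Γ(Y, U)) :
    res h' (pull f h a) = pull f (h'.trans h) a := by
  unfold res pull
  rw [← Scheme.Hom.appLE_map f h (homOfLE h').op]
  rfl

theorem pull_res {X Y : Scheme.{0}} (f : X ⟶ Y) {U U' : Y.Opens} {V : X.Opens}
    (hU : U ≤ U') (h : V ≤ f ⁻¹ᵁ U) (a : Γ(Y, U')) :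
    pull f h (res hU a) = pull f (h.trans (Scheme.Hom.preimage_mono f hU)) a := by
  unfold res pull
  rw [← Scheme.Hom.map_appLE f h (homOfLE hU).op]
  rfl

theorem le_preimage_inf {X Y : Scheme.{0}} (f : X ⟶ Y) {U V : Y.Opens} :
    f ⁻¹ᵁ U ⊓ f ⁻¹ᵁ V ≤ f ⁻¹ᵁ (U ⊓ V) :=
  fun _ hx => hx

theorem le_preimage_inf₃ {X Y : Scheme.{0}} (f : X ⟶ Y) {U V W : Y.Opens} :
    f ⁻¹ᵁ U ⊓ f ⁻¹ᵁ V ⊓ f ⁻¹ᵁ W ≤ f ⁻¹ᵁ (U ⊓ V ⊓ W) :=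
  fun _ hx => hx

/-- The functions on a scheme over `Spec ℂ` form `ℂ`-algebras. -/
instance {X : Scheme.{0}} [X.Over (Spec (.of ℂ))] (U : X.Opens) : Algebra ℂ Γ(X, U) :=
  ((pull (X ↘ Spec (.of ℂ)) (U := ⊤) (V := U) le_top).comp
    (Scheme.ΓSpecIso (.of ℂ)).inv.hom).toAlgebra

/-! ### Ideal sheaves given by local generators -/

/-- The smallest quasi-coherent ideal sheaf that contains the sections in `S i` over the open
sets `U i`. Its closed subscheme is the largest one on which all these sections vanish. -/
def idealGeneratedBy {X : Scheme.{0}} {ι : Type} (U : ι → X.Opens)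
    (S : ∀ i, Set Γ(X, U i)) : X.IdealSheafData :=
  sInf {I | ∀ (i : ι) (V : X.affineOpens) (h : V.1 ≤ U i), ∀ a ∈ S i, res h a ∈ I.ideal V}

/-! ### Vector bundles, their sections and zero loci -/

/-- A vector bundle on `X`, given by a trivializing open cover `U i`, a finite local frame over
each `U i`, and transition matrices `g i j` on `U i ⊓ U j` subject to the cocycle condition.
The matrix `g i j` turns coordinates with respect to the frame `j` into coordinates with respect
to the frame `i`. -/
structure VecBundle (X : Scheme.{0}) where
  Idx : Type
  U : Idx → X.Opens
  cover : ⨆ i, U i = ⊤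
  Frame : Idx → Type
  [fintypeFrame : ∀ i, Fintype (Frame i)]
  [decEqFrame : ∀ i, DecidableEq (Frame i)]
  g : ∀ i j, Matrix (Frame i) (Frame j) Γ(X, U i ⊓ U j)
  g_self : ∀ i, g i i = 1
  g_comp : ∀ i j k,
    (g i j).map (res (inf_le_left : U i ⊓ U j ⊓ U k ≤ U i ⊓ U j)) *
      (g j k).map (res (inf_le_inf_right _ inf_le_right : U i ⊓ U j ⊓ U k ≤ U j ⊓ U k)) =
    (g i k).map (res (inf_le_inf_right _ inf_le_left : U i ⊓ U j ⊓ U k ≤ U i ⊓ U k))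

attribute [instance] VecBundle.fintypeFrame VecBundle.decEqFrame

namespace VecBundle

/-- The pull-back `f^* E`. -/
def pullback {X Y : Scheme.{0}} (f : X ⟶ Y) (E : VecBundle Y) : VecBundle X where
  Idx := E.Idx
  U i := f ⁻¹ᵁ E.U i
  cover := by rw [← Scheme.Hom.preimage_iSup, E.cover]; rfl
  Frame := E.Frame
  g i j := (E.g i j).map (pull f (V := f ⁻¹ᵁ E.U i ⊓ f ⁻¹ᵁ E.U j) (le_preimage_inf f))
  g_self i := by rw [E.g_self]; simp
  g_comp i j k := by
    have h := congrArg (fun M => M.map (pull f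
      (V := f ⁻¹ᵁ E.U i ⊓ f ⁻¹ᵁ E.U j ⊓ f ⁻¹ᵁ E.U k) (le_preimage_inf₃ f))) (E.g_comp i j k)
    simp only [Matrix.map_mul] at h
    have key : ∀ {m n : Type} {A : Y.Opens} {B C : X.Opens} (M : Matrix m n Γ(Y, A))
        (h₁ : B ≤ f ⁻¹ᵁ A) (h₂ : C ≤ B), (M.map (pull f h₁)).map (res h₂) =
          M.map (pull f (h₂.trans h₁)) := by
      intros; ext; simp [res_pull]
    have key' : ∀ {m n : Type} {A A' : Y.Opens} {B : X.Opens} (M : Matrix m n Γ(Y, A'))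
        (h₁ : A ≤ A') (h₂ : B ≤ f ⁻¹ᵁ A), (M.map (res h₁)).map (pull f h₂) =
          M.map (pull f (h₂.trans (Scheme.Hom.preimage_mono f h₁))) := by
      intros; ext; simp [pull_res]
    simp only [key'] at h
    simp only [key]
    exact h

/-- The tensor product `E ⊗ F`. -/
def tensor {X : Scheme.{0}} (E F : VecBundle X) : VecBundle X where
  Idx := E.Idx × F.Idx
  U a := E.U a.1 ⊓ F.U a.2
  cover := by
    rw [iSup_prod]
    simp_rw [← inf_iSup_eq, F.cover, inf_top_eq, E.cover]
  Frame a := E.Frame a.1 × F.Frame a.2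
  g a b :=
    (E.g a.1 b.1).map (res (inf_le_inf inf_le_left inf_le_left)) ⊗ₖ
      (F.g a.2 b.2).map (res (inf_le_inf inf_le_right inf_le_right))
  g_self a := by
    rw [E.g_self, F.g_self]
    simp
  g_comp a b c := by
    have hE := congrArg (fun M => M.map (res (V := E.U a.1 ⊓ F.U a.2 ⊓ (E.U b.1 ⊓ F.U b.2) ⊓
      (E.U c.1 ⊓ F.U c.2)) (inf_le_inf (inf_le_inf inf_le_left inf_le_left) inf_le_left)))
      (E.g_comp a.1 b.1 c.1)
    have hF := congrArg (fun M => M.map (res (V := E.U a.1 ⊓ F.U a.2 ⊓ (E.U b.1 ⊓ F.U b.2) ⊓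
      (E.U c.1 ⊓ F.U c.2)) (inf_le_inf (inf_le_inf inf_le_right inf_le_right) inf_le_right)))
      (F.g_comp a.2 b.2 c.2)
    simp only [Matrix.map_mul, map_res_res] at hE hF
    have key : ∀ {m n m' n' : Type} {A B : X.Opens} (M : Matrix m n Γ(X, A))
        (N : Matrix m' n' Γ(X, A)) (h : B ≤ A),
        (M ⊗ₖ N).map (res h) = M.map (res h) ⊗ₖ N.map (res h) := by
      intros; ext; simp
    simp only [key, map_res_res, ← Matrix.mul_kronecker_mul]
    rw [hE, hF]

/-- The complex vector space `H⁰(X, E)` of global sections: families of coordinate vectors over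
the trivializing open sets that are matched by the transition matrices. -/
def globalSections {X : Scheme.{0}} [X.Over (Spec (.of ℂ))] (E : VecBundle X) :
    Submodule ℂ (∀ i, E.Frame i → Γ(X, E.U i)) where
  carrier := {s | ∀ i j,
    (fun a => res (inf_le_left : E.U i ⊓ E.U j ≤ E.U i) (s i a)) =
      (E.g i j).mulVec (fun b => res (inf_le_right : E.U i ⊓ E.U j ≤ E.U j) (s j b))}
  add_mem' := by
    intro s t hs ht i j
    have := congrArg₂ (· + ·) (hs i j) (ht i j)
    simp only [← Matrix.mulVec_add] at this
    convert this using 1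
    · ext; simp
    · congr 1; ext; simp
  zero_mem' := by
    intro i j
    ext
    simp [Matrix.mulVec, dotProduct]
  smul_mem' := by
    intro c s hs i j
    have hres : ∀ {U V : X.Opens} (h : V ≤ U) (a : Γ(X, U)), res h (c • a) = c • res h a := by
      intro U V h a
      rw [Algebra.smul_def, Algebra.smul_def, map_mul]
      congr 1
      exact res_pull (X ↘ Spec (.of ℂ)) (U := ⊤) le_top h ((Scheme.ΓSpecIso (.of ℂ)).inv.hom c)
    have := congrArg (c • ·) (hs i j)
    simp only [← Matrix.mulVec_smul] at this
    convert this using 1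
    · ext; simp [hres]
    · congr 1; ext; simp [hres]

/-- The ideal sheaf of the zero scheme of a section: locally generated by the coordinates of the
section. -/
def zeroIdeal {X : Scheme.{0}} [X.Over (Spec (.of ℂ))] (E : VecBundle X)
    (s : E.globalSections) : X.IdealSheafData :=
  idealGeneratedBy E.U fun i => Set.range (s.1 i)

/-- The zero locus `Z(s)` of a section `s`, as a closed subscheme. -/
def zeroLocus {X : Scheme.{0}} [X.Over (Spec (.of ℂ))] (E : VecBundle X)
    (s : E.globalSections) : Scheme.{0} :=
  (E.zeroIdeal s).subscheme

/-- The closed immersion of `Z(s)`. -/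
def zeroLocusι {X : Scheme.{0}} [X.Over (Spec (.of ℂ))] (E : VecBundle X)
    (s : E.globalSections) : E.zeroLocus s ⟶ X :=
  (E.zeroIdeal s).subschemeι

end VecBundle

/-- A property holds for the general element of a complex vector space `H` if it holds on the
non-empty complement of the zero set of a polynomial function on `H`, that is, of a polynomial
expression in linear forms on `H`. -/
def HoldsForGeneral {H : Type} [AddCommGroup H] [Module ℂ H] (P : H → Prop) : Prop :=
  ∃ p : MvPolynomial (Module.Dual ℂ H) ℂ,
    (∃ s : H, MvPolynomial.eval (fun φ => φ s) p ≠ 0) ∧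
      ∀ s : H, MvPolynomial.eval (fun φ => φ s) p ≠ 0 → P s

/-! ### Blow-ups -/

/-- The ideal sheaf of an effective Cartier divisor: locally generated by one nonzerodivisor. -/
def IsCartier {X : Scheme.{0}} (I : X.IdealSheafData) : Prop :=
  ∀ x : X, ∃ U : X.affineOpens, x ∈ U.1 ∧
    ∃ a ∈ nonZeroDivisors Γ(X, U.1), I.ideal U = Ideal.span {a}

/-- `π : B ⟶ X` is the blow-up of `X` along the closed subscheme with ideal sheaf `I`: the inverse
image of that subscheme in `B` is an effective Cartier divisor, and `π` is universal with this
property. (`I.comap f` is the inverse image ideal sheaf `f⁻¹I · 𝒪`.) -/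
structure IsBlowUp {X B : Scheme.{0}} (I : X.IdealSheafData) (π : B ⟶ X) : Prop where
  cartier : IsCartier (I.comap π)
  universal : ∀ (T : Scheme.{0}) (f : T ⟶ X), IsCartier (I.comap f) →
    ∃! g : T ⟶ B, g ≫ π = f

/-! ### Projective space -/

/-- The grading of `ℂ[x₀, …, xₙ]` by degree. -/
abbrev grading (n : ℕ) : ℕ → Submodule ℂ (MvPolynomial (Fin (n + 1)) ℂ) :=
  MvPolynomial.homogeneousSubmodule (Fin (n + 1)) ℂ

instance (n : ℕ) : GradedAlgebra (grading n) := MvPolynomial.gradedAlgebra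

/-- `ℙⁿ = Proj ℂ[x₀, …, xₙ]`. -/
abbrev PP (n : ℕ) : Scheme.{0} := Proj (grading n)

instance (n : ℕ) : (PP n).Over (Spec (.of ℂ)) where
  hom := Proj.toSpecZero (grading n) ≫ Spec.map (CommRingCat.ofHom (algebraMap ℂ (grading n 0)))

/-- The chart `xᵢ ≠ 0`. -/
abbrev chart (n : ℕ) (i : Fin (n + 1)) : (PP n).Opens :=
  Proj.basicOpen (grading n) (MvPolynomial.X i)

theorem X_mem (n : ℕ) (i : Fin (n + 1)) :
    (MvPolynomial.X i : MvPolynomial (Fin (n + 1)) ℂ) ∈ grading n 1 :=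
  MvPolynomial.isHomogeneous_X ℂ i

/-- The function `xⱼ / xᵢ` on the chart `xᵢ ≠ 0`. -/
def ratio (n : ℕ) (j i : Fin (n + 1)) : Γ(PP n, chart n i) :=
  (Proj.awayToSection (grading n) (MvPolynomial.X i)).hom
    (HomogeneousLocalization.Away.mk (grading n) (X_mem n i) 1 (MvPolynomial.X j) (X_mem n j))

theorem iSup_chart (n : ℕ) : ⨆ i, chart n i = ⊤ := by
  refine Proj.iSup_basicOpen_eq_top' (grading n) _ (fun i => ⟨1, X_mem n i⟩) ?_
  rw [eq_top_iff]
  intro p _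
  induction p using MvPolynomial.induction_on with
  | C a => exact Subalgebra.algebraMap_mem _ (⟨MvPolynomial.C a, MvPolynomial.isHomogeneous_C _ a⟩ :
      grading n 0)
  | add p q hp hq => exact add_mem (hp trivial) (hq trivial)
  | mul_X p i hp => exact mul_mem (hp trivial) (Algebra.subset_adjoin ⟨i, rfl⟩)

theorem ratio_self (n : ℕ) (i : Fin (n + 1)) : ratio n i i = 1 := by
  unfold ratio
  rw [← map_one (Proj.awayToSection (grading n) (MvPolynomial.X i)).hom]
  congr 1
  apply HomogeneousLocalization.val_injective
  rw [HomogeneousLocalization.Away.val_mk, HomogeneousLocalization.val_one]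
  convert Localization.mk_self _ using 2
  simp

theorem ratio_mul_ratio (n : ℕ) (i j k : Fin (n + 1)) {V : (PP n).Opens}
    (hi : V ≤ chart n i) (hj : V ≤ chart n j) :
    res hi (ratio n j i) * res hj (ratio n k j) = res hi (ratio n k i) := by
  refine Subtype.ext (funext fun x => HomogeneousLocalization.val_injective _ ?_)
  have := x.1.isPrime
  have key : ∀ (a b : Fin (n + 1)) (h : V ≤ chart n b),
      (((res h (ratio n a b)).1 x).val : Localization x.1.asHomogeneousIdeal.toIdeal.primeCompl) =
        Localization.mk (MvPolynomial.X a) (⟨MvPolynomial.X b ^ 1,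
          fun hb => h x.2 (by simpa using hb)⟩ : x.1.asHomogeneousIdeal.toIdeal.primeCompl) := by
    intro a b h
    rfl
  have hmul : ∀ a b : Γ(PP n, V), ((a * b).1 x).val = (a.1 x).val * (b.1 x).val := by
    intro a b
    rw [← HomogeneousLocalization.val_mul]
    rfl
  rw [hmul, key, key, key, Localization.mk_mul, Localization.mk_eq_mk_iff, Localization.r_iff_exists]
  refine ⟨1, ?_⟩
  simp
  ring

/-- The line bundle `𝒪(1)` on `ℙⁿ`: a linear form `ℓ` has the coordinate `ℓ / xᵢ` on the chart
`xᵢ ≠ 0`. -/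
def hyperplaneBundle (n : ℕ) : VecBundle (PP n) where
  Idx := Fin (n + 1)
  U := chart n
  cover := iSup_chart n
  Frame _ := Unit
  g i j := Matrix.of fun _ _ => res inf_le_left (ratio n j i)
  g_self i := by ext; simp [ratio_self]
  g_comp i j k := by
    ext
    simp only [Matrix.mul_apply, Matrix.map_apply, Matrix.of_apply, res_res,
      Finset.univ_unique, Finset.sum_singleton]
    exact ratio_mul_ratio n i j k _ _

theorem quotient_cocycle {R : Type} [CommRing R] {m : ℕ} (q i j p : Fin (m + 1))
    (t u : Fin (m + 1) → R) (hj : u j = 1) (h : ∀ x, u x = t x * u i) :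
    ∑ x : {x : Fin (m + 1) // x ≠ j},
      ((if q = x.1 then 1 else 0) - t q * (if i = x.1 then 1 else 0)) *
        ((if x.1 = p then 1 else 0) - u x.1 * (if j = p then 1 else 0)) =
      (if q = p then 1 else 0) - t q * (if i = p then 1 else 0) := by
  let F : Fin (m + 1) → R := fun x =>
    ((if q = x then 1 else 0) - t q * (if i = x then 1 else 0)) *
      ((if x = p then 1 else 0) - u x * (if j = p then 1 else 0))
  have hF : F j = 0 := by simp [F, hj]
  have h1 : ∑ x : {x : Fin (m + 1) // x ≠ j}, F x.1 = ∑ x, F x := by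
    rw [← Finset.sum_erase Finset.univ hF]
    exact (Finset.sum_subtype _ (by simp) F).symm
  refine h1.trans ?_
  simp only [F, sub_mul, mul_sub, Finset.sum_sub_distrib, mul_assoc, ← Finset.mul_sum, ite_mul,
    one_mul, zero_mul, Finset.sum_ite_eq, Finset.mem_univ, if_true]
  rw [h q]
  ring

/-- The tautological quotient bundle `Q = 𝒪ᵐ⁺¹ / 𝒪(-1)` on `ℙᵐ`, where the fibre of `𝒪(-1)` at
`[y]` is the line spanned by `y = (y₀, …, yₘ)`. Over the chart `yᵢ ≠ 0` the images of the standard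
basis vectors `e_p` with `p ≠ i` are a frame of `Q`; the image of any vector `v` has the coordinates
`v_q - (y_q / yᵢ) vᵢ`, `q ≠ i`, with respect to this frame. The entries of the transition matrix
are these coordinates for `v = e_p`. -/
def quotientBundle (m : ℕ) : VecBundle (PP m) where
  Idx := Fin (m + 1)
  U := chart m
  cover := iSup_chart m
  Frame i := {q : Fin (m + 1) // q ≠ i}
  g i j := Matrix.of fun q p =>
    (Pi.single p.1 1 : Fin (m + 1) → Γ(PP m, chart m i ⊓ chart m j)) q.1 -
      res inf_le_left (ratio m q.1 i) *
        (Pi.single p.1 1 : Fin (m + 1) → Γ(PP m, chart m i ⊓ chart m j)) i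
  g_self i := by
    ext q p
    have hp : i ≠ p.1 := p.2.symm
    simp [Matrix.one_apply, Pi.single_apply, hp, Subtype.ext_iff]
  g_comp i j k := by
    ext q p
    simp only [Matrix.mul_apply, Matrix.map_apply, Matrix.of_apply, map_sub, map_mul, res_res,
      Pi.single_apply, apply_ite (res _), map_one, map_zero]
    have hi : chart m i ⊓ chart m j ⊓ chart m k ≤ chart m i := inf_le_left.trans inf_le_left
    have hj : chart m i ⊓ chart m j ⊓ chart m k ≤ chart m j := inf_le_left.trans inf_le_right
    exact quotient_cocycle q.1 i j p.1 (fun x => res hi (ratio m x i))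
      (fun x => res hj (ratio m x j)) (by rw [ratio_self, map_one])
      (fun x => (ratio_mul_ratio m j i x hj hi).symm.trans (mul_comm _ _))

/-- The ideal sheaf of the linear subspace `ℙ(L) ⊆ ℙⁿ`, for a vector subspace `L` of `ℂⁿ⁺¹`: on the
chart `xᵢ ≠ 0` it is generated by the functions `ℓ / xᵢ`, where `ℓ` runs through the linear forms
that vanish on `L`. -/
def linearSubspaceIdeal (n : ℕ) (L : Submodule ℂ (Fin (n + 1) → ℂ)) :
    (PP n).IdealSheafData :=
  idealGeneratedBy (chart n) fun i =>
    {a | ∃ ℓ ∈ L.dualAnnihilator, a = ∑ j, ℓ (Pi.single j 1) • ratio n j i}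

/-! ### The bundle `Q(0,1)` on `ℙᵐ × ℙⁿ` -/

/-- The product `ℙᵐ × ℙⁿ` over `Spec ℂ`. -/
abbrev PPprod (m n : ℕ) : Scheme.{0} :=
  Limits.pullback (PP m ↘ Spec (.of ℂ)) (PP n ↘ Spec (.of ℂ))

/-- The projection `ℙᵐ × ℙⁿ ⟶ ℙᵐ`. -/
abbrev pr₁ (m n : ℕ) : PPprod m n ⟶ PP m := Limits.pullback.fst _ _

/-- The projection `ℙᵐ × ℙⁿ ⟶ ℙⁿ`. -/
abbrev pr₂ (m n : ℕ) : PPprod m n ⟶ PP n := Limits.pullback.snd _ _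

instance (m n : ℕ) : (PPprod m n).Over (Spec (.of ℂ)) where
  hom := pr₁ m n ≫ (PP m ↘ Spec (.of ℂ))

/-- The bundle `Q(0,1) = Q ⊠ 𝒪(1)` on `ℙᵐ × ℙⁿ`, where `Q` is the tautological quotient bundle
of `ℙᵐ`. -/
def Q01 (m n : ℕ) : VecBundle (PPprod m n) :=
  ((quotientBundle m).pullback (pr₁ m n)).tensor ((hyperplaneBundle n).pullback (pr₂ m n))

end BlowUpLinear

end

open BlowUpLinear

noncomputable section

namespace BlowUpLinear

/-! ### Functoriality of functions -/

/-! Put m = n - r. A matrix A of size (m+1) × (n+1) gives a section of Q(0,1): at ([y], [x]) its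
value is the class of Ax modulo y. Its zero scheme Z consists of the pairs with Ax in the line
spanned by y. If A has full rank, then Z → ℙⁿ is the blow-up along ℙ(ker A), by a direct check of
the universal property.

Cartier (`isCartier_zeroLocus`): the ideal of ℙ(ker A) is generated by the entries of Ax. On the
chart yᵢ = 1 of Z one has Ax = t y with t = (Ax)ᵢ, so the inverse image ideal is generated by t.
That t is a nonzerodivisor follows by solving Ax = t y with a right inverse B of A: x = tBy + (z -
BAz) with z free. Functions on the chart thus embed into a localized polynomial ring in which t is,
up to a unit, a variable (`exists_weakly_universal_chart`, `formValues_mem_nonZeroDivisors`).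

Universality (`isBlowUp_zeroLocus`): if the entries of Ax generate locally a principal ideal (a)
with a a nonzerodivisor, then Ax = a b, where the entries of b generate the unit ideal. So b is a
point of ℙᵐ and ([b], [x]) lies on Z. Cancelling nonzerodivisors shows that the lift is unique,
hence the local lifts glue.

Dependence on the centre: linear automorphisms of ℙⁿ permute transitively the linear subspaces of a
given dimension, so one Z serves for every L (`exists_iso_of_isBlowUp`). An automorphism g is itself
obtained from the blow-up statement for m = n: the centre is then empty, so the identity of ℙⁿ lifts
to the zero locus, and the other projection gives x ↦ gx.

General sections: for m, n > 0 every section comes from a matrix (`isMatrixSection`). Functions on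
the product charts are viewed as Laurent polynomials supported in cones, and comparing charts leaves
only the coefficients that are matrix entries (`coefficients_eq_zero`, `eq_zero_of_isCompatible`).
The open set U is the locus where one fixed maximal minor of the matrix is nonzero. For m = 0 the
bundle Q has rank zero and every matrix represents the only section. -/

theorem res_self {X : Scheme.{0}} {U : X.Opens} (h : U ≤ U) (a : Γ(X, U)) : res h a = a := by
  have : res h = RingHom.id _ := by
    unfold res
    have : (homOfLE h).op = 𝟙 _ := rfl
    rw [this, X.presheaf.map_id]
    rfl
  rw [this]
  rfl

theorem pull_pull {X Y Z : Scheme.{0}} (f : X ⟶ Y) (g : Y ⟶ Z) {U : Z.Opens} {V : Y.Opens}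
    {W : X.Opens} (h : V ≤ g ⁻¹ᵁ U) (h' : W ≤ f ⁻¹ᵁ V) (a : Γ(Z, U)) :
    pull f h' (pull g h a) =
      pull (f ≫ g) (h'.trans (Scheme.Hom.preimage_mono f h)) a := by
  unfold pull
  rw [← Scheme.Hom.appLE_comp_appLE f g U V W h h']
  rfl

theorem pull_congr {X Y : Scheme.{0}} {f g : X ⟶ Y} (e : f = g) {U : Y.Opens} {V : X.Opens}
    (h : V ≤ f ⁻¹ᵁ U) (h' : V ≤ g ⁻¹ᵁ U) (a : Γ(Y, U)) : pull f h a = pull g h' a := by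
  subst e
  rfl

theorem pull_id {X : Scheme.{0}} {U V : X.Opens} (h : V ≤ (𝟙 X : X ⟶ X) ⁻¹ᵁ U) (a : Γ(X, U)) :
    pull (𝟙 X) h a = res (show V ≤ U from h) a := by
  unfold pull res
  rw [Scheme.Hom.appLE]
  erw [Scheme.Hom.id_app, Category.id_comp]
  rfl

theorem pull_ι_bijective' {X : Scheme.{0}} {U V : X.Opens} {W : U.toScheme.Opens} (hV : V ≤ U)
    (h : W ≤ U.ι ⁻¹ᵁ V) (h' : U.ι ⁻¹ᵁ V ≤ W) : Function.Bijective (pull U.ι h) := by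
  obtain rfl := le_antisymm h h'
  unfold pull
  rw [Scheme.Hom.appLE_eq_app]
  have := U.ι.isIso_app V (by rwa [Scheme.Opens.opensRange_ι])
  exact ConcreteCategory.bijective_of_isIso (U.ι.app V)

theorem pull_ι_bijective {X : Scheme.{0}} (U : X.Opens) (h : (⊤ : U.toScheme.Opens) ≤ U.ι ⁻¹ᵁ U) :
    Function.Bijective (pull U.ι h) :=
  pull_ι_bijective' le_rfl h le_top

theorem le_ι_preimage {X : Scheme.{0}} (U : X.Opens) : (⊤ : U.toScheme.Opens) ≤ U.ι ⁻¹ᵁ U :=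
  U.ι_preimage_self.ge

/-- If the inclusion of `U` factors through a morphism `e`, then the pull-back of functions
on `U` along `e` is injective. -/
theorem pull_injective_of_section {X Y : Scheme.{0}} {U : X.Opens} (e : Y ⟶ X) {V : Y.Opens}
    (h : V ≤ e ⁻¹ᵁ U) (b : U.toScheme ⟶ Y) (hb : ⊤ ≤ b ⁻¹ᵁ V) (hbe : b ≫ e = U.ι) :
    Function.Injective (pull e h) := by
  intro a a' haa
  apply (pull_ι_bijective U (le_ι_preimage U)).1
  rw [← pull_congr hbe (hb.trans (Scheme.Hom.preimage_mono b h)),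
    ← pull_congr hbe (hb.trans (Scheme.Hom.preimage_mono b h)), ← pull_pull b e h hb,
    ← pull_pull b e h hb, haa]

/-- Functions agree if they agree locally. -/
theorem section_ext {X : Scheme.{0}} {U : X.Opens} {a b : Γ(X, U)}
    (h : ∀ x ∈ U, ∃ (V : X.Opens) (hV : V ≤ U), x ∈ V ∧ res hV a = res hV b) : a = b := by
  apply X.IsSheaf.section_ext
  intro x hx
  obtain ⟨V, hV, hxV, e⟩ := h x hx
  exact ⟨V, hV, hxV, e⟩

theorem le_preimage_top {X Y : Scheme.{0}} (f : X ⟶ Y) (V : X.Opens) : V ≤ f ⁻¹ᵁ ⊤ :=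
  fun _ _ => trivial

/-- The scalars on a scheme over `Spec ℂ`. -/
def scalar {X : Scheme.{0}} (τ : X ⟶ Spec (.of ℂ)) (U : X.Opens) : ℂ →+* Γ(X, U) :=
  (pull τ (le_preimage_top τ U)).comp (Scheme.ΓSpecIso (.of ℂ)).inv.hom

theorem smul_eq_scalar_mul {X : Scheme.{0}} [X.Over (Spec (.of ℂ))] {U : X.Opens} (c : ℂ)
    (a : Γ(X, U)) : c • a = scalar (X ↘ Spec (.of ℂ)) U c * a :=
  Algebra.smul_def c a

theorem res_scalar {X : Scheme.{0}} (τ : X ⟶ Spec (.of ℂ)) {U V : X.Opens} (h : V ≤ U) (c : ℂ) :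
    res h (scalar τ U c) = scalar τ V c :=
  res_pull τ (le_preimage_top τ U) h _

theorem pull_scalar {X Y : Scheme.{0}} (f : X ⟶ Y) (τ : Y ⟶ Spec (.of ℂ)) {U : Y.Opens}
    {V : X.Opens} (h : V ≤ f ⁻¹ᵁ U) (c : ℂ) :
    pull f h (scalar τ U c) = scalar (f ≫ τ) V c :=
  pull_pull f τ (le_preimage_top τ U) h _

/-! ### Morphisms to affine schemes -/

theorem appLE_top {T X : Scheme.{0}} (k : T ⟶ X) (h : (⊤ : T.Opens) ≤ k ⁻¹ᵁ ⊤) :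
    k.appLE ⊤ ⊤ h = k.appTop := by
  rw [Scheme.Hom.appLE]
  have : (homOfLE h).op = 𝟙 _ := rfl
  erw [this, T.presheaf.map_id, Category.comp_id]

/-- The elements of `R` as functions on `Spec R`. -/
def specFun (R : CommRingCat.{0}) : R →+* Γ(Spec R, ⊤) := (Scheme.ΓSpecIso R).inv.hom

/-- The morphism to `Spec R` given by a ring homomorphism `R → Γ(T, ⊤)`. -/
def toSpec {T : Scheme.{0}} {R : CommRingCat.{0}} (φ : R →+* Γ(T, ⊤)) : T ⟶ Spec R :=
  T.toSpecΓ ≫ Spec.map (CommRingCat.ofHom φ)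

theorem pull_toSpec {T : Scheme.{0}} {R : CommRingCat.{0}} (φ : R →+* Γ(T, ⊤)) (r : R)
    (h : ⊤ ≤ toSpec φ ⁻¹ᵁ ⊤) : pull (toSpec φ) h (specFun R r) = φ r := by
  have : (Scheme.ΓSpecIso R).inv ≫ (toSpec φ).appLE ⊤ ⊤ h = CommRingCat.ofHom φ := by
    have h1 : (toSpec φ).appLE ⊤ ⊤ h = (toSpec φ).appTop := appLE_top _ _
    rw [h1, toSpec, Scheme.Hom.comp_appTop, Scheme.toSpecΓ_appTop]
    rw [Scheme.ΓSpecIso_naturality, Iso.inv_hom_id_assoc]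
  exact congrArg (fun g => g.hom r) this

theorem hom_Spec_ext {T : Scheme.{0}} {R : CommRingCat.{0}} {f g : T ⟶ Spec R}
    (h : ∀ r : R, pull f (le_preimage_top f ⊤) (specFun R r) =
      pull g (le_preimage_top g ⊤) (specFun R r)) : f = g := by
  apply ext_to_Spec (R := R)
  suffices (Scheme.ΓSpecIso R).inv ≫ f.appTop = (Scheme.ΓSpecIso R).inv ≫ g.appTop from
    this
  ext r
  have h1 : ∀ k : T ⟶ Spec R, k.appLE ⊤ ⊤ (le_preimage_top k ⊤) = k.appTop := fun k =>
    appLE_top _ _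
  have := h r
  unfold pull at this
  rw [h1, h1] at this
  exact this

theorem scalar_injective_hom {T : Scheme.{0}} {σ τ : T ⟶ Spec (.of ℂ)}
    (h : ∀ c, scalar σ ⊤ c = scalar τ ⊤ c) : σ = τ :=
  hom_Spec_ext h

/-! ### Points of projective space -/

/-- The ring of functions on the chart `xⱼ ≠ 0`. -/
abbrev chartRing (n : ℕ) (j : Fin (n + 1)) : CommRingCat.{0} :=
  .of (HomogeneousLocalization.Away (grading n) (MvPolynomial.X j))

/-- The open immersion of the chart `xⱼ ≠ 0`, as an affine scheme. -/
def chartι (n : ℕ) (j : Fin (n + 1)) :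
    Spec (chartRing n j) ⟶ PP n :=
  Proj.awayι (grading n) (MvPolynomial.X j) (X_mem n j) one_pos

instance (n : ℕ) (j : Fin (n + 1)) : IsOpenImmersion (chartι n j) :=
  inferInstanceAs (IsOpenImmersion (Proj.awayι _ _ _ _))

theorem opensRange_chartι (n : ℕ) (j : Fin (n + 1)) : (chartι n j).opensRange = chart n j :=
  Proj.opensRange_awayι _ _ _ _

theorem le_chartι_preimage (n : ℕ) (j : Fin (n + 1)) : ⊤ ≤ chartι n j ⁻¹ᵁ chart n j := by
  rw [← opensRange_chartι]
  intro x _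
  exact ⟨x, rfl⟩

/-- This links the two descriptions of a chart: sections of the structure sheaf of `Proj` over a
basic open set, and elements of the degree-zero localization. All computations with `ratio` reduce
to the ring `chartRing` through it. -/
theorem pull_chartι (n : ℕ) (j : Fin (n + 1))
    (z : HomogeneousLocalization.Away (grading n) (MvPolynomial.X j)) :
    pull (chartι n j) (le_chartι_preimage n j) ((Proj.awayToSection (grading n) _).hom z) =
      specFun (chartRing n j) z := by
  let e := Proj.basicOpenIsoSpec (grading n) (MvPolynomial.X j) (X_mem n j) one_pos
  have h1 : pull e.hom (le_preimage_top _ ⊤) (specFun (chartRing n j) z) =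
      pull (chart n j).ι (le_ι_preimage _) ((Proj.awayToSection (grading n) _).hom z) := by
    have h2 : (chart n j).ι.appLE (chart n j) ⊤ (le_ι_preimage _) = (chart n j).topIso.inv := by
      rw [Scheme.Hom.appLE, Scheme.Opens.topIso_inv, Scheme.Opens.ι_app]
      erw [← Functor.map_comp]
      rfl
    have h3 := Proj.basicOpenToSpec_app_top (grading n) (MvPolynomial.X j)
    unfold pull
    rw [h2, appLE_top]
    have h4 : e.hom = Proj.basicOpenToSpec (grading n) (MvPolynomial.X j) := rfl
    rw [h4]
    have h5 : (Scheme.ΓSpecIso (chartRing n j)).inv ≫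
        (Proj.basicOpenToSpec (grading n) (MvPolynomial.X j)).appTop = _ ≫ _ :=
      (Iso.inv_comp_eq _).mpr h3
    exact congrArg (fun g => g.hom z) h5
  have h6 : chartι n j = e.inv ≫ (chart n j).ι := rfl
  rw [pull_congr h6 _ (le_chartι_preimage n j), ← pull_pull e.inv (chart n j).ι (le_ι_preimage _)
    (le_preimage_top e.inv ⊤), ← h1, pull_pull, pull_congr e.inv_hom_id _ (le_preimage_top _ ⊤),
    pull_id, res_self]

/-- Scalars, as elements of the ring of a chart. -/
def awayScalar (n : ℕ) (j : Fin (n + 1)) :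
    ℂ →+* HomogeneousLocalization.Away (grading n) (MvPolynomial.X j) :=
  (HomogeneousLocalization.fromZeroRingHom (grading n) _).comp (algebraMap ℂ (grading n 0))

theorem chartι_over (n : ℕ) (j : Fin (n + 1)) :
    chartι n j ≫ (PP n ↘ Spec (.of ℂ)) = Spec.map (CommRingCat.ofHom (awayScalar n j)) := by
  change Proj.awayι _ _ _ _ ≫ Proj.toSpecZero (grading n) ≫ _ = _
  rw [Proj.awayι_toSpecZero_assoc, ← Spec.map_comp]
  rfl

theorem scalar_chartι (n : ℕ) (j : Fin (n + 1)) (c : ℂ) :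
    scalar (chartι n j ≫ (PP n ↘ Spec (.of ℂ))) ⊤ c =
      specFun (chartRing n j) (awayScalar n j c) := by
  rw [chartι_over]
  unfold scalar pull
  rw [appLE_top]
  have := Scheme.ΓSpecIso_inv_naturality (CommRingCat.ofHom (awayScalar n j))
  exact congrArg (fun g => g.hom c) this.symm

/-- The element `xₚ / xⱼ` of the ring of the chart `xⱼ ≠ 0`. -/
def awayRatio (n : ℕ) (p j : Fin (n + 1)) :
    HomogeneousLocalization.Away (grading n) (MvPolynomial.X j) :=
  HomogeneousLocalization.Away.mk (grading n) (X_mem n j) 1 (MvPolynomial.X p) (X_mem n p)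

/-- The polynomial ring, localized at `xⱼ`. -/
abbrev chartLoc (n : ℕ) (j : Fin (n + 1)) : Type :=
  Localization.Away (MvPolynomial.X j : MvPolynomial (Fin (n + 1)) ℂ)

theorem val_awayRatio_mul (n : ℕ) (p j : Fin (n + 1)) :
    (awayRatio n p j).val * algebraMap (MvPolynomial (Fin (n + 1)) ℂ) (chartLoc n j)
      (MvPolynomial.X j) = algebraMap (MvPolynomial (Fin (n + 1)) ℂ) _ (MvPolynomial.X p) := by
  unfold awayRatio
  rw [HomogeneousLocalization.Away.val_mk, ← Localization.mk_one_eq_algebraMap,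
    ← Localization.mk_one_eq_algebraMap, Localization.mk_mul, Localization.mk_eq_mk_iff,
    Localization.r_iff_exists]
  exact ⟨1, by simp [mul_comm]⟩

theorem val_awayScalar (n : ℕ) (j : Fin (n + 1)) (c : ℂ) :
    (awayScalar n j c).val = algebraMap (MvPolynomial (Fin (n + 1)) ℂ) _ (MvPolynomial.C c) := by
  rw [← Localization.mk_one_eq_algebraMap]
  rfl

/-- Evaluation at u sends xⱼ to 1, so it extends to the localization at xⱼ; its restriction to
degree zero is the required map. With `away_hom_ext` this says that the chart ring is the polynomial
ring in the ratios xₚ/xⱼ modulo xⱼ/xⱼ = 1. -/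
theorem away_hom_exists (n : ℕ) (j : Fin (n + 1)) {R : Type} [CommRing R] (σ : ℂ →+* R)
    (u : Fin (n + 1) → R) (hu : u j = 1) :
    ∃ φ : HomogeneousLocalization.Away (grading n) (MvPolynomial.X j) →+* R,
      (∀ c, φ (awayScalar n j c) = σ c) ∧ ∀ p, φ (awayRatio n p j) = u p := by
  let ψ : MvPolynomial (Fin (n + 1)) ℂ →+* R := MvPolynomial.eval₂Hom σ u
  have hψ : ψ (MvPolynomial.X j) = 1 := by simp [ψ, hu]
  let θ : chartLoc n j →+* R :=
    IsLocalization.Away.lift (MvPolynomial.X j) (g := ψ) (by rw [hψ]; exact isUnit_one)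
  have hθ : ∀ p, θ (algebraMap _ _ p) = ψ p := fun p => IsLocalization.Away.lift_eq _ _ _
  refine ⟨θ.comp (algebraMap _ _), fun c => ?_, fun p => ?_⟩
  · rw [RingHom.comp_apply, HomogeneousLocalization.algebraMap_apply, val_awayScalar, hθ]
    simp [ψ]
  · rw [RingHom.comp_apply, HomogeneousLocalization.algebraMap_apply]
    have h2 := congrArg θ (val_awayRatio_mul n p j)
    rw [map_mul, hθ, hθ, hψ, mul_one] at h2
    rw [h2]
    simp [ψ]

/-- The chart ring is generated by scalars and ratios: a fraction p / xⱼᵈ is the dehomogenization of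
p. -/
theorem away_hom_ext (n : ℕ) (j : Fin (n + 1)) {R : Type} [CommRing R]
    {φ ψ : HomogeneousLocalization.Away (grading n) (MvPolynomial.X j) →+* R}
    (hs : ∀ c, φ (awayScalar n j c) = ψ (awayScalar n j c))
    (hr : ∀ p, φ (awayRatio n p j) = ψ (awayRatio n p j)) : φ = ψ := by
  let θ : MvPolynomial (Fin (n + 1)) ℂ →+*
      HomogeneousLocalization.Away (grading n) (MvPolynomial.X j) :=
    MvPolynomial.eval₂Hom (awayScalar n j) (fun p => awayRatio n p j)
  have hθ : φ.comp θ = ψ.comp θ := by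
    apply MvPolynomial.ringHom_ext
    · intro c; simp [θ, hs]
    · intro p; simp [θ, hr]
  -- Here θ is dehomogenization, and homogenizing back by xⱼᵈ recovers p; this is checked on
  -- monomials.
  have key : ∀ (d : ℕ) (p : MvPolynomial (Fin (n + 1)) ℂ), p.IsHomogeneous d →
      (θ p).val * algebraMap (MvPolynomial (Fin (n + 1)) ℂ) _ (MvPolynomial.X j ^ d) =
        algebraMap _ _ p := by
    intro d p hp
    have h1 : ∀ e : Fin (n + 1) →₀ ℕ, e.degree = d → ∀ c : ℂ,
        (θ (MvPolynomial.monomial e c)).val * algebraMap (MvPolynomial (Fin (n + 1)) ℂ) (chartLoc n j) (MvPolynomial.X j ^ d) =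
          algebraMap _ _ (MvPolynomial.monomial e c) := by
      rintro e rfl c
      rw [MvPolynomial.monomial_eq, Finsupp.degree_apply, ← Finset.prod_pow_eq_pow_sum, Finsupp.prod]
      simp only [map_mul, map_prod, map_pow]
      rw [← HomogeneousLocalization.algebraMap_apply]
      simp only [map_mul, map_prod, map_pow, θ, MvPolynomial.coe_eval₂Hom, MvPolynomial.eval₂_C,
        MvPolynomial.eval₂_X]
      simp only [HomogeneousLocalization.algebraMap_apply, val_awayScalar]
      rw [mul_assoc, ← Finset.prod_mul_distrib]
      simp only [← mul_pow, val_awayRatio_mul]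
    rw [← HomogeneousLocalization.algebraMap_apply]
    conv_lhs => rw [p.as_sum]
    conv_rhs => rw [p.as_sum]
    rw [map_sum, map_sum, map_sum, Finset.sum_mul]
    refine Finset.sum_congr rfl fun e he => ?_
    rw [HomogeneousLocalization.algebraMap_apply]
    refine h1 e ?_ _
    have := hp (MvPolynomial.mem_support_iff.mp he)
    rw [Finsupp.degree_eq_weight_one]
    exact this
  have surj : Function.Surjective θ := by
    intro z
    obtain ⟨d, p, hp, rfl⟩ := HomogeneousLocalization.Away.mk_surjective (grading n) (X_mem n j) z
    refine ⟨p, HomogeneousLocalization.val_injective _ ?_⟩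
    rw [HomogeneousLocalization.Away.val_mk]
    have hp' : p.IsHomogeneous d := by simpa using hp
    have hu : IsUnit (algebraMap (MvPolynomial (Fin (n + 1)) ℂ) (chartLoc n j) (MvPolynomial.X j ^ d)) := by
      rw [map_pow]
      exact (IsLocalization.Away.algebraMap_isUnit _).pow d
    rw [← hu.mul_left_inj, key d p hp', ← Localization.mk_one_eq_algebraMap,
          ← Localization.mk_one_eq_algebraMap,
          Localization.mk_mul, Localization.mk_eq_mk_iff, Localization.r_iff_exists]
    exact ⟨1, by simp [mul_comm]⟩
  ext z
  obtain ⟨p, rfl⟩ := surj z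
  exact RingHom.congr_fun hθ p

theorem ratio_eq (n : ℕ) (p j : Fin (n + 1)) :
    ratio n p j = (Proj.awayToSection (grading n) _).hom (awayRatio n p j) := rfl

/-- The point of the chart `xⱼ ≠ 0` with prescribed coordinates. -/
theorem exists_point {n : ℕ} {T : Scheme.{0}} (τ : T ⟶ Spec (.of ℂ)) (j : Fin (n + 1))
    (u : Fin (n + 1) → Γ(T, ⊤)) (hu : u j = 1) :
    ∃ f : T ⟶ PP n, f ≫ (PP n ↘ Spec (.of ℂ)) = τ ∧
      ∃ h : ⊤ ≤ f ⁻¹ᵁ chart n j, ∀ p, pull f h (ratio n p j) = u p := by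
  obtain ⟨φ, hφ, hφ'⟩ := away_hom_exists n j (scalar τ ⊤) u hu
  let b := toSpec (R := chartRing n j) φ
  have hb := le_preimage_top b ⊤
  refine ⟨b ≫ chartι n j, ?_, ?_, fun p => ?_⟩
  · apply scalar_injective_hom
    intro c
    have := pull_scalar b (chartι n j ≫ (PP n ↘ Spec (.of ℂ))) (U := ⊤) hb c
    rw [Category.assoc, ← this, scalar_chartι, pull_toSpec, hφ]
  · exact hb.trans (Scheme.Hom.preimage_mono b (le_chartι_preimage n j))
  · rw [← pull_pull b (chartι n j) (le_chartι_preimage n j) hb, ratio_eq, pull_chartι,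
      pull_toSpec, hφ']

/-- A point of the chart `xⱼ ≠ 0` is determined by its coordinates. -/
theorem point_ext {n : ℕ} {T : Scheme.{0}} {f g : T ⟶ PP n} (j : Fin (n + 1))
    (hfg : f ≫ (PP n ↘ Spec (.of ℂ)) = g ≫ (PP n ↘ Spec (.of ℂ)))
    (hf : ⊤ ≤ f ⁻¹ᵁ chart n j) (hg : ⊤ ≤ g ⁻¹ᵁ chart n j)
    (h : ∀ p, pull f hf (ratio n p j) = pull g hg (ratio n p j)) : f = g := by
  have lift : ∀ k : T ⟶ PP n, ⊤ ≤ k ⁻¹ᵁ chart n j → ∃ k', k = k' ≫ chartι n j := by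
    intro k hk
    refine ⟨IsOpenImmersion.lift (chartι n j) k ?_, (IsOpenImmersion.lift_fac _ _ _).symm⟩
    rintro _ ⟨x, rfl⟩
    have : k x ∈ (chartι n j).opensRange := by
      rw [opensRange_chartι]
      exact hk (Set.mem_univ x)
    exact this
  obtain ⟨f, rfl⟩ := lift f hf
  obtain ⟨g, rfl⟩ := lift g hg
  congr 1
  apply hom_Spec_ext
  have : ∀ k : T ⟶ Spec (chartRing n j), ∃ φ : HomogeneousLocalization.Away (grading n)
      (MvPolynomial.X j) →+* Γ(T, ⊤), ∀ z, φ z = pull k (le_preimage_top k ⊤)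
        (specFun (chartRing n j) z) := fun k => ⟨(pull k (le_preimage_top k ⊤)).comp
        (specFun (chartRing n j)), fun z => rfl⟩
  obtain ⟨φ, hφ⟩ := this f
  obtain ⟨ψ, hψ⟩ := this g
  have hφψ : φ = ψ := by
    apply away_hom_ext
    · intro c
      rw [hφ, hψ, ← scalar_chartι, pull_scalar, pull_scalar]
      simp only [Category.assoc] at hfg
      rw [hfg]
    · intro p
      have := h p
      rwa [← pull_pull f (chartι n j) (le_chartι_preimage n j) (le_preimage_top _ ⊤),
        ← pull_pull g (chartι n j) (le_chartι_preimage n j) (le_preimage_top _ ⊤), ratio_eq, pull_chartι,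
        ← hφ, ← hψ] at this
  intro z
  rw [← hφ, ← hψ, hφψ]

theorem isAffineOpen_chart (n : ℕ) (j : Fin (n + 1)) : IsAffineOpen (chart n j) :=
  Proj.isAffineOpen_basicOpen _ _ (X_mem n j) one_pos

/-- A unit stays a unit in the stalk, and a fraction xⱼ/xᵢ is invertible in the homogeneous
localization at a prime only if xⱼ lies outside that prime. -/
theorem mem_chart_of_isUnit {n : ℕ} {i j : Fin (n + 1)} {V : (PP n).Opens} (h : V ≤ chart n i)
    (hu : IsUnit (res h (ratio n j i))) : V ≤ chart n j := by
  intro x hx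
  have := x.isPrime
  have hx' : IsUnit ((res h (ratio n j i)).1 ⟨x, hx⟩ :
      HomogeneousLocalization.AtPrime (grading n) x.asHomogeneousIdeal.toIdeal) := by
    obtain ⟨b, hb⟩ := hu.exists_right_inv
    refine IsUnit.of_mul_eq_one (b.1 ⟨x, hx⟩) ?_
    exact congrArg (fun s => s.1 ⟨x, hx⟩) hb
  rw [← HomogeneousLocalization.isUnit_iff_isUnit_val] at hx'
  have key : ((res h (ratio n j i)).1 ⟨x, hx⟩).val =
        Localization.mk (MvPolynomial.X j) (⟨MvPolynomial.X i ^ 1,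
          fun hb => h hx (by simpa using hb)⟩ : x.asHomogeneousIdeal.toIdeal.primeCompl) := rfl
  rw [key, Localization.mk_eq_mk', IsLocalization.AtPrime.isUnit_mk'_iff _
    x.asHomogeneousIdeal.toIdeal] at hx'
  exact hx'

/-! ### Ideal sheaves -/

theorem res_mem_ideal {X : Scheme.{0}} (K : X.IdealSheafData) {U V : X.affineOpens}
    (h : V.1 ≤ U.1) {a : Γ(X, U.1)} (ha : a ∈ K.ideal U) : res h a ∈ K.ideal V :=
  K.ideal_le_comap_ideal (U := V) (V := U) h ha

theorem ideal_eq_map_res {X : Scheme.{0}} (K : X.IdealSheafData) {U V : X.affineOpens}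
    (h : V.1 ≤ U.1) : K.ideal V = (K.ideal U).map (res h) :=
  (K.map_ideal (U := V) (V := U) h).symm

theorem isAffineOpen_top_of {X : Scheme.{0}} {V : X.Opens} (hV : IsAffineOpen V) :
    IsAffineOpen (⊤ : V.toScheme.Opens) :=
  have : IsAffine V.toScheme := hV
  isAffineOpen_top _

theorem pull_ι_mem_ideal_comap {X : Scheme.{0}} (K : X.IdealSheafData) {V : X.Opens}
    (hV : IsAffineOpen V) (a : Γ(X, V)) :
    pull V.ι (le_ι_preimage V) a ∈ (K.comap V.ι).ideal ⟨⊤, isAffineOpen_top_of hV⟩ ↔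
      a ∈ K.ideal ⟨V, hV⟩ := by
  rw [Scheme.IdealSheafData.ideal_comap_of_isOpenImmersion]
  have e : V.ι ''ᵁ ⊤ = V := V.ι_image_top
  have hA : IsAffineOpen (V.ι ''ᵁ ⊤) := (isAffineOpen_top_of hV).image_of_isOpenImmersion V.ι
  have h1 : pull V.ι (le_ι_preimage V) a = res e.le a := by
    unfold pull res
    rw [Scheme.Hom.appLE, Scheme.Opens.ι_app]
    erw [← Functor.map_comp]
    rfl
  have h2 : res e.le a ∈ K.ideal ⟨V.ι ''ᵁ ⊤, hA⟩ ↔ a ∈ K.ideal ⟨V, hV⟩ := by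
    constructor
    · intro h
      have := res_mem_ideal K (U := ⟨V.ι ''ᵁ ⊤, hA⟩) (V := ⟨V, hV⟩) e.ge h
      rwa [res_res, res_self] at this
    · exact fun h => res_mem_ideal K (U := ⟨V, hV⟩) (V := ⟨V.ι ''ᵁ ⊤, hA⟩) e.le h
  rw [← h2, h1]
  have h3 : (CommRingCat.Hom.hom (V.ι.appIso ⊤).inv) = RingHom.id _ := by
    rw [Scheme.Opens.ι_appIso]
    rfl
  change (CommRingCat.Hom.hom (V.ι.appIso ⊤).inv) (res e.le a) ∈ K.ideal ⟨V.ι ''ᵁ ⊤, hA⟩ ↔ _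
  rw [h3]
  rfl

/-- Both sides have the same upper bounds: `comap` is left adjoint to `map`, and on affine schemes
inclusions of ideal sheaves can be tested on global sections. -/
theorem ideal_comap_top {X Y : Scheme.{0}} (K : Y.IdealSheafData) (f : X ⟶ Y)
    (hX : IsAffineOpen (⊤ : X.Opens)) (hY : IsAffineOpen (⊤ : Y.Opens)) :
    (K.comap f).ideal ⟨⊤, hX⟩ =
      (K.ideal ⟨⊤, hY⟩).map (pull f (le_preimage_top f ⊤)) := by
  have : IsAffine X :=
    have : IsAffine (⊤ : X.Opens).toScheme := hX
    .of_isIso X.topIso.inv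
  have : IsAffine Y :=
    have : IsAffine (⊤ : Y.Opens).toScheme := hY
    .of_isIso Y.topIso.inv
  have hp : pull f (le_preimage_top f ⊤) = (f.app ⊤).hom := by
    unfold pull
    rw [appLE_top]
    rfl
  have key : ∀ J : X.IdealSheafData, K.comap f ≤ J ↔
      (K.ideal ⟨⊤, hY⟩).map (pull f (le_preimage_top f ⊤)) ≤ J.ideal ⟨⊤, hX⟩ := by
    intro J
    rw [← Scheme.IdealSheafData.le_map_iff_comap_le, Ideal.map_le_iff_le_comap, hp]
    have h1 := J.ideal_map_of_isAffineHom f ⟨⊤, hY⟩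
    constructor
    · intro h
      exact (h ⟨⊤, hY⟩).trans h1.le
    · intro h
      exact Scheme.IdealSheafData.le_of_isAffine (h.trans h1.ge)
  apply le_antisymm
  · let J := Scheme.IdealSheafData.equivOfIsAffine.symm
      ((K.ideal ⟨⊤, hY⟩).map (pull f (le_preimage_top f ⊤)))
    have hJ : J.ideal ⟨⊤, hX⟩ = (K.ideal ⟨⊤, hY⟩).map (pull f (le_preimage_top f ⊤)) := by
      exact Scheme.IdealSheafData.equivOfIsAffine.apply_symm_apply _
    exact (((key J).mpr hJ.ge) ⟨⊤, hX⟩).trans hJ.le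
  · exact (key _).mp le_rfl

/-- The inverse image of an ideal sheaf over affine open sets. -/
theorem ideal_comap {X Y : Scheme.{0}} (K : Y.IdealSheafData) (f : X ⟶ Y) {V : X.Opens}
    {U : Y.Opens} (hV : IsAffineOpen V) (hU : IsAffineOpen U) (h : V ≤ f ⁻¹ᵁ U) :
    (K.comap f).ideal ⟨V, hV⟩ = (K.ideal ⟨U, hU⟩).map (pull f h) := by
  -- Restricting f to a morphism V → U reduces the claim to affine schemes. The bijections between
  -- functions on an open set and on the corresponding open subscheme carry the result back.
  let g := f.resLE U V h
  have hg : g ≫ U.ι = V.ι ≫ f := Scheme.Hom.resLE_comp_ι f h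
  have h1 : (K.comap f).comap V.ι = (K.comap U.ι).comap g := by
    rw [← Scheme.IdealSheafData.comap_comp, ← Scheme.IdealSheafData.comap_comp, hg]
  have h2 := ideal_comap_top (K.comap U.ι) g (isAffineOpen_top_of hV) (isAffineOpen_top_of hU)
  have h3 : (K.comap U.ι).ideal ⟨⊤, isAffineOpen_top_of hU⟩ =
      (K.ideal ⟨U, hU⟩).map (pull U.ι (le_ι_preimage U)) := by
    apply le_antisymm
    · intro b hb
      obtain ⟨a, rfl⟩ := (pull_ι_bijective U (le_ι_preimage U)).2 b
      exact Ideal.mem_map_of_mem _ ((pull_ι_mem_ideal_comap K hU a).mp hb)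
    · rw [Ideal.map_le_iff_le_comap]
      exact fun a ha => (pull_ι_mem_ideal_comap K hU a).mpr ha
  have h4 : (pull g (le_preimage_top g ⊤)).comp (pull U.ι (le_ι_preimage U)) =
      (pull V.ι (le_ι_preimage V)).comp (pull f h) := by
    ext a
    rw [RingHom.comp_apply, RingHom.comp_apply, pull_pull, pull_pull]
    exact pull_congr hg _ _ a
  rw [h3, Ideal.map_map, h4, ← Ideal.map_map] at h2
  ext a
  rw [← pull_ι_mem_ideal_comap (K.comap f) hV, h1, h2]
  have hb := pull_ι_bijective V (le_ι_preimage V)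
  let e := RingEquiv.ofBijective _ hb
  constructor
  · intro ha
    rw [Ideal.mem_map_iff_of_surjective _ hb.2] at ha
    obtain ⟨x, hx, hxa⟩ := ha
    rwa [← hb.1 hxa]
  · exact fun ha => Ideal.mem_map_of_mem _ ha

/-- An infimum of ideal sheaves could be larger on `U i` than the span of the generators. That it is
not is shown by exhibiting a quasi-coherent ideal sheaf that contains all generators and has exactly
this value. Compatibility on overlaps guarantees that this sheaf contains the generators. -/
theorem ideal_idealGeneratedBy {X : Scheme.{0}} [X.IsSeparated] {ι : Type} [Finite ι]
    (U : ι → X.Opens) (hU : ∀ i, IsAffineOpen (U i)) (hcov : ⨆ i, U i = ⊤)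
    (S : ∀ i, Set Γ(X, U i))
    (compat : ∀ i k, ∀ a ∈ S k, res (inf_le_right : U i ⊓ U k ≤ U k) a ∈
      Ideal.span (res (inf_le_left : U i ⊓ U k ≤ U i) '' S i)) (i : ι) :
    (idealGeneratedBy U S).ideal ⟨U i, hU i⟩ = Ideal.span (S i) := by
  let J' : ∀ i, (U i).toScheme.IdealSheafData := fun i =>
    Scheme.IdealSheafData.ofIdealTop ((Ideal.span (S i)).map (pull (U i).ι (le_ι_preimage _)))
  -- A function lies in J exactly when its restriction to each `U i` lies in the ideal generated
  -- there by `S i`.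
  let J : X.IdealSheafData := ⨅ i, (J' i).map (U i).ι
  have hJ' : ∀ (i : ι) (V : X.affineOpens) (a : Γ(X, V.1)), a ∈ ((J' i).map (U i).ι).ideal V ↔
      res (inf_le_right : U i ⊓ V.1 ≤ V.1) a ∈
        Ideal.span (res (inf_le_left : U i ⊓ V.1 ≤ U i) '' S i) := by
    intro i V a
    have : IsAffine (U i).toScheme := hU i
    -- This uses separatedness: a morphism from an affine scheme to a separated scheme is affine.
    -- Hence the pushed-forward ideal is simply a preimage.
    have : IsAffineHom (U i).ι := by
      have : IsAffineHom ((U i).ι ≫ Limits.terminal.from X) := inferInstance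
      exact IsAffineHom.of_comp (U i).ι (Limits.terminal.from X)
    rw [Scheme.IdealSheafData.ideal_map_of_isAffineHom, Ideal.mem_comap]
    have hle : (U i).ι ⁻¹ᵁ V.1 ≤ (U i).ι ⁻¹ᵁ (U i ⊓ V.1) := by
      intro x hx
      exact ⟨x.2, hx⟩
    let β := pull (U i).ι hle
    have hβ : Function.Bijective β :=
      pull_ι_bijective' inf_le_left hle (Scheme.Hom.preimage_mono _ inf_le_right)
    have h3 : ((U i).ι.app V.1).hom a = β (res inf_le_right a) := by
      rw [pull_res]
      unfold pull
      rw [Scheme.Hom.appLE_eq_app]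
    have h4 : (J' i).ideal ⟨(U i).ι ⁻¹ᵁ V.1, V.2.preimage (U i).ι⟩ =
        (Ideal.span (res (inf_le_left : U i ⊓ V.1 ≤ U i) '' S i)).map β := by
      rw [Scheme.IdealSheafData.ofIdealTop_ideal, Ideal.map_map, Ideal.map_span, Ideal.map_span,
        ← Set.image_comp]
      congr 1
      apply Set.image_congr
      intro a _
      exact (res_pull _ _ le_top a).trans (pull_res _ _ _ _).symm
    rw [h4, h3, Ideal.mem_map_iff_of_surjective _ hβ.2]
    constructor
    · rintro ⟨x, hx, hxa⟩
      rwa [← hβ.1 hxa]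
    · exact fun h => ⟨_, h, rfl⟩
  have hJ : ∀ (V : X.affineOpens) (a : Γ(X, V.1)), a ∈ J.ideal V ↔ ∀ i,
      res (inf_le_right : U i ⊓ V.1 ≤ V.1) a ∈
        Ideal.span (res (inf_le_left : U i ⊓ V.1 ≤ U i) '' S i) := by
    intro V a
    have : J.ideal V = ⨅ i, ((J' i).map (U i).ι).ideal V := by
      rw [Scheme.IdealSheafData.ideal_iInf, iInf_apply]
    rw [this, Ideal.mem_iInf]
    exact forall_congr' fun i => hJ' i V a
  have hJset : ∀ (k : ι) (V : X.affineOpens) (h : V.1 ≤ U k), ∀ a ∈ S k,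
      res h a ∈ J.ideal V := by
    intro k V h a ha
    rw [hJ]
    intro i
    have := Ideal.mem_map_of_mem (res (inf_le_inf_left (U i) h)) (compat i k a ha)
    rw [Ideal.map_span, ← Set.image_comp, res_res] at this
    rw [res_res]
    convert this using 2
    exact Set.image_congr fun b _ => (res_res _ _ b).symm
  have hJi : ∀ i, J.ideal ⟨U i, hU i⟩ ≤ Ideal.span (S i) := by
    intro i a ha
    have h1 := (hJ _ a).mp ha i
    have h2 : U i ≤ U i ⊓ U i := le_inf le_rfl le_rfl
    have h3 := Ideal.mem_map_of_mem (res h2) h1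
    rw [Ideal.map_span, ← Set.image_comp, res_res, res_self] at h3
    have h4 : (res h2 ∘ res (inf_le_left : U i ⊓ U i ≤ U i)) '' S i = S i := by
      refine (Set.image_congr fun b _ => ?_).trans (Set.image_id _)
      rw [Function.comp_apply, res_res, res_self]
      rfl
    rwa [h4] at h3
  have hge : ∀ I : X.IdealSheafData, (∀ (k : ι) (V : X.affineOpens) (h : V.1 ≤ U k), ∀ a ∈ S k,
      res h a ∈ I.ideal V) → ∀ i, Ideal.span (S i) ≤ I.ideal ⟨U i, hU i⟩ := by
    intro I hI i
    rw [Ideal.span_le]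
    intro a ha
    have := hI i ⟨U i, hU i⟩ le_rfl a ha
    rwa [res_self] at this
  have heq : idealGeneratedBy U S = J := by
    apply le_antisymm
    · exact sInf_le hJset
    · apply le_sInf
      intro I hI
      apply Scheme.IdealSheafData.le_of_iSup_eq_top (fun i => ⟨U i, hU i⟩) hcov
      exact fun i => (hJi i).trans (hge I hI i)
  rw [heq]
  exact le_antisymm (hJi i) (hge J hJset i)

/-! ### Cartier divisors -/

theorem res_mem_nonZeroDivisors {X : Scheme.{0}} {U : X.Opens} (hU : IsAffineOpen U)
    (b : Γ(X, U)) {a : Γ(X, U)} (ha : a ∈ nonZeroDivisors Γ(X, U)) :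
    res (X.basicOpen_le b) a ∈ nonZeroDivisors Γ(X, X.basicOpen b) := by
  have := hU.isLocalization_basicOpen b
  exact IsLocalization.map_nonZeroDivisors_le (Submonoid.powers b) Γ(X, X.basicOpen b)
    (Submonoid.mem_map_of_mem _ ha)

theorem map_mem_nonZeroDivisors_of_bijective {R R' : Type} [CommRing R] [CommRing R']
    {φ : R →+* R'} (hφ : Function.Bijective φ) {a : R} (ha : a ∈ nonZeroDivisors R) :
    φ a ∈ nonZeroDivisors R' := by
  rw [mem_nonZeroDivisors_iff_right] at ha ⊢
  intro x hx
  obtain ⟨x, rfl⟩ := hφ.2 x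
  rw [← map_mul, map_eq_zero_iff φ hφ.1] at hx
  rw [ha x hx, map_zero]

theorem IsCartier.exists_le {X : Scheme.{0}} {K : X.IdealSheafData} (hK : IsCartier K) (x : X)
    (O : X.Opens) (hx : x ∈ O) :
    ∃ (V : X.Opens) (hV : IsAffineOpen V), x ∈ V ∧ V ≤ O ∧
      ∃ a ∈ nonZeroDivisors Γ(X, V), K.ideal ⟨V, hV⟩ = Ideal.span {a} := by
  obtain ⟨⟨U, hU⟩, hxU, a, ha, hKa⟩ := hK x
  obtain ⟨b, hb, hxb⟩ := hU.exists_basicOpen_le ⟨x, hx⟩ hxU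
  refine ⟨X.basicOpen b, hU.basicOpen b, hxb, hb, res (X.basicOpen_le b) a,
    res_mem_nonZeroDivisors hU b ha, ?_⟩
  rw [ideal_eq_map_res K (U := ⟨U, hU⟩) (V := ⟨X.basicOpen b, hU.basicOpen b⟩)
    (X.basicOpen_le b), hKa, Ideal.map_span, Set.image_singleton]

/-! ### Coordinates -/

/-- The coordinates `xₚ / xⱼ` of a point of `ℙⁿ` in the chart `xⱼ ≠ 0`. -/
def coord {n : ℕ} {T : Scheme.{0}} (f : T ⟶ PP n) {V : T.Opens} {j : Fin (n + 1)}
    (h : V ≤ f ⁻¹ᵁ chart n j) (p : Fin (n + 1)) : Γ(T, V) :=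
  pull f h (ratio n p j)

/-- The values of the linear forms with coefficients `A` at a point of `ℙⁿ`, divided by `xⱼ`. -/
def formValues {m n : ℕ} (A : Matrix (Fin (m + 1)) (Fin (n + 1)) ℂ) {T : Scheme.{0}}
    (f : T ⟶ PP n) {V : T.Opens} {j : Fin (n + 1)} (h : V ≤ f ⁻¹ᵁ chart n j) :
    Fin (m + 1) → Γ(T, V) :=
  (A.map (scalar (f ≫ (PP n ↘ Spec (.of ℂ))) V)).mulVec (coord f h)

section

variable {m n : ℕ} {T T' : Scheme.{0}}

theorem coord_self (f : T ⟶ PP n) {V : T.Opens} {j : Fin (n + 1)} (h : V ≤ f ⁻¹ᵁ chart n j) :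
    coord f h j = 1 := by
  rw [coord, ratio_self, map_one]

theorem res_coord (f : T ⟶ PP n) {V W : T.Opens} {j : Fin (n + 1)} (h : V ≤ f ⁻¹ᵁ chart n j)
    (hW : W ≤ V) (p : Fin (n + 1)) : res hW (coord f h p) = coord f (hW.trans h) p :=
  res_pull f h hW _

theorem pull_coord (g : T' ⟶ T) (f : T ⟶ PP n) {V : T.Opens} {W : T'.Opens} {j : Fin (n + 1)}
    (h : V ≤ f ⁻¹ᵁ chart n j) (hW : W ≤ g ⁻¹ᵁ V) (p : Fin (n + 1)) :
    pull g hW (coord f h p) =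
      coord (g ≫ f) (hW.trans (Scheme.Hom.preimage_mono g h) : W ≤ (g ≫ f) ⁻¹ᵁ chart n j) p :=
  pull_pull g f h hW _

theorem coord_congr {f g : T ⟶ PP n} (e : f = g) {V : T.Opens} {j : Fin (n + 1)}
    (h : V ≤ f ⁻¹ᵁ chart n j) (h' : V ≤ g ⁻¹ᵁ chart n j) (p : Fin (n + 1)) :
    coord f h p = coord g h' p :=
  pull_congr e h h' _

theorem coord_mul_coord (f : T ⟶ PP n) {V : T.Opens} {i j : Fin (n + 1)}
    (hi : V ≤ f ⁻¹ᵁ chart n i) (hj : V ≤ f ⁻¹ᵁ chart n j) (p : Fin (n + 1)) :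
    coord f hi j * coord f hj p = coord f hi p := by
  have h : V ≤ f ⁻¹ᵁ (chart n i ⊓ chart n j) := fun x hx => ⟨hi hx, hj hx⟩
  have := congrArg (pull f h) (ratio_mul_ratio n i j p inf_le_left inf_le_right)
  rwa [map_mul, pull_res, pull_res, pull_res] at this

/-- This lets a point be moved from one chart to another once the relevant coordinate is known to be
invertible. -/
theorem le_preimage_chart_of_isUnit (f : T ⟶ PP n) {V : T.Opens} {i j : Fin (n + 1)}
    (h : V ≤ f ⁻¹ᵁ chart n i) (hu : IsUnit (coord f h j)) : V ≤ f ⁻¹ᵁ chart n j := by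
  have h1 : T.basicOpen (coord f h j) = V := T.basicOpen_of_isUnit hu
  have h2 : T.basicOpen (coord f h j) = V ⊓ f ⁻¹ᵁ ((PP n).basicOpen (ratio n j i)) :=
    Scheme.basicOpen_appLE f V _ h _
  have h3 : (PP n).basicOpen (ratio n j i) ≤ chart n j :=
    mem_chart_of_isUnit ((PP n).basicOpen_le _)
      (RingedSpace.isUnit_res_basicOpen _ (ratio n j i))
  rw [h1] at h2
  exact (h2.le.trans inf_le_right).trans (Scheme.Hom.preimage_mono f h3)

theorem point_ext_of_coord {f g : T ⟶ PP n} (j : Fin (n + 1)) {V : T.Opens}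
    (hfg : f ≫ (PP n ↘ Spec (.of ℂ)) = g ≫ (PP n ↘ Spec (.of ℂ)))
    (hf : V ≤ f ⁻¹ᵁ chart n j) (hg : V ≤ g ⁻¹ᵁ chart n j)
    (h : ∀ p, coord f hf p = coord g hg p) : V.ι ≫ f = V.ι ≫ g := by
  refine point_ext j (by rw [Category.assoc, Category.assoc, hfg])
    ((le_ι_preimage V).trans (Scheme.Hom.preimage_mono _ hf))
    ((le_ι_preimage V).trans (Scheme.Hom.preimage_mono _ hg)) fun p => ?_
  have := congrArg (pull V.ι (le_ι_preimage V)) (h p)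
  rwa [pull_coord, pull_coord] at this

theorem exists_mem_chart (f : T ⟶ PP n) (t : T) : ∃ j, t ∈ f ⁻¹ᵁ chart n j := by
  have : f t ∈ ⨆ j, chart n j := by
    rw [iSup_chart]
    trivial
  obtain ⟨j, hj⟩ := TopologicalSpace.Opens.mem_iSup.mp this
  exact ⟨j, hj⟩

theorem res_formValues (A : Matrix (Fin (m + 1)) (Fin (n + 1)) ℂ) (f : T ⟶ PP n) {V W : T.Opens}
    {j : Fin (n + 1)} (h : V ≤ f ⁻¹ᵁ chart n j) (hW : W ≤ V) (q : Fin (m + 1)) :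
    res hW (formValues A f h q) = formValues A f (hW.trans h) q := by
  simp only [formValues, Matrix.mulVec, dotProduct, Matrix.map_apply, map_sum, map_mul, res_scalar,
    res_coord]

theorem pull_formValues (A : Matrix (Fin (m + 1)) (Fin (n + 1)) ℂ) (g : T' ⟶ T) (f : T ⟶ PP n)
    {V : T.Opens} {W : T'.Opens} {j : Fin (n + 1)} (h : V ≤ f ⁻¹ᵁ chart n j)
    (hW : W ≤ g ⁻¹ᵁ V) (q : Fin (m + 1)) :
    pull g hW (formValues A f h q) = formValues A (g ≫ f)
      (hW.trans (Scheme.Hom.preimage_mono g h) : W ≤ (g ≫ f) ⁻¹ᵁ chart n j) q := by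
  simp only [formValues, Matrix.mulVec, dotProduct, Matrix.map_apply, map_sum, map_mul,
    pull_scalar, pull_coord, Category.assoc]

theorem formValues_congr (A : Matrix (Fin (m + 1)) (Fin (n + 1)) ℂ) {f g : T ⟶ PP n} (e : f = g)
    {V : T.Opens} {j : Fin (n + 1)} (h : V ≤ f ⁻¹ᵁ chart n j) (h' : V ≤ g ⁻¹ᵁ chart n j)
    (q : Fin (m + 1)) : formValues A f h q = formValues A g h' q := by
  subst e
  rfl

theorem coord_mul_formValues (A : Matrix (Fin (m + 1)) (Fin (n + 1)) ℂ) (f : T ⟶ PP n)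
    {V : T.Opens} {i j : Fin (n + 1)} (hi : V ≤ f ⁻¹ᵁ chart n i) (hj : V ≤ f ⁻¹ᵁ chart n j)
    (q : Fin (m + 1)) : coord f hi j * formValues A f hj q = formValues A f hi q := by
  simp only [formValues, Matrix.mulVec, dotProduct, Matrix.map_apply, Finset.mul_sum]
  refine Finset.sum_congr rfl fun p _ => ?_
  rw [mul_left_comm, coord_mul_coord]

theorem formValues_one (f : T ⟶ PP n) {V : T.Opens} {j : Fin (n + 1)}
    (h : V ≤ f ⁻¹ᵁ chart n j) : formValues 1 f h = coord f h := by
  rw [formValues, Matrix.map_one _ (map_zero _) (map_one _), Matrix.one_mulVec]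

end

/-! ### The ideal of a linear subspace -/

section

variable {m n : ℕ}

instance : (PP n).IsSeparated := inferInstanceAs (Scheme.IsSeparated (Proj _))

instance : IsSeparated (PP n ↘ Spec (.of ℂ)) :=
  inferInstanceAs (IsSeparated (Proj.toSpecZero (grading n) ≫ Spec.map _))

theorem linearForm_eq (n : ℕ) (j : Fin (n + 1)) (c : Fin (n + 1) → ℂ) :
    ∑ p, c p • ratio n p j = ∑ p, scalar (PP n ↘ Spec (.of ℂ)) (chart n j) (c p) * ratio n p j :=
  Finset.sum_congr rfl fun _ _ => smul_eq_scalar_mul _ _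

/-- The generators are compatible because passing from chart k to chart i multiplies every linear
form by the same ratio xᵢ/xₖ. -/
theorem linearSubspaceIdeal_chart (L : Submodule ℂ (Fin (n + 1) → ℂ)) (j : Fin (n + 1)) :
    (linearSubspaceIdeal n L).ideal ⟨chart n j, isAffineOpen_chart n j⟩ = Ideal.span
      {a | ∃ ℓ ∈ L.dualAnnihilator, a = ∑ p, ℓ (Pi.single p 1) • ratio n p j} := by
  apply ideal_idealGeneratedBy (chart n) (isAffineOpen_chart n) (iSup_chart n)
  rintro i k _ ⟨ℓ, hℓ, rfl⟩
  have h1 : res (inf_le_right : chart n i ⊓ chart n k ≤ chart n k)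
      (∑ p, ℓ (Pi.single p 1) • ratio n p k) = res inf_le_right (ratio n i k) *
        res inf_le_left (∑ p, ℓ (Pi.single p 1) • ratio n p i) := by
    rw [linearForm_eq, linearForm_eq, map_sum, map_sum, Finset.mul_sum]
    refine Finset.sum_congr rfl fun p _ => ?_
    rw [map_mul, map_mul, res_scalar, res_scalar, mul_left_comm, ratio_mul_ratio]
  rw [h1]
  exact Ideal.mul_mem_left _ _ (Ideal.subset_span ⟨_, ⟨ℓ, hℓ, rfl⟩, rfl⟩)

/-- The annihilator of ker A is the row space of A, so finitely many generators, the rows, suffice.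
-/
theorem linearSubspaceIdeal_ker (A : Matrix (Fin (m + 1)) (Fin (n + 1)) ℂ) (j : Fin (n + 1)) :
    (linearSubspaceIdeal n (LinearMap.ker A.mulVecLin)).ideal
      ⟨chart n j, isAffineOpen_chart n j⟩ =
      Ideal.span (Set.range fun q => ∑ p, A q p • ratio n p j) := by
  rw [linearSubspaceIdeal_chart]
  apply le_antisymm
  · rw [Ideal.span_le]
    rintro _ ⟨ℓ, hℓ, rfl⟩
    rw [← LinearMap.range_dualMap_eq_dualAnnihilator_ker] at hℓ
    obtain ⟨k, rfl⟩ := hℓ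
    have h1 : ∑ p, (A.mulVecLin.dualMap k) (Pi.single p 1) • ratio n p j =
        ∑ q, k (Pi.single q 1) • ∑ p, A q p • ratio n p j := by
      have h2 : ∀ p, (A.mulVecLin.dualMap k) (Pi.single p 1) =
          ∑ q, k (Pi.single q 1) * A q p := by
        intro p
        rw [LinearMap.dualMap_apply, Matrix.mulVecLin_apply, Matrix.mulVec_single_one,
          LinearMap.pi_apply_eq_sum_univ k]
        refine Finset.sum_congr rfl fun q _ => ?_
        rw [smul_eq_mul, mul_comm]
        congr 2
        ext x
        simp [Pi.single_apply, eq_comm]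
      simp only [h2, Finset.sum_smul, Finset.smul_sum, smul_smul]
      exact Finset.sum_comm
    rw [h1]
    refine Ideal.sum_mem _ fun q _ => ?_
    rw [smul_eq_scalar_mul]
    exact Ideal.mul_mem_left _ _ (Ideal.subset_span ⟨q, rfl⟩)
  · rw [Ideal.span_le]
    rintro _ ⟨q, rfl⟩
    refine Ideal.subset_span ⟨A.mulVecLin.dualMap (LinearMap.proj q), ?_, ?_⟩
    · rw [← LinearMap.range_dualMap_eq_dualAnnihilator_ker]
      exact ⟨_, rfl⟩
    · refine Finset.sum_congr rfl fun p _ => ?_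
      congr 1
      simp

theorem ideal_comap_ker (A : Matrix (Fin (m + 1)) (Fin (n + 1)) ℂ) {T : Scheme.{0}}
    (f : T ⟶ PP n) {V : T.Opens} (hV : IsAffineOpen V) {j : Fin (n + 1)}
    (h : V ≤ f ⁻¹ᵁ chart n j) :
    ((linearSubspaceIdeal n (LinearMap.ker A.mulVecLin)).comap f).ideal ⟨V, hV⟩ =
      Ideal.span (Set.range (formValues A f h)) := by
  rw [ideal_comap _ f hV (isAffineOpen_chart n j) h, linearSubspaceIdeal_ker, Ideal.map_span,
    ← Set.range_comp]
  congr 2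
  ext q
  simp only [Function.comp_apply, linearForm_eq, map_sum, map_mul, pull_scalar, formValues,
    Matrix.mulVec, dotProduct, Matrix.map_apply]
  rfl

end

/-! ### Zero loci of sections given by matrices -/

section

variable {m n : ℕ}

instance : IsSeparated (pr₁ m n) :=
  inferInstanceAs (IsSeparated (Limits.pullback.fst _ _))

instance : (PPprod m n).IsSeparated where
  isSeparated_terminal_from := by
    have : pr₁ m n ≫ Limits.terminal.from (PP m) = Limits.terminal.from _ :=
      Limits.terminal.hom_ext _ _
    rw [← this]
    infer_instance

/-- The chart `yᵢ ≠ 0`, `xⱼ ≠ 0` of `ℙᵐ × ℙⁿ`. -/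
abbrev prodChart (m n : ℕ) (i : Fin (m + 1)) (j : Fin (n + 1)) : (PPprod m n).Opens :=
  pr₁ m n ⁻¹ᵁ chart m i ⊓ pr₂ m n ⁻¹ᵁ chart n j

theorem isAffineOpen_prodChart (i : Fin (m + 1)) (j : Fin (n + 1)) :
    IsAffineOpen (prodChart m n i j) := by
  have h1 : IsPullback ((pr₁ m n ⁻¹ᵁ chart m i).ι ≫ pr₂ m n) (pr₁ m n ∣_ chart m i)
      (PP n ↘ Spec (.of ℂ)) ((chart m i).ι ≫ (PP m ↘ Spec (.of ℂ))) :=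
    ((isPullback_morphismRestrict (pr₁ m n) (chart m i)).flip.paste_horiz
      (IsPullback.of_hasPullback (PP m ↘ Spec (.of ℂ)) (PP n ↘ Spec (.of ℂ))).flip).flip.flip
  have : IsAffine (chart m i).toScheme := isAffineOpen_chart m i
  -- The second projection, restricted to the preimage of an affine chart of ℙᵐ, is a base change of
  -- the affine morphism from that chart to Spec ℂ.
  have h2 : IsAffineHom ((pr₁ m n ⁻¹ᵁ chart m i).ι ≫ pr₂ m n) :=
    MorphismProperty.of_isPullback h1.flip inferInstance
  have h3 := (isAffineOpen_chart n j).preimage ((pr₁ m n ⁻¹ᵁ chart m i).ι ≫ pr₂ m n)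
  have h4 := h3.image_of_isOpenImmersion (pr₁ m n ⁻¹ᵁ chart m i).ι
  have h5 : (pr₁ m n ⁻¹ᵁ chart m i).ι ''ᵁ
      (((pr₁ m n ⁻¹ᵁ chart m i).ι ≫ pr₂ m n) ⁻¹ᵁ chart n j) = prodChart m n i j := by
    ext x
    constructor
    · rintro ⟨y, hy, rfl⟩
      exact ⟨y.2, hy⟩
    · rintro ⟨hx, hx'⟩
      exact ⟨⟨x, hx⟩, hx', rfl⟩
  rwa [h5] at h4

/-- The coordinates of a section of `Q(0,1)` on the chart `yᵢ ≠ 0`, `xⱼ ≠ 0`. -/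
def localCoord (s : (Q01 m n).globalSections) (i : Fin (m + 1)) (j : Fin (n + 1))
    (q : {q : Fin (m + 1) // q ≠ i}) : Γ(PPprod m n, prodChart m n i j) :=
  s.1 (i, j) (q, ())

/-- The local coordinates of the section of `Q(0,1)` that maps `([y], [x])` to the class of `A x`
modulo `y`. -/
def matrixCoord (A : Matrix (Fin (m + 1)) (Fin (n + 1)) ℂ) (i : Fin (m + 1)) (j : Fin (n + 1))
    (q : Fin (m + 1)) : Γ(PPprod m n, prodChart m n i j) :=
  formValues A (pr₂ m n) inf_le_right q -
    coord (pr₁ m n) inf_le_left q * formValues A (pr₂ m n) inf_le_right i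

/-- The section `s` maps `([y], [x])` to the class of `A x` modulo `y`. -/
def IsMatrixSection (A : Matrix (Fin (m + 1)) (Fin (n + 1)) ℂ) (s : (Q01 m n).globalSections) :
    Prop :=
  ∀ i j q, localCoord s i j q = matrixCoord A i j q

theorem pull_matrixCoord (A : Matrix (Fin (m + 1)) (Fin (n + 1)) ℂ) {T : Scheme.{0}}
    (k : T ⟶ PPprod m n) {V : T.Opens} {i : Fin (m + 1)} {j : Fin (n + 1)}
    (h : V ≤ k ⁻¹ᵁ prodChart m n i j) (hi : V ≤ (k ≫ pr₁ m n) ⁻¹ᵁ chart m i)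
    (hj : V ≤ (k ≫ pr₂ m n) ⁻¹ᵁ chart n j) (q : Fin (m + 1)) :
    pull k h (matrixCoord A i j q) = formValues A (k ≫ pr₂ m n) hj q -
      coord (k ≫ pr₁ m n) hi q * formValues A (k ≫ pr₂ m n) hj i := by
  rw [matrixCoord, map_sub, map_mul, pull_formValues, pull_formValues, pull_coord]

theorem globalSections_rel {E : VecBundle (PPprod m n)} (s : E.globalSections) (a b : E.Idx)
    (c : E.Frame a) : res (inf_le_left : E.U a ⊓ E.U b ≤ E.U a) (s.1 a c) =
      ∑ d, E.g a b c d * res (inf_le_right : E.U a ⊓ E.U b ≤ E.U b) (s.1 b d) :=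
  congrFun (s.2 a b) c

/-- On an overlap, the transition matrix expresses the coordinates in one frame as combinations of
those in the other; this is the compatibility that `ideal_idealGeneratedBy` requires. -/
theorem zeroIdeal_prodChart (s : (Q01 m n).globalSections) (i : Fin (m + 1)) (j : Fin (n + 1)) :
    ((Q01 m n).zeroIdeal s).ideal ⟨prodChart m n i j, isAffineOpen_prodChart i j⟩ =
      Ideal.span (Set.range (localCoord s i j)) := by
  have : Finite (Q01 m n).Idx := inferInstanceAs (Finite (Fin (m + 1) × Fin (n + 1)))
  have key : ∀ a, ((Q01 m n).zeroIdeal s).ideal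
      ⟨(Q01 m n).U a, isAffineOpen_prodChart a.1 a.2⟩ = Ideal.span (Set.range (s.1 a)) := by
    refine ideal_idealGeneratedBy (Q01 m n).U (fun a => isAffineOpen_prodChart a.1 a.2)
      (Q01 m n).cover _ ?_
    rintro a b _ ⟨c, rfl⟩
    have h1 := globalSections_rel s b a c
    have h2 : (Q01 m n).U a ⊓ (Q01 m n).U b ≤ (Q01 m n).U b ⊓ (Q01 m n).U a :=
      le_inf inf_le_right inf_le_left
    have h3 := congrArg (res h2) h1
    rw [res_res, map_sum] at h3
    rw [h3]
    refine Ideal.sum_mem _ fun d _ => ?_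
    rw [map_mul, res_res]
    exact Ideal.mul_mem_left _ _ (Ideal.subset_span ⟨_, ⟨d, rfl⟩, rfl⟩)
  have h : Set.range (localCoord s i j) = Set.range (s.1 (i, j)) := by
    ext a
    constructor
    · rintro ⟨q, rfl⟩
      exact ⟨(q, ()), rfl⟩
    · rintro ⟨⟨q, _⟩, rfl⟩
      exact ⟨q, rfl⟩
  rw [h]
  exact key (i, j)

instance (s : (Q01 m n).globalSections) : IsClosedImmersion ((Q01 m n).zeroLocusι s) :=
  inferInstanceAs (IsClosedImmersion ((Q01 m n).zeroIdeal s).subschemeι)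

/-! ### The zero locus through its points: Ax = (Ax)ᵢ y -/

theorem formValues_zeroLocus {A : Matrix (Fin (m + 1)) (Fin (n + 1)) ℂ}
    {s : (Q01 m n).globalSections} (hs : IsMatrixSection A s) {T : Scheme.{0}}
    (z : T ⟶ (Q01 m n).zeroLocus s) (k : T ⟶ PPprod m n) (hk : z ≫ (Q01 m n).zeroLocusι s = k)
    {V : T.Opens} {i : Fin (m + 1)} {j : Fin (n + 1)} (hi : V ≤ (k ≫ pr₁ m n) ⁻¹ᵁ chart m i)
    (hj : V ≤ (k ≫ pr₂ m n) ⁻¹ᵁ chart n j) (q : Fin (m + 1)) :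
    formValues A (k ≫ pr₂ m n) hj q =
      coord (k ≫ pr₁ m n) hi q * formValues A (k ≫ pr₂ m n) hj i := by
  -- The frame of Q omits the index i, where the equation is trivial because yᵢ/yᵢ = 1.
  by_cases hq : q = i
  · subst hq
    rw [coord_self, one_mul]
  have hV : V ≤ k ⁻¹ᵁ prodChart m n i j := fun x hx => ⟨hi hx, hj hx⟩
  have h1 : localCoord s i j ⟨q, hq⟩ ∈
      ((Q01 m n).zeroIdeal s).ideal ⟨prodChart m n i j, isAffineOpen_prodChart i j⟩ := by
    rw [zeroIdeal_prodChart]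
    exact Ideal.subset_span ⟨_, rfl⟩
  rw [← Scheme.IdealSheafData.ker_subschemeι_app, RingHom.mem_ker] at h1
  have h2 : pull k hV (localCoord s i j ⟨q, hq⟩) = 0 := by
    subst hk
    have h3 : V ≤ z ⁻¹ᵁ ((Q01 m n).zeroLocusι s ⁻¹ᵁ prodChart m n i j) := hV
    have h4 : pull ((Q01 m n).zeroLocusι s) le_rfl (localCoord s i j ⟨q, hq⟩) = 0 := by
      unfold pull
      rw [Scheme.Hom.appLE_eq_app]
      exact h1
    rw [← pull_pull z ((Q01 m n).zeroLocusι s) le_rfl h3]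
    erw [h4]
    exact map_zero _
  rwa [hs, pull_matrixCoord A k hV hi hj, sub_eq_zero] at h2

/-- A morphism factors through a closed subscheme when the ideal of the subscheme lies in its
kernel. The vanishing of functions is local, and on a product chart the ideal is generated by the
differences (Ax)_q - y_q (Ax)ᵢ. -/
theorem exists_lift_zeroLocus {A : Matrix (Fin (m + 1)) (Fin (n + 1)) ℂ}
    {s : (Q01 m n).globalSections} (hs : IsMatrixSection A s) {T : Scheme.{0}}
    (k : T ⟶ PPprod m n)
    (H : ∀ t : T, ∃ (V : T.Opens) (i : Fin (m + 1)) (j : Fin (n + 1))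
      (hi : V ≤ (k ≫ pr₁ m n) ⁻¹ᵁ chart m i) (hj : V ≤ (k ≫ pr₂ m n) ⁻¹ᵁ chart n j), t ∈ V ∧
      ∀ q, formValues A (k ≫ pr₂ m n) hj q =
        coord (k ≫ pr₁ m n) hi q * formValues A (k ≫ pr₂ m n) hj i) :
    ∃ z : T ⟶ (Q01 m n).zeroLocus s, z ≫ (Q01 m n).zeroLocusι s = k := by
  have hker : ((Q01 m n).zeroLocusι s).ker ≤ k.ker := by
    have h0 : ((Q01 m n).zeroLocusι s).ker = (Q01 m n).zeroIdeal s :=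
      Scheme.IdealSheafData.ker_subschemeι _
    rw [h0]
    refine Scheme.IdealSheafData.le_ofIdeals_iff.mpr fun W a ha => ?_
    rw [RingHom.mem_ker]
    suffices pull k (le_refl (k ⁻¹ᵁ W.1)) a = 0 by
      unfold pull at this
      rwa [Scheme.Hom.appLE_eq_app] at this
    apply section_ext
    intro t ht
    obtain ⟨V, i, j, hi, hj, htV, hV⟩ := H t
    have hV' : V ≤ k ⁻¹ᵁ prodChart m n i j := fun x hx => ⟨hi hx, hj hx⟩
    refine ⟨V ⊓ k ⁻¹ᵁ W.1, inf_le_right, ⟨htV, ht⟩, ?_⟩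
    have hA : IsAffineOpen (W.1 ⊓ prodChart m n i j) :=
      IsAffineOpen.inf W.2 (isAffineOpen_prodChart i j)
    have h1 := res_mem_ideal _ (U := W) (V := ⟨_, hA⟩) inf_le_left ha
    rw [ideal_eq_map_res _ (U := ⟨prodChart m n i j, isAffineOpen_prodChart i j⟩) (V := ⟨_, hA⟩)
      inf_le_right, zeroIdeal_prodChart] at h1
    have h2 : V ⊓ k ⁻¹ᵁ W.1 ≤ k ⁻¹ᵁ (W.1 ⊓ prodChart m n i j) := fun x hx => ⟨hx.2, hV' hx.1⟩
    have h3 := Ideal.mem_map_of_mem (pull k h2) h1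
    rw [Ideal.map_map, Ideal.map_span, ← Set.range_comp] at h3
    have h4 : Set.range ((pull k h2).comp (res (inf_le_right : W.1 ⊓ prodChart m n i j ≤ _)) ∘
        localCoord s i j) ⊆ {0} := by
      rintro _ ⟨⟨q, hq⟩, rfl⟩
      rw [Function.comp_apply, RingHom.comp_apply, pull_res, hs]
      rw [pull_matrixCoord A k _ (inf_le_left.trans hi) (inf_le_left.trans hj),
        Set.mem_singleton_iff, sub_eq_zero]
      have h6 := congrArg (res (inf_le_left : V ⊓ k ⁻¹ᵁ W.1 ≤ V)) (hV q)
      rwa [map_mul, res_formValues, res_formValues, res_coord] at h6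
    have h5 := Ideal.span_mono h4 h3
    rw [Ideal.span_singleton_zero, Ideal.mem_bot, pull_res] at h5
    rw [res_pull, map_zero]
    exact h5
  exact ⟨IsClosedImmersion.lift _ k hker, IsClosedImmersion.lift_fac _ _ _⟩

end

/-! ### Uniqueness of lifts -/

theorem mem_nonZeroDivisors_of_span_eq {R : Type} [CommRing R] {a b : R}
    (ha : a ∈ nonZeroDivisors R) (h : Ideal.span {a} = Ideal.span {b}) :
    b ∈ nonZeroDivisors R := by
  have h1 : b ∣ a := by
    rw [← Ideal.mem_span_singleton, ← h]
    exact Ideal.mem_span_singleton_self a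
  obtain ⟨c, rfl⟩ := h1
  exact (mul_mem_nonZeroDivisors.mp ha).1

theorem span_range_eq_of_proportional {R ι : Type} [CommRing R] {v y : ι → R} {i : ι}
    (hv : ∀ q, v q = y q * v i) : Ideal.span (Set.range v) = Ideal.span {v i} := by
  apply le_antisymm
  · rw [Ideal.span_le]
    rintro _ ⟨q, rfl⟩
    rw [hv q]
    exact Ideal.mul_mem_left _ _ (Ideal.mem_span_singleton_self _)
  · rw [Ideal.span_singleton_le_iff_mem]
    exact Ideal.subset_span ⟨i, rfl⟩

/-- The entry `v i` generates the same ideal as the nonzerodivisor a, so it is a nonzerodivisor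
itself and can be cancelled after expressing v through both y and y'. -/
theorem proportional_unique {R ι : Type} [CommRing R] {v y y' : ι → R} {i i' : ι} {a : R}
    (ha : a ∈ nonZeroDivisors R) (hva : Ideal.span (Set.range v) = Ideal.span {a})
    (hv : ∀ q, v q = y q * v i) (hv' : ∀ q, v q = y' q * v i') :
    y i' * y' i = 1 ∧ ∀ q, y q = y i' * y' q := by
  have hi : v i ∈ nonZeroDivisors R :=
    mem_nonZeroDivisors_of_span_eq ha (hva.symm.trans (span_range_eq_of_proportional hv))
  constructor
  · rw [← mul_cancel_right_mem_nonZeroDivisors hi, one_mul, mul_right_comm, ← hv i', mul_comm,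
      ← hv' i]
  · intro q
    rw [← mul_cancel_right_mem_nonZeroDivisors hi, ← hv q, hv' q, hv i']
    ring

section

variable {m n : ℕ}

/-- The vector of functions `v` is a multiple of the homogeneous coordinates of the point `h`. -/
def Proportional {T : Scheme.{0}} (h : T ⟶ PP m) {V : T.Opens} (v : Fin (m + 1) → Γ(T, V)) :
    Prop :=
  ∀ (W : T.Opens) (hW : W ≤ V) (i : Fin (m + 1)) (hi : W ≤ h ⁻¹ᵁ chart m i) (q : Fin (m + 1)),
    res hW (v q) = coord h hi q * res hW (v i)

theorem hom_ext_of_locally {X Y : Scheme.{0}} {f g : X ⟶ Y}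
    (h : ∀ x : X, ∃ V : X.Opens, x ∈ V ∧ V.ι ≫ f = V.ι ≫ g) : f = g := by
  choose V hV hfg using h
  have hcov : TopologicalSpace.IsOpenCover V := by
    rw [TopologicalSpace.IsOpenCover, eq_top_iff]
    intro x _
    exact TopologicalSpace.Opens.mem_iSup.mpr ⟨x, hV x⟩
  exact (X.openCoverOfIsOpenCover V hcov).hom_ext _ _ hfg

/-- A vector that generates a Cartier ideal determines a point of projective space even where all
its entries vanish. This is the source of uniqueness, both for lifts to the blow-up and for
composites of linear maps. -/
theorem eq_of_proportional {T : Scheme.{0}} {h h' : T ⟶ PP m}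
    (e : h ≫ (PP m ↘ Spec (.of ℂ)) = h' ≫ (PP m ↘ Spec (.of ℂ)))
    (H : ∀ t : T, ∃ V : T.Opens, IsAffineOpen V ∧ t ∈ V ∧ ∃ v : Fin (m + 1) → Γ(T, V),
      Proportional h v ∧ Proportional h' v ∧ ∃ a ∈ nonZeroDivisors Γ(T, V),
        Ideal.span (Set.range v) = Ideal.span {a}) : h = h' := by
  apply hom_ext_of_locally
  intro t
  obtain ⟨V, hV, htV, v, hv, hv', a, ha, hva⟩ := H t
  obtain ⟨i, hi⟩ := exists_mem_chart h t
  obtain ⟨i', hi'⟩ := exists_mem_chart h' t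
  obtain ⟨b, hb, htb⟩ := hV.exists_basicOpen_le
    (V := h ⁻¹ᵁ chart m i ⊓ h' ⁻¹ᵁ chart m i') ⟨t, hi, hi'⟩ htV
  have hWi := hb.trans inf_le_left
  have hWi' := hb.trans inf_le_right
  have hWV := T.basicOpen_le b
  have haW := res_mem_nonZeroDivisors hV b ha
  have hvaW := congrArg (Ideal.map (res hWV)) hva
  rw [Ideal.map_span, Ideal.map_span, Set.image_singleton, ← Set.range_comp] at hvaW
  obtain ⟨h1, h2⟩ := proportional_unique (v := res hWV ∘ v) haW hvaW (hv _ hWV i hWi)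
    (hv' _ hWV i' hWi')
  -- Since the i'-th coordinate of h is a unit, h also maps into chart i', where the coordinates of
  -- the two points can be compared.
  have hu : IsUnit (coord h hWi i') := IsUnit.of_mul_eq_one _ h1
  have h3 := le_preimage_chart_of_isUnit h hWi hu
  refine ⟨_, htb, point_ext_of_coord i' e h3 hWi' fun p => ?_⟩
  rw [← hu.mul_right_inj, ← h2 p, coord_mul_coord]

theorem proportional_formValues {A : Matrix (Fin (m + 1)) (Fin (n + 1)) ℂ}
    {s : (Q01 m n).globalSections} (hs : IsMatrixSection A s) {T : Scheme.{0}}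
    (z : T ⟶ (Q01 m n).zeroLocus s) {f : T ⟶ PP n}
    (hf : z ≫ (Q01 m n).zeroLocusι s ≫ pr₂ m n = f) {V : T.Opens} {j : Fin (n + 1)}
    (hj : V ≤ f ⁻¹ᵁ chart n j) :
    Proportional (z ≫ (Q01 m n).zeroLocusι s ≫ pr₁ m n) (formValues A f hj) := by
  intro W hW i hi q
  rw [res_formValues, res_formValues]
  have hf' : (z ≫ (Q01 m n).zeroLocusι s) ≫ pr₂ m n = f := by rw [Category.assoc, hf]
  have hj' : W ≤ ((z ≫ (Q01 m n).zeroLocusι s) ≫ pr₂ m n) ⁻¹ᵁ chart n j := by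
    rw [hf']
    exact hW.trans hj
  have := formValues_zeroLocus hs z _ rfl (by rw [Category.assoc]; exact hi) hj' q
  rw [formValues_congr A hf' hj' (hW.trans hj), formValues_congr A hf' hj' (hW.trans hj)] at this
  rw [this]
  congr 1

/-- The component in ℙⁿ is f by assumption; the component in ℙᵐ is proportional to Ax, which
generates a Cartier ideal. -/
theorem zeroLocus_hom_ext {A : Matrix (Fin (m + 1)) (Fin (n + 1)) ℂ}
    {s : (Q01 m n).globalSections} (hs : IsMatrixSection A s) {T : Scheme.{0}} {f : T ⟶ PP n}
    (hf : IsCartier ((linearSubspaceIdeal n (LinearMap.ker A.mulVecLin)).comap f))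
    {z z' : T ⟶ (Q01 m n).zeroLocus s} (hz : z ≫ (Q01 m n).zeroLocusι s ≫ pr₂ m n = f)
    (hz' : z' ≫ (Q01 m n).zeroLocusι s ≫ pr₂ m n = f) : z = z' := by
  rw [← cancel_mono ((Q01 m n).zeroLocusι s)]
  apply Limits.pullback.hom_ext
  · change (z ≫ (Q01 m n).zeroLocusι s) ≫ pr₁ m n = (z' ≫ (Q01 m n).zeroLocusι s) ≫ pr₁ m n
    rw [Category.assoc, Category.assoc]
    have hover : ∀ w : T ⟶ (Q01 m n).zeroLocus s, w ≫ (Q01 m n).zeroLocusι s ≫ pr₂ m n = f →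
        (w ≫ (Q01 m n).zeroLocusι s ≫ pr₁ m n) ≫ (PP m ↘ Spec (.of ℂ)) =
          f ≫ (PP n ↘ Spec (.of ℂ)) := by
      intro w hw
      rw [← hw, Category.assoc, Category.assoc, Category.assoc, Category.assoc,
        Limits.pullback.condition]
    apply eq_of_proportional ((hover z hz).trans (hover z' hz').symm)
    intro t
    obtain ⟨j, hj⟩ := exists_mem_chart f t
    obtain ⟨V, hV, htV, hVj, a, ha, hVa⟩ := hf.exists_le t _ hj
    rw [ideal_comap_ker A f hV hVj] at hVa
    exact ⟨V, hV, htV, _, proportional_formValues hs z hz hVj,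
      proportional_formValues hs z' hz' hVj, a, ha, hVa⟩
  · change (z ≫ (Q01 m n).zeroLocusι s) ≫ pr₂ m n = (z' ≫ (Q01 m n).zeroLocusι s) ≫ pr₂ m n
    rw [Category.assoc, Category.assoc, hz, hz']

/-! ### Existence of lifts -/

/-- Writing a as a combination of the `v q = a * b q` and cancelling a turns the relation into a
combination of the b's equal to 1. -/
theorem exists_factor_of_span_eq {R ι : Type} [CommRing R] [Fintype ι] {v : ι → R} {a : R}
    (ha : a ∈ nonZeroDivisors R) (h : Ideal.span (Set.range v) = Ideal.span {a}) :
    ∃ b : ι → R, (∀ q, v q = a * b q) ∧ Ideal.span (Set.range b) = ⊤ := by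
  have h1 : ∀ q, ∃ b, v q = a * b := by
    intro q
    have : v q ∈ Ideal.span {a} := h ▸ Ideal.subset_span ⟨q, rfl⟩
    exact Ideal.mem_span_singleton.mp this
  choose b hb using h1
  refine ⟨b, hb, ?_⟩
  have h2 : a ∈ Ideal.span (Set.range v) := h ▸ Ideal.mem_span_singleton_self a
  obtain ⟨c, hc⟩ := (Ideal.mem_span_range_iff_exists_fun).mp h2
  rw [Ideal.eq_top_iff_one]
  have h3 : ∑ q, c q * b q = 1 := by
    rw [← mul_cancel_right_mem_nonZeroDivisors ha, one_mul, Finset.sum_mul]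
    refine Eq.trans (Finset.sum_congr rfl fun q _ => ?_) hc
    rw [hb q]
    ring
  rw [← h3]
  exact Ideal.sum_mem _ fun q _ => Ideal.mul_mem_left _ _ (Ideal.subset_span ⟨q, rfl⟩)

/-- After division by the local equation a of the Cartier divisor, the vector Ax becomes b, which
has an invertible entry near t and so defines the missing point of ℙᵐ. -/
theorem exists_local_lift {A : Matrix (Fin (m + 1)) (Fin (n + 1)) ℂ}
    {s : (Q01 m n).globalSections} (hs : IsMatrixSection A s) {T : Scheme.{0}} {f : T ⟶ PP n}
    (hf : IsCartier ((linearSubspaceIdeal n (LinearMap.ker A.mulVecLin)).comap f)) (t : T) :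
    ∃ (W : T.Opens) (_ : t ∈ W) (z : W.toScheme ⟶ (Q01 m n).zeroLocus s),
      z ≫ (Q01 m n).zeroLocusι s ≫ pr₂ m n = W.ι ≫ f := by
  obtain ⟨j, hj⟩ := exists_mem_chart f t
  obtain ⟨V, hV, htV, hVj, a, ha, hVa⟩ := hf.exists_le t _ hj
  rw [ideal_comap_ker A f hV hVj] at hVa
  obtain ⟨b, hb, hbtop⟩ := exists_factor_of_span_eq ha hVa
  have h1 : ∃ i, t ∈ T.basicOpen (b i) := by
    have := hV.self_le_iSup_basicOpen_iff.mpr hbtop htV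
    obtain ⟨⟨_, i, rfl⟩, hi⟩ := TopologicalSpace.Opens.mem_iSup.mp this
    exact ⟨i, hi⟩
  obtain ⟨i, hti⟩ := h1
  let W := T.basicOpen (b i)
  have hWV : W ≤ V := T.basicOpen_le _
  have hu : IsUnit (res hWV (b i)) := RingedSpace.isUnit_res_basicOpen _ (b i)
  obtain ⟨c, hc⟩ := hu.exists_right_inv
  -- The point [b] in the chart where bᵢ is invertible: c is the inverse of bᵢ.
  obtain ⟨h, hover, hi, hh⟩ := exists_point (W.ι ≫ f ≫ (PP n ↘ Spec (.of ℂ))) i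
    (fun q => pull W.ι (le_ι_preimage W) (res hWV (b q) * c)) (by rw [hc, map_one])
  let k : W.toScheme ⟶ PPprod m n := Limits.pullback.lift h (W.ι ≫ f)
    (by rw [hover, Category.assoc])
  have hk₁ : k ≫ pr₁ m n = h := Limits.pullback.lift_fst _ _ _
  have hk₂ : k ≫ pr₂ m n = W.ι ≫ f := Limits.pullback.lift_snd _ _ _
  have hi' : ⊤ ≤ (k ≫ pr₁ m n) ⁻¹ᵁ chart m i := by rwa [hk₁]
  have hj' : ⊤ ≤ (k ≫ pr₂ m n) ⁻¹ᵁ chart n j := by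
    rw [hk₂]
    exact (le_ι_preimage W).trans (Scheme.Hom.preimage_mono _ (hWV.trans hVj))
  obtain ⟨z, hz⟩ := exists_lift_zeroLocus hs k fun x => by
    refine ⟨⊤, i, j, hi', hj', trivial, fun q => ?_⟩
    have h2 : ∀ q, formValues A (k ≫ pr₂ m n) hj' q =
        pull W.ι (le_ι_preimage W) (res hWV a * res hWV (b q)) := by
      intro q
      rw [formValues_congr A hk₂ hj' ((le_ι_preimage W).trans
        (Scheme.Hom.preimage_mono _ (hWV.trans hVj))), ← map_mul, ← hb, res_formValues,
        pull_formValues]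
    have h3 : res hWV a * res hWV (b q) = (res hWV (b q) * c) * (res hWV a * res hWV (b i)) := by
      linear_combination (-res hWV a * res hWV (b q)) * hc
    rw [h2, h2, h3, coord_congr hk₁ hi' hi, coord, hh, map_mul]
  exact ⟨W, hti, z, by rw [← Category.assoc, hz, hk₂]⟩

/-- Uniqueness is assumed over every open immersion into T, because the local lifts have to be
compared on overlaps. -/
theorem exists_glued_lift {T X B : Scheme.{0}} {f : T ⟶ X} {π : B ⟶ X}
    (hex : ∀ t : T, ∃ (W : T.Opens) (_ : t ∈ W) (z : W.toScheme ⟶ B), z ≫ π = W.ι ≫ f)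
    (huniq : ∀ (S : Scheme.{0}) (j : S ⟶ T) [IsOpenImmersion j] (z z' : S ⟶ B),
      z ≫ π = j ≫ f → z' ≫ π = j ≫ f → z = z') : ∃ g : T ⟶ B, g ≫ π = f := by
  choose W hW z hz using hex
  have hcov : TopologicalSpace.IsOpenCover W := by
    rw [TopologicalSpace.IsOpenCover, eq_top_iff]
    intro x _
    exact TopologicalSpace.Opens.mem_iSup.mpr ⟨x, hW x⟩
  let 𝒰 := T.openCoverOfIsOpenCover W hcov
  let z' : ∀ x : 𝒰.I₀, 𝒰.X x ⟶ B := z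
  have hz' : ∀ x : 𝒰.I₀, z' x ≫ π = 𝒰.f x ≫ f := hz
  have hcompat : ∀ x y : 𝒰.I₀, Limits.pullback.fst (𝒰.f x) (𝒰.f y) ≫ z' x =
      Limits.pullback.snd (𝒰.f x) (𝒰.f y) ≫ z' y := by
    intro x y
    apply huniq _ (Limits.pullback.fst (𝒰.f x) (𝒰.f y) ≫ 𝒰.f x)
    · rw [Category.assoc, Category.assoc, hz']
    · rw [Category.assoc, Category.assoc, hz', Limits.pullback.condition_assoc]
  refine ⟨𝒰.glueMorphisms z' hcompat, 𝒰.hom_ext _ _ fun x => ?_⟩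
  rw [← Category.assoc, Scheme.Cover.ι_glueMorphisms, hz']

theorem IsCartier.comap_isOpenImmersion {S X : Scheme.{0}} {K : X.IdealSheafData}
    (hK : IsCartier K) (j : S ⟶ X) [IsOpenImmersion j] : IsCartier (K.comap j) := by
  intro x
  obtain ⟨V, hV, hxV, hVO, a, ha, hKa⟩ := hK.exists_le (j x) j.opensRange ⟨x, rfl⟩
  have hA : IsAffineOpen (j ⁻¹ᵁ V) := hV.preimage_of_isOpenImmersion j hVO
  have hbij : Function.Bijective (pull j (le_refl (j ⁻¹ᵁ V))) := by
    unfold pull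
    rw [Scheme.Hom.appLE_eq_app]
    have := j.isIso_app V hVO
    exact ConcreteCategory.bijective_of_isIso (j.app V)
  refine ⟨⟨_, hA⟩, hxV, pull j le_rfl a, map_mem_nonZeroDivisors_of_bijective hbij ha, ?_⟩
  rw [ideal_comap K j hA hV le_rfl, hKa, Ideal.map_span, Set.image_singleton]

end

/-! ### The inverse image of the centre is a Cartier divisor -/

section

variable {m n : ℕ}

/-- The ring of functions on a chart of the incidence variety `A x = t y` is a retract of a
localization of a polynomial ring, in which `t` is a nonzerodivisor. -/
theorem exists_weakly_universal_chart {A : Matrix (Fin (m + 1)) (Fin (n + 1)) ℂ}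
    {B : Matrix (Fin (n + 1)) (Fin (m + 1)) ℂ} (hAB : A * B = 1) (i : Fin (m + 1))
    (j : Fin (n + 1)) :
    ∃ (D : CommRingCat.{0}) (σ : ℂ →+* D) (y : Fin (m + 1) → D) (x : Fin (n + 1) → D) (t : D),
      y i = 1 ∧ x j = 1 ∧ (∀ q, (A.map σ).mulVec x q = y q * t) ∧ t ∈ nonZeroDivisors D ∧
      ∀ (R : CommRingCat.{0}) (ρ : ℂ →+* R) (y' : Fin (m + 1) → R) (x' : Fin (n + 1) → R) (t' : R),
        y' i = 1 → x' j = 1 → (∀ q, (A.map ρ).mulVec x' q = y' q * t') →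
        ∃ φ : D →+* R, (∀ c, φ (σ c) = ρ c) ∧ (∀ q, φ (y q) = y' q) ∧ ∀ p, φ (x p) = x' p := by
  let P := MvPolynomial (Fin (m + 1) ⊕ Option (Fin (n + 1))) ℂ
  -- The coordinates y are free variables, except that the i-th one is set to 1.
  let Y : Fin (m + 1) → P := Function.update (fun q => MvPolynomial.X (Sum.inl q)) i 1
  let t : P := MvPolynomial.X (Sum.inr none)
  let z : Fin (n + 1) → P := fun p => MvPolynomial.X (Sum.inr (some p))
  let C : ℂ →+* P := MvPolynomial.C
  -- The general solution of Ax = tY: a particular solution tBY plus z - BAz, which runs through ker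
  -- A because AB = 1.
  let x : Fin (n + 1) → P := t • (B.map C).mulVec Y + (z - (B.map C).mulVec ((A.map C).mulVec z))
  have hABC : A.map C * B.map C = 1 := by
    rw [← Matrix.map_mul, hAB, Matrix.map_one _ (map_zero _) (map_one _)]
  have hx : (A.map C).mulVec x = t • Y := by
    simp only [x]
    rw [Matrix.mulVec_add, Matrix.mulVec_sub, Matrix.mulVec_smul, Matrix.mulVec_mulVec,
      Matrix.mulVec_mulVec, hABC, Matrix.one_mulVec, Matrix.one_mulVec, sub_self, add_zero]
  let D := Localization.Away (x j)
  let a : P →+* D := algebraMap P D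
  have hu : IsUnit (a (x j)) := IsLocalization.Away.algebraMap_isUnit (x j)
  obtain ⟨u, hu'⟩ := hu.exists_right_inv
  have hunit : IsUnit u := IsUnit.of_mul_eq_one_right _ hu'
  -- Dividing x and t by the inverted element `x j` normalizes the j-th coordinate to 1.
  refine ⟨.of D, a.comp C, fun q => a (Y q), fun p => a (x p) * u, a t * u, ?_, hu', ?_, ?_, ?_⟩
  · simp [Y]
  · intro q
    have h1 := congrArg a (congrFun hx q)
    rw [RingHom.map_mulVec] at h1
    have h2 : (A.map (a.comp C)).mulVec (fun p => a (x p) * u) q =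
        (A.map (a.comp C)).mulVec (a ∘ x) q * u := by
      simp only [Matrix.mulVec, dotProduct, Finset.sum_mul, Function.comp_apply, mul_assoc]
    rw [h2]
    rw [Matrix.map_map] at h1
    refine (congrArg (· * u) h1).trans ?_
    simp only [Pi.smul_apply, smul_eq_mul, map_mul]
    ring
  · refine mul_mem ?_ hunit.mem_nonZeroDivisors
    refine IsLocalization.map_nonZeroDivisors_le (Submonoid.powers (x j)) D
      (Submonoid.mem_map_of_mem _ ?_)
    exact mem_nonZeroDivisors_of_ne_zero (MvPolynomial.X_ne_zero _)
  · intro R ρ y' x' t' hy' hx' hA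
    -- Sending z to x' itself works: as Ax' = t'y', the terms t'By' and BAx' cancel, so x goes to
    -- x'. This gives a map out of D but no uniqueness of that map, and existence is all that is
    -- needed.
    let φ₀ : P →+* R := MvPolynomial.eval₂Hom ρ (Sum.elim y' fun o => o.elim t' x')
    have hC : ∀ c, φ₀ (C c) = ρ c := fun c => MvPolynomial.eval₂Hom_C _ _ _
    have hCm : ∀ {k l : ℕ} (M : Matrix (Fin k) (Fin l) ℂ), (M.map C).map φ₀ = M.map ρ := by
      intro k l M
      ext
      simp [hC]
    have hY : ∀ q, φ₀ (Y q) = y' q := by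
      intro q
      by_cases hq : q = i
      · subst hq
        simp [Y, hy']
      · rw [show Y q = MvPolynomial.X (Sum.inl q) from Function.update_of_ne hq _ _]
        exact MvPolynomial.eval₂Hom_X' _ _ _
    have ht : φ₀ t = t' := MvPolynomial.eval₂Hom_X' _ _ _
    have hz : ∀ p, φ₀ (z p) = x' p := fun p => MvPolynomial.eval₂Hom_X' _ _ _
    have hX : ∀ p, φ₀ (x p) = x' p := by
      intro p
      have h1 : φ₀ (x p) = t' * (B.map ρ).mulVec y' p +
          (x' p - (B.map ρ).mulVec ((A.map ρ).mulVec x') p) := by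
        simp only [x, Pi.add_apply, Pi.sub_apply, Pi.smul_apply, smul_eq_mul, map_add, map_sub,
          map_mul, RingHom.map_mulVec, hCm, ht, hz]
        have h2 : φ₀ ∘ Y = y' := funext hY
        have h3 : φ₀ ∘ (A.map C).mulVec z = (A.map ρ).mulVec x' := by
          funext q
          rw [Function.comp_apply, RingHom.map_mulVec, hCm]
          exact congrFun (congrArg _ (funext hz)) q
        rw [h2, h3]
      have h4 : (A.map ρ).mulVec x' = t' • y' := by
        funext q
        rw [hA, Pi.smul_apply, smul_eq_mul, mul_comm]
      rw [h1, h4, Matrix.mulVec_smul, Pi.smul_apply, smul_eq_mul]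
      ring
    have hXj : IsUnit (φ₀ (x j)) := by
      rw [hX, hx']
      exact isUnit_one
    let φ : D →+* R := IsLocalization.Away.lift (x j) hXj
    have hφ : ∀ b, φ (a b) = φ₀ b := fun b => IsLocalization.Away.lift_eq (x j) hXj b
    have hφu : φ u = 1 := by
      have := congrArg φ hu'
      rwa [map_mul, hφ, hX, hx', one_mul, map_one] at this
    refine ⟨φ, fun c => (hφ _).trans (hC c), fun q => (hφ _).trans (hY q), fun p => ?_⟩
    refine (map_mul φ _ _).trans ?_
    rw [hφ, hφu, hX, mul_one]

/-- The ring D gives a morphism e from Spec D to the zero locus, and the inclusion of the chart W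
factors through e. Pull-back along e is therefore injective on functions on W, and it sends (Ax)ᵢ to
the nonzerodivisor t. -/
theorem formValues_mem_nonZeroDivisors {A : Matrix (Fin (m + 1)) (Fin (n + 1)) ℂ}
    {B : Matrix (Fin (n + 1)) (Fin (m + 1)) ℂ} (hAB : A * B = 1)
    {s : (Q01 m n).globalSections} (hs : IsMatrixSection A s)
    {W : ((Q01 m n).zeroLocus s).Opens} {i : Fin (m + 1)} {j : Fin (n + 1)}
    (hW : W = (Q01 m n).zeroLocusι s ⁻¹ᵁ prodChart m n i j)
    (hj : W ≤ ((Q01 m n).zeroLocusι s ≫ pr₂ m n) ⁻¹ᵁ chart n j) :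
    formValues A ((Q01 m n).zeroLocusι s ≫ pr₂ m n) hj i ∈
      nonZeroDivisors Γ((Q01 m n).zeroLocus s, W) := by
  obtain ⟨D, σ, y, x, t, hy, hx, hyx, ht, hD⟩ := exists_weakly_universal_chart hAB i j
  have hi : W ≤ ((Q01 m n).zeroLocusι s ≫ pr₁ m n) ⁻¹ᵁ chart m i := by
    subst hW
    exact fun x hx => hx.1
  -- the morphism from `Spec D` to the zero locus
  let τ : Spec D ⟶ Spec (.of ℂ) := toSpec (R := .of ℂ) ((specFun D).comp σ)
  have hτ : ∀ c, scalar τ ⊤ c = specFun D (σ c) := fun c =>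
    pull_toSpec (R := .of ℂ) ((specFun D).comp σ) c _
  obtain ⟨Y, hYτ, hYi, hY⟩ := exists_point τ i (fun q => specFun D (y q)) (by rw [hy, map_one])
  obtain ⟨X, hXτ, hXj, hX⟩ := exists_point τ j (fun p => specFun D (x p)) (by rw [hx, map_one])
  let k : Spec D ⟶ PPprod m n := Limits.pullback.lift Y X (hYτ.trans hXτ.symm)
  have hk₁ : k ≫ pr₁ m n = Y := Limits.pullback.lift_fst _ _ _
  have hk₂ : k ≫ pr₂ m n = X := Limits.pullback.lift_snd _ _ _
  have hki : ⊤ ≤ (k ≫ pr₁ m n) ⁻¹ᵁ chart m i := by rwa [hk₁]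
  have hkj : ⊤ ≤ (k ≫ pr₂ m n) ⁻¹ᵁ chart n j := by rwa [hk₂]
  have hform : ∀ q, formValues A X hXj q = specFun D (y q * t) := by
    intro q
    rw [← hyx q, RingHom.map_mulVec, formValues, hXτ]
    have h1 : A.map (scalar τ ⊤) = (A.map σ).map (specFun D) := Matrix.ext fun _ _ => hτ _
    rw [h1]
    exact congrFun (congrArg _ (funext hX)) q
  obtain ⟨e, he⟩ := exists_lift_zeroLocus hs k fun _ => ⟨⊤, i, j, hki, hkj, trivial, fun q => by
    rw [formValues_congr A hk₂ hkj hXj, formValues_congr A hk₂ hkj hXj,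
      coord_congr hk₁ hki hYi, hform, hform, coord, hY, hy, one_mul, map_mul]⟩
  -- the morphism from the chart to `Spec D`
  let f₁ : W.toScheme ⟶ PP m := W.ι ≫ (Q01 m n).zeroLocusι s ≫ pr₁ m n
  let f₂ : W.toScheme ⟶ PP n := W.ι ≫ (Q01 m n).zeroLocusι s ≫ pr₂ m n
  have hf : f₁ ≫ (PP m ↘ Spec (.of ℂ)) = f₂ ≫ (PP n ↘ Spec (.of ℂ)) := by
    simp only [f₁, f₂, Category.assoc, Limits.pullback.condition]
  have hf₁ : ⊤ ≤ f₁ ⁻¹ᵁ chart m i := (le_ι_preimage W).trans (Scheme.Hom.preimage_mono _ hi)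
  have hf₂ : ⊤ ≤ f₂ ⁻¹ᵁ chart n j := (le_ι_preimage W).trans (Scheme.Hom.preimage_mono _ hj)
  -- The data fed to D are the coordinates of W in the two factors, with (Ax)ᵢ in the role of t.
  obtain ⟨φ, hφσ, hφy, hφx⟩ := hD Γ(W.toScheme, ⊤) (scalar (f₂ ≫ (PP n ↘ Spec (.of ℂ))) ⊤)
    (coord f₁ hf₁) (coord f₂ hf₂) (formValues A f₂ hf₂ i) (coord_self _ _) (coord_self _ _)
    fun q => proportional_formValues hs W.ι rfl hf₂ ⊤ le_rfl i hf₁ q |> fun h => by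
      rw [res_self, res_self] at h
      exact h
  let b : W.toScheme ⟶ Spec D := toSpec φ
  have hb := le_preimage_top b ⊤
  have hbτ : b ≫ τ = f₂ ≫ (PP n ↘ Spec (.of ℂ)) := by
    apply scalar_injective_hom
    intro c
    rw [← pull_scalar b τ hb, hτ, pull_toSpec, hφσ]
  have hbe : b ≫ e = W.ι := by
    rw [← cancel_mono ((Q01 m n).zeroLocusι s), Category.assoc, he]
    apply Limits.pullback.hom_ext
    · change (b ≫ k) ≫ pr₁ m n = (W.ι ≫ (Q01 m n).zeroLocusι s) ≫ pr₁ m n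
      rw [Category.assoc, Category.assoc, hk₁]
      refine point_ext i (g := f₁) ?_ (hb.trans (Scheme.Hom.preimage_mono b hYi)) hf₁ fun p => ?_
      · rw [Category.assoc, hYτ, hbτ, hf]
      · rw [← pull_pull b Y hYi hb, hY, pull_toSpec, hφy]
        rfl
    · change (b ≫ k) ≫ pr₂ m n = (W.ι ≫ (Q01 m n).zeroLocusι s) ≫ pr₂ m n
      rw [Category.assoc, Category.assoc, hk₂]
      refine point_ext j (g := f₂) ?_ (hb.trans (Scheme.Hom.preimage_mono b hXj)) hf₂ fun p => ?_
      · rw [Category.assoc, hXτ, hbτ]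
      · rw [← pull_pull b X hXj hb, hX, pull_toSpec, hφx]
        rfl
  have heW : ⊤ ≤ e ⁻¹ᵁ W := by
    subst hW
    intro x _
    have : ⊤ ≤ (e ≫ (Q01 m n).zeroLocusι s) ⁻¹ᵁ prodChart m n i j := by
      rw [he]
      exact fun x hx => ⟨hki hx, hkj hx⟩
    exact this trivial
  have hinj := pull_injective_of_section e heW b hb hbe
  have heX : e ≫ (Q01 m n).zeroLocusι s ≫ pr₂ m n = X := by rw [← Category.assoc, he, hk₂]
  have hval : pull e heW (formValues A ((Q01 m n).zeroLocusι s ≫ pr₂ m n) hj i) =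
      specFun D t := by
    rw [pull_formValues, formValues_congr A heX _ hXj, hform, hy, one_mul]
  have hbij : Function.Bijective (specFun D) :=
    ConcreteCategory.bijective_of_isIso (Scheme.ΓSpecIso D).inv
  have hnz := map_mem_nonZeroDivisors_of_bijective hbij ht
  rw [mem_nonZeroDivisors_iff_right] at hnz ⊢
  intro c hc
  apply hinj
  rw [map_zero]
  apply hnz
  rw [← hval, ← map_mul, hc, map_zero]

theorem isCartier_zeroLocus {A : Matrix (Fin (m + 1)) (Fin (n + 1)) ℂ}
    {B : Matrix (Fin (n + 1)) (Fin (m + 1)) ℂ} (hAB : A * B = 1)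
    {s : (Q01 m n).globalSections} (hs : IsMatrixSection A s) :
    IsCartier ((linearSubspaceIdeal n (LinearMap.ker A.mulVecLin)).comap
      ((Q01 m n).zeroLocusι s ≫ pr₂ m n)) := by
  intro z
  obtain ⟨i, hi⟩ := exists_mem_chart ((Q01 m n).zeroLocusι s ≫ pr₁ m n) z
  obtain ⟨j, hj⟩ := exists_mem_chart ((Q01 m n).zeroLocusι s ≫ pr₂ m n) z
  let W := (Q01 m n).zeroLocusι s ⁻¹ᵁ prodChart m n i j
  have hW : IsAffineOpen W := (isAffineOpen_prodChart i j).preimage _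
  have hWi : W ≤ ((Q01 m n).zeroLocusι s ≫ pr₁ m n) ⁻¹ᵁ chart m i := fun x hx => hx.1
  have hWj : W ≤ ((Q01 m n).zeroLocusι s ≫ pr₂ m n) ⁻¹ᵁ chart n j := fun x hx => hx.2
  refine ⟨⟨W, hW⟩, ⟨hi, hj⟩, _, formValues_mem_nonZeroDivisors hAB hs rfl hWj, ?_⟩
  rw [ideal_comap_ker A _ hW hWj]
  exact span_range_eq_of_proportional fun q =>
    formValues_zeroLocus hs (𝟙 _) _ (Category.id_comp _) hWi hWj q

/-- If `A` has a right inverse, then the zero locus of the section of `Q(0,1)` given by `A` is the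
blow-up of `ℙⁿ` along the linear subspace `A x = 0`. -/
theorem isBlowUp_zeroLocus {A : Matrix (Fin (m + 1)) (Fin (n + 1)) ℂ}
    {B : Matrix (Fin (n + 1)) (Fin (m + 1)) ℂ} (hAB : A * B = 1)
    {s : (Q01 m n).globalSections} (hs : IsMatrixSection A s) :
    IsBlowUp (linearSubspaceIdeal n (LinearMap.ker A.mulVecLin))
      ((Q01 m n).zeroLocusι s ≫ pr₂ m n) where
  cartier := isCartier_zeroLocus hAB hs
  universal T f hf := by
    obtain ⟨g, hg⟩ := exists_glued_lift (exists_local_lift hs hf)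
      fun S j _ z z' hz hz' => zeroLocus_hom_ext hs (by
        rw [Scheme.IdealSheafData.comap_comp]
        exact hf.comap_isOpenImmersion j) hz hz'
    exact ⟨g, hg, fun g' hg' => zeroLocus_hom_ext hs hf hg' hg⟩

end

/-! ### Sections of `Q(0,1)` in local coordinates -/

section

variable {m n : ℕ}

/-- Coordinates with respect to the frame of Q are extended by zero to the missing index i, so the
sum over the frame becomes a sum over all indices, which the Kronecker deltas collapse. -/
theorem sum_quotient_frame {R : Type} [CommRing R] (i : Fin (m + 1)) (q p : Fin (m + 1))
    (y x : R) (c : Fin (m + 1) → R) (hc : c i = 0) :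
    ∑ d : {d : Fin (m + 1) // d ≠ i} × Unit,
      (((Pi.single d.1.1 1 : Fin (m + 1) → R) q -
        y * (Pi.single d.1.1 1 : Fin (m + 1) → R) p) * x) * c d.1.1 = x * (c q - y * c p) := by
  rw [Fintype.sum_prod_type]
  simp only [Finset.univ_unique, Finset.sum_singleton]
  let F : Fin (m + 1) → R := fun d =>
    (((Pi.single d 1 : Fin (m + 1) → R) q - y * (Pi.single d 1 : Fin (m + 1) → R) p) * x) * c d
  have hF : F i = 0 := by simp [F, hc]
  have h1 : ∑ d : {d : Fin (m + 1) // d ≠ i}, F d.1 = ∑ d, F d := by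
    rw [← Finset.sum_erase Finset.univ hF]
    exact (Finset.sum_subtype _ (by simp) F).symm
  refine h1.trans ?_
  simp only [F, Pi.single_apply, sub_mul, mul_assoc, Finset.sum_sub_distrib, ite_mul, one_mul,
    zero_mul, Finset.sum_ite_eq, Finset.mem_univ, if_true, ← Finset.mul_sum]
  ring

/-- The transition matrices of `Q(0,1)`. -/
def transition (i i' : Fin (m + 1)) (j j' : Fin (n + 1)) (q : {q : Fin (m + 1) // q ≠ i})
    (d : {d : Fin (m + 1) // d ≠ i'} × Unit) :
    Γ(PPprod m n, prodChart m n i j ⊓ prodChart m n i' j') :=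
  (Q01 m n).g (i, j) (i', j') (q, ()) d

theorem transition_apply (i i' : Fin (m + 1)) (j j' : Fin (n + 1)) (q : {q : Fin (m + 1) // q ≠ i})
    (d : {d : Fin (m + 1) // d ≠ i'} × Unit) :
    transition i i' j j' q d =
      ((Pi.single d.1.1 1 : Fin (m + 1) → Γ(PPprod m n, prodChart m n i j ⊓ prodChart m n i' j'))
        q.1 - coord (pr₁ m n) (inf_le_left.trans inf_le_left) q.1 *
          (Pi.single d.1.1 1 :
            Fin (m + 1) → Γ(PPprod m n, prodChart m n i j ⊓ prodChart m n i' j')) i) *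
        coord (pr₂ m n) (inf_le_left.trans inf_le_right : _ ≤ pr₂ m n ⁻¹ᵁ chart n j) j' := by
  change res (U := pr₁ m n ⁻¹ᵁ chart m i ⊓ pr₁ m n ⁻¹ᵁ chart m i')
      (V := prodChart m n i j ⊓ prodChart m n i' j') (inf_le_inf inf_le_left inf_le_left)
      (pull (pr₁ m n) (U := chart m i ⊓ chart m i') (le_preimage_inf (pr₁ m n))
        ((Pi.single d.1.1 1 : Fin (m + 1) → Γ(PP m, chart m i ⊓ chart m i')) q.1 -
          res inf_le_left (ratio m q.1 i) *
            (Pi.single d.1.1 1 : Fin (m + 1) → Γ(PP m, chart m i ⊓ chart m i')) i)) *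
    res (U := pr₂ m n ⁻¹ᵁ chart n j ⊓ pr₂ m n ⁻¹ᵁ chart n j')
      (V := prodChart m n i j ⊓ prodChart m n i' j') (inf_le_inf inf_le_right inf_le_right)
      (pull (pr₂ m n) (U := chart n j ⊓ chart n j') (le_preimage_inf (pr₂ m n))
        (res inf_le_left (ratio n j' j))) = _
  simp only [Pi.single_apply, map_sub, map_mul, apply_ite (pull _ _), apply_ite (res _), map_one,
    map_zero, pull_res, res_pull]
  rfl

/-- A family of local coordinates is a section of `Q(0,1)`. -/
def IsCompatible (c : ∀ (i : Fin (m + 1)) (j : Fin (n + 1)), Fin (m + 1) →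
    Γ(PPprod m n, prodChart m n i j)) : Prop :=
  ∀ (i i' : Fin (m + 1)) (j j' : Fin (n + 1)) (q : Fin (m + 1)),
    res (inf_le_left : prodChart m n i j ⊓ prodChart m n i' j' ≤ prodChart m n i j) (c i j q) =
      coord (pr₂ m n) (inf_le_left.trans inf_le_right : _ ≤ pr₂ m n ⁻¹ᵁ chart n j) j' *
        (res inf_le_right (c i' j' q) -
          coord (pr₁ m n) (inf_le_left.trans inf_le_left : _ ≤ pr₁ m n ⁻¹ᵁ chart m i) q *
            res inf_le_right (c i' j' i))

theorem sum_transition_mul (c : ∀ (i : Fin (m + 1)) (j : Fin (n + 1)), Fin (m + 1) →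
    Γ(PPprod m n, prodChart m n i j)) (hc : ∀ i j, c i j i = 0) (i i' : Fin (m + 1))
    (j j' : Fin (n + 1)) (q : {q : Fin (m + 1) // q ≠ i}) :
    ∑ d : {d : Fin (m + 1) // d ≠ i'} × Unit, transition i i' j j' q d *
        res (inf_le_right : prodChart m n i j ⊓ prodChart m n i' j' ≤ prodChart m n i' j')
          (c i' j' d.1.1) =
      coord (pr₂ m n) (inf_le_left.trans inf_le_right :
        prodChart m n i j ⊓ prodChart m n i' j' ≤ pr₂ m n ⁻¹ᵁ chart n j) j' *
        (res inf_le_right (c i' j' q) -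
          coord (pr₁ m n) (inf_le_left.trans inf_le_left : _ ≤ pr₁ m n ⁻¹ᵁ chart m i) q *
            res inf_le_right (c i' j' i)) := by
  refine Eq.trans ?_ (sum_quotient_frame i' q.1 i _ _ (fun d => res
    (inf_le_right : prodChart m n i j ⊓ prodChart m n i' j' ≤ prodChart m n i' j') (c i' j' d))
    (by rw [hc, map_zero]))
  exact Finset.sum_congr rfl fun d _ => congrArg (· * _) (transition_apply i i' j j' q d)

theorem mem_globalSections_of_isCompatible {c : ∀ (i : Fin (m + 1)) (j : Fin (n + 1)),
    Fin (m + 1) → Γ(PPprod m n, prodChart m n i j)} (hc : ∀ i j, c i j i = 0)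
    (h : IsCompatible c) : ∃ s : (Q01 m n).globalSections, ∀ i j q, localCoord s i j q = c i j q := by
  refine ⟨⟨fun a b => c a.1 a.2 b.1.1, ?_⟩, fun i j q => rfl⟩
  rintro ⟨i, j⟩ ⟨i', j'⟩
  funext ⟨q, _⟩
  exact (h i i' j j' _).trans (sum_transition_mul c hc i i' j j' q).symm

/-- The coordinates of a section of `Q(0,1)`, extended by zero to the index `q = i`. -/
def extCoord (s : (Q01 m n).globalSections) (i : Fin (m + 1)) (j : Fin (n + 1))
    (q : Fin (m + 1)) : Γ(PPprod m n, prodChart m n i j) :=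
  if h : q ≠ i then localCoord s i j ⟨q, h⟩ else 0

theorem extCoord_self (s : (Q01 m n).globalSections) (i : Fin (m + 1)) (j : Fin (n + 1)) :
    extCoord s i j i = 0 := by simp [extCoord]

theorem extCoord_of_ne (s : (Q01 m n).globalSections) (i : Fin (m + 1)) (j : Fin (n + 1))
    (q : {q : Fin (m + 1) // q ≠ i}) : extCoord s i j q = localCoord s i j q :=
  dif_pos q.2

theorem isCompatible_extCoord (s : (Q01 m n).globalSections) : IsCompatible (extCoord s) := by
  intro i i' j j' q
  by_cases hq : q = i
  · subst hq
    rw [extCoord_self, map_zero, coord_self, one_mul, sub_self, mul_zero]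
  · rw [← sum_transition_mul (extCoord s) (extCoord_self s) i i' j j' ⟨q, hq⟩]
    have h1 := congrFun (s.2 (i, j) (i', j')) (⟨q, hq⟩, ())
    have h2 : extCoord s i j q = s.1 (i, j) (⟨q, hq⟩, ()) := extCoord_of_ne s i j ⟨q, hq⟩
    have h3 : (fun b : {q : Fin (m + 1) // q ≠ i'} × Unit => extCoord s i' j' b.1.1) =
        s.1 (i', j') := funext fun b => extCoord_of_ne s i' j' b.1
    rw [h2]
    refine h1.trans ?_
    rw [← h3]
    rfl

theorem exists_isMatrixSection (A : Matrix (Fin (m + 1)) (Fin (n + 1)) ℂ) :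
    ∃ s : (Q01 m n).globalSections, IsMatrixSection A s := by
  obtain ⟨s, hs⟩ := mem_globalSections_of_isCompatible (c := matrixCoord A)
    (fun i j => by rw [matrixCoord, coord_self, one_mul, sub_self]) (by
      intro i i' j j' q
      simp only [matrixCoord, map_sub, map_mul, res_formValues, res_coord]
      have hi : prodChart m n i j ⊓ prodChart m n i' j' ≤ pr₁ m n ⁻¹ᵁ chart m i :=
        inf_le_left.trans inf_le_left
      have hi' : prodChart m n i j ⊓ prodChart m n i' j' ≤ pr₁ m n ⁻¹ᵁ chart m i' :=
        inf_le_right.trans inf_le_left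
      have hj : prodChart m n i j ⊓ prodChart m n i' j' ≤ pr₂ m n ⁻¹ᵁ chart n j :=
        inf_le_left.trans inf_le_right
      have hj' : prodChart m n i j ⊓ prodChart m n i' j' ≤ pr₂ m n ⁻¹ᵁ chart n j' :=
        inf_le_right.trans inf_le_right
      have h1 := coord_mul_formValues A (pr₂ m n) hj hj'
      have h2 := coord_mul_coord (pr₁ m n) hi' hi q
      rw [← h1 q, ← h1 i, ← h2]
      ring)
  exact ⟨s, fun i j q => hs i j q⟩

end

/-! ### Linear automorphisms of projective space -/

section

variable {m n : ℕ}

/-- Applying g' to gx recovers the coordinates of x, one of which is 1. -/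
theorem span_formValues_eq_top {g g' : Matrix (Fin (n + 1)) (Fin (n + 1)) ℂ} (hg : g' * g = 1)
    {T : Scheme.{0}} (f : T ⟶ PP n) {V : T.Opens} {j : Fin (n + 1)} (h : V ≤ f ⁻¹ᵁ chart n j) :
    Ideal.span (Set.range (formValues g f h)) = ⊤ := by
  rw [Ideal.eq_top_iff_one, ← coord_self f h, ← formValues_one f h, ← hg]
  have h1 : formValues (g' * g) f h =
      (g'.map (scalar (f ≫ (PP n ↘ Spec (.of ℂ))) V)).mulVec (formValues g f h) := by
    rw [formValues, Matrix.map_mul, ← Matrix.mulVec_mulVec]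
    rfl
  rw [h1, Matrix.mulVec, dotProduct]
  refine Ideal.sum_mem (Ideal.span (Set.range (formValues g f h))) fun q _ =>
    Ideal.mul_mem_left _ _ ?_
  exact Ideal.subset_span ⟨q, rfl⟩

/-- For invertible g the blow-up has empty centre: the ideal of ℙ(ker g) pulls back to the unit
ideal. So the identity of ℙⁿ lifts to the zero locus in ℙⁿ × ℙⁿ, and the first projection of the
lift is x ↦ gx. -/
theorem exists_linear_endomorphism {g g' : Matrix (Fin (n + 1)) (Fin (n + 1)) ℂ}
    (hg : g' * g = 1) :
    ∃ φ : PP n ⟶ PP n, φ ≫ (PP n ↘ Spec (.of ℂ)) = (PP n ↘ Spec (.of ℂ)) ∧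
      ∀ {T : Scheme.{0}} (f : T ⟶ PP n) {V : T.Opens} {j : Fin (n + 1)}
        (hj : V ≤ f ⁻¹ᵁ chart n j), Proportional (f ≫ φ) (formValues g f hj) := by
  obtain ⟨s, hs⟩ := exists_isMatrixSection g
  have hcart : IsCartier ((linearSubspaceIdeal n (LinearMap.ker g.mulVecLin)).comap (𝟙 _)) := by
    intro x
    obtain ⟨j, hj⟩ := exists_mem_chart (𝟙 (PP n)) x
    have hle : chart n j ≤ 𝟙 (PP n) ⁻¹ᵁ chart n j := fun _ h => h
    refine ⟨⟨chart n j, isAffineOpen_chart n j⟩, hj, 1, one_mem _, ?_⟩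
    rw [ideal_comap_ker g (𝟙 _) (isAffineOpen_chart n j) hle, span_formValues_eq_top hg,
      Ideal.span_singleton_one]
  obtain ⟨z, hz, -⟩ :=
    (isBlowUp_zeroLocus (mul_eq_one_comm.mp hg) hs).universal _ (𝟙 _) hcart
  have hz' : z ≫ (Q01 n n).zeroLocusι s ≫ pr₂ n n = 𝟙 _ := hz
  refine ⟨z ≫ (Q01 n n).zeroLocusι s ≫ pr₁ n n, ?_, ?_⟩
  · rw [Category.assoc, Category.assoc, Limits.pullback.condition, ← Category.assoc,
      ← Category.assoc, Category.assoc z, hz', Category.id_comp]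
  · intro T f V j hj
    have h1 : (f ≫ z) ≫ (Q01 n n).zeroLocusι s ≫ pr₂ n n = f := by
      rw [Category.assoc, hz', Category.comp_id]
    have h2 := proportional_formValues hs (f ≫ z) h1 hj
    rwa [Category.assoc] at h2

/-- By proportionality gx is (gx)ᵢ times the normalized coordinates of h; A is then applied to both
sides. -/
theorem formValues_mul {g : Matrix (Fin (n + 1)) (Fin (n + 1)) ℂ}
    (A : Matrix (Fin (m + 1)) (Fin (n + 1)) ℂ) {T : Scheme.{0}} {f h : T ⟶ PP n}
    (e : f ≫ (PP n ↘ Spec (.of ℂ)) = h ≫ (PP n ↘ Spec (.of ℂ))) {V : T.Opens} {i j : Fin (n + 1)}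
    (hi : V ≤ h ⁻¹ᵁ chart n i) (hj : V ≤ f ⁻¹ᵁ chart n j) (H : Proportional h (formValues g f hj))
    (q : Fin (m + 1)) :
    formValues (A * g) f hj q = formValues g f hj i * formValues A h hi q := by
  have h1 : formValues g f hj = formValues g f hj i • coord h hi := by
    funext p
    have := H V le_rfl i hi p
    rw [res_self, res_self] at this
    rw [this, Pi.smul_apply, smul_eq_mul, mul_comm]
  have h2 : formValues (A * g) f hj =
      (A.map (scalar (f ≫ (PP n ↘ Spec (.of ℂ))) V)).mulVec (formValues g f hj) := by
    rw [formValues, Matrix.map_mul, ← Matrix.mulVec_mulVec]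
    rfl
  rw [h2, h1, Matrix.mulVec_smul, e]
  simp only [Pi.smul_apply, smul_eq_mul, coord_self, mul_one]
  rfl

/-- The coordinate vector x = g'gx is proportional both to the composite and to the identity, and it
generates the unit ideal, so the two agree. -/
theorem linear_endomorphism_comp {g g' : Matrix (Fin (n + 1)) (Fin (n + 1)) ℂ} (hg : g' * g = 1)
    {φ φ' : PP n ⟶ PP n} (hφ : φ ≫ (PP n ↘ Spec (.of ℂ)) = (PP n ↘ Spec (.of ℂ)))
    (hφ' : φ' ≫ (PP n ↘ Spec (.of ℂ)) = (PP n ↘ Spec (.of ℂ)))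
    (H : ∀ {T : Scheme.{0}} (f : T ⟶ PP n) {V : T.Opens} {j : Fin (n + 1)}
        (hj : V ≤ f ⁻¹ᵁ chart n j), Proportional (f ≫ φ) (formValues g f hj))
    (H' : ∀ {T : Scheme.{0}} (f : T ⟶ PP n) {V : T.Opens} {j : Fin (n + 1)}
        (hj : V ≤ f ⁻¹ᵁ chart n j), Proportional (f ≫ φ') (formValues g' f hj)) :
    φ ≫ φ' = 𝟙 _ := by
  apply eq_of_proportional
  · rw [Category.assoc, hφ', hφ, Category.id_comp]
  intro t
  obtain ⟨i, hi⟩ := exists_mem_chart φ t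
  obtain ⟨j, hj⟩ := exists_mem_chart (𝟙 (PP n)) t
  obtain ⟨V, hV, htV, hVij⟩ := exists_isAffineOpen_mem_and_subset
    (U := φ ⁻¹ᵁ chart n i ⊓ 𝟙 (PP n) ⁻¹ᵁ chart n j) (x := t) ⟨hi, hj⟩
  have hVi : V ≤ φ ⁻¹ᵁ chart n i := le_trans hVij inf_le_left
  have hVj : V ≤ 𝟙 (PP n) ⁻¹ᵁ chart n j := le_trans hVij inf_le_right
  refine ⟨V, hV, htV, coord (𝟙 _) hVj, ?_, ?_, 1, one_mem _, ?_⟩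
  · have h1 : ∀ q, coord (𝟙 _) hVj q =
        formValues g (𝟙 _) hVj i * formValues g' φ hVi q := by
      intro q
      rw [← formValues_one, ← hg]
      refine formValues_mul g' ?_ hVi hVj ?_ q
      · rw [hφ, Category.id_comp]
      · have := H (𝟙 _) hVj
        rwa [Category.id_comp] at this
    intro W hW k hk q
    rw [h1, h1, map_mul, map_mul, H' φ hVi W hW k hk q]
    ring
  · intro W hW k hk q
    rw [res_coord, res_coord, mul_comm, coord_mul_coord]
  · rw [← formValues_one, span_formValues_eq_top (mul_one 1), Ideal.span_singleton_one]

/-- Locally the two ideals have generators A·(gx normalized) and A·gx, which differ by the factor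
(gx)ᵢ. This factor is a unit, because it generates the same ideal as all entries of gx. -/
theorem linearSubspaceIdeal_comap {g g' : Matrix (Fin (n + 1)) (Fin (n + 1)) ℂ} (hg : g' * g = 1)
    {φ : PP n ⟶ PP n} (hφ : φ ≫ (PP n ↘ Spec (.of ℂ)) = (PP n ↘ Spec (.of ℂ)))
    (H : ∀ {T : Scheme.{0}} (f : T ⟶ PP n) {V : T.Opens} {j : Fin (n + 1)}
        (hj : V ≤ f ⁻¹ᵁ chart n j), Proportional (f ≫ φ) (formValues g f hj))
    (A : Matrix (Fin (m + 1)) (Fin (n + 1)) ℂ) :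
    (linearSubspaceIdeal n (LinearMap.ker A.mulVecLin)).comap φ =
      linearSubspaceIdeal n (LinearMap.ker (A * g).mulVecLin) := by
  have hloc : ∀ t : PP n, ∃ (V : (PP n).Opens) (i j : Fin (n + 1)), IsAffineOpen V ∧ t ∈ V ∧
      V ≤ φ ⁻¹ᵁ chart n i ∧ V ≤ 𝟙 (PP n) ⁻¹ᵁ chart n j := by
    intro t
    obtain ⟨i, hi⟩ := exists_mem_chart φ t
    obtain ⟨j, hj⟩ := exists_mem_chart (𝟙 (PP n)) t
    obtain ⟨V, hV, htV, hVij⟩ := exists_isAffineOpen_mem_and_subset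
      (U := φ ⁻¹ᵁ chart n i ⊓ 𝟙 (PP n) ⁻¹ᵁ chart n j) (x := t) ⟨hi, hj⟩
    exact ⟨V, i, j, hV, htV, le_trans hVij inf_le_left, le_trans hVij inf_le_right⟩
  choose V i j hV htV hVi hVj using hloc
  apply Scheme.IdealSheafData.ext_of_iSup_eq_top (fun t => ⟨V t, hV t⟩)
  · rw [eq_top_iff]
    intro t _
    exact TopologicalSpace.Opens.mem_iSup.mpr ⟨t, htV t⟩
  intro t
  have h1 : linearSubspaceIdeal n (LinearMap.ker (A * g).mulVecLin) =
      (linearSubspaceIdeal n (LinearMap.ker (A * g).mulVecLin)).comap (𝟙 _) :=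
    (Scheme.IdealSheafData.comap_id _).symm
  have hid : Proportional φ (formValues g (𝟙 _) (hVj t)) := by
    have := H (𝟙 _) (hVj t)
    rwa [Category.id_comp] at this
  rw [h1, ideal_comap_ker A φ (hV t) (hVi t), ideal_comap_ker (A * g) (𝟙 _) (hV t) (hVj t)]
  have h2 : formValues (A * g) (𝟙 _) (hVj t) =
      formValues g (𝟙 _) (hVj t) (i t) • formValues A φ (hVi t) := by
    funext q
    exact formValues_mul A (by rw [hφ, Category.id_comp]) (hVi t) (hVj t) hid q
  have hu : IsUnit (formValues g (𝟙 _) (hVj t) (i t)) := by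
    have h3 := span_formValues_eq_top hg (𝟙 _) (hVj t)
    rw [span_range_eq_of_proportional (i := i t) (y := coord φ (hVi t)) fun q => by
      have := hid _ le_rfl (i t) (hVi t) q
      rwa [res_self, res_self] at this] at h3
    exact Ideal.span_singleton_eq_top.mp h3
  rw [h2]
  apply le_antisymm
  · rw [Ideal.span_le]
    rintro _ ⟨q, rfl⟩
    rw [SetLike.mem_coe, ← Ideal.unit_mul_mem_iff_mem _ hu]
    exact Ideal.subset_span ⟨q, rfl⟩
  · rw [Ideal.span_le]
    rintro _ ⟨q, rfl⟩
    exact Ideal.mul_mem_left _ _ (Ideal.subset_span ⟨q, rfl⟩)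

/-! ### Transport along isomorphisms and uniqueness of blow-ups -/

theorem IsBlowUp.comp_iso {X X' B : Scheme.{0}} {I : X.IdealSheafData} {π : B ⟶ X}
    (h : IsBlowUp I π) {φ : X' ⟶ X} {φ' : X ⟶ X'} (h₁ : φ ≫ φ' = 𝟙 _) (h₂ : φ' ≫ φ = 𝟙 _) :
    IsBlowUp (I.comap φ) (π ≫ φ') where
  cartier := by
    rw [← Scheme.IdealSheafData.comap_comp, Category.assoc, h₂, Category.comp_id]
    exact h.cartier
  universal T f hf := by
    rw [← Scheme.IdealSheafData.comap_comp] at hf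
    obtain ⟨g, hg, hg'⟩ := h.universal T (f ≫ φ) hf
    refine ⟨g, ?_, fun k hk => hg' k ?_⟩
    · change g ≫ π ≫ φ' = f
      rw [← Category.assoc, hg, Category.assoc, h₁, Category.comp_id]
    · rw [← hk, Category.assoc, Category.assoc, h₂, Category.comp_id]

theorem IsBlowUp.exists_iso {X B B' : Scheme.{0}} {I : X.IdealSheafData} {π : B ⟶ X}
    {π' : B' ⟶ X} (h : IsBlowUp I π) (h' : IsBlowUp I π') : ∃ e : B ≅ B', e.hom ≫ π' = π := by
  obtain ⟨a, ha, -⟩ := h'.universal B π h.cartier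
  obtain ⟨b, hb, -⟩ := h.universal B' π' h'.cartier
  refine ⟨⟨a, b, ?_, ?_⟩, ha⟩
  · exact (h.universal B π h.cartier).unique (by rw [Category.assoc, hb, ha])
      (Category.id_comp _)
  · exact (h'.universal B' π' h'.cartier).unique (by rw [Category.assoc, ha, hb])
      (Category.id_comp _)

/-- The blow-ups of `ℙⁿ` along two linear subspaces of the same dimension are isomorphic. -/
theorem exists_iso_of_isBlowUp {A : Matrix (Fin (m + 1)) (Fin (n + 1)) ℂ}
    {g g' : Matrix (Fin (n + 1)) (Fin (n + 1)) ℂ} (hg : g' * g = 1)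
    {B B' : Scheme.{0}} {π : B ⟶ PP n} {π' : B' ⟶ PP n}
    (h : IsBlowUp (linearSubspaceIdeal n (LinearMap.ker (A * g).mulVecLin)) π)
    (h' : IsBlowUp (linearSubspaceIdeal n (LinearMap.ker A.mulVecLin)) π') :
    Nonempty (Over.mk (π ≫ (PP n ↘ Spec (.of ℂ))) ≅ Over.mk (π' ≫ (PP n ↘ Spec (.of ℂ)))) := by
  obtain ⟨φ, hφ, H⟩ := exists_linear_endomorphism hg
  obtain ⟨φ', hφ', H'⟩ := exists_linear_endomorphism (mul_eq_one_comm.mp hg)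
  have h2 := h'.comp_iso (linear_endomorphism_comp hg hφ hφ' H H')
    (linear_endomorphism_comp (mul_eq_one_comm.mp hg) hφ' hφ H' H)
  rw [linearSubspaceIdeal_comap hg hφ H A] at h2
  obtain ⟨e, he⟩ := h.exists_iso h2
  refine ⟨Over.isoMk e ?_⟩
  change e.hom ≫ π' ≫ (PP n ↘ Spec (.of ℂ)) = π ≫ (PP n ↘ Spec (.of ℂ))
  rw [← he, Category.assoc, Category.assoc, hφ']

end

/-! ### Linear algebra -/

section

/-- A is the quotient map by L in coordinates, and B is a linear section of it. -/
theorem exists_matrix_of_submodule {n r : ℕ} (hr : r ≤ n) (L : Submodule ℂ (Fin (n + 1) → ℂ))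
    (hL : Module.finrank ℂ L = r) :
    ∃ (A : Matrix (Fin (n - r + 1)) (Fin (n + 1)) ℂ) (B : Matrix (Fin (n + 1)) (Fin (n - r + 1)) ℂ),
      A * B = 1 ∧ LinearMap.ker A.mulVecLin = L := by
  have h1 : Module.finrank ℂ ((Fin (n + 1) → ℂ) ⧸ L) = Module.finrank ℂ (Fin (n - r + 1) → ℂ) := by
    have := L.finrank_quotient_add_finrank
    rw [hL, Module.finrank_fin_fun] at this
    rw [Module.finrank_fin_fun]
    omega
  let e := LinearEquiv.ofFinrankEq _ _ h1
  let f : (Fin (n + 1) → ℂ) →ₗ[ℂ] (Fin (n - r + 1) → ℂ) := e.toLinearMap ∘ₗ L.mkQ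
  have hf : LinearMap.range f = ⊤ := by
    rw [LinearMap.range_eq_top]
    exact e.surjective.comp L.mkQ_surjective
  obtain ⟨k, hk⟩ := f.exists_rightInverse_of_surjective hf
  refine ⟨LinearMap.toMatrix' f, LinearMap.toMatrix' k, ?_, ?_⟩
  · rw [← LinearMap.toMatrix'_comp, hk, LinearMap.toMatrix'_id]
  · rw [← Matrix.toLin'_apply', Matrix.toLin'_toMatrix']
    ext x
    simp [f]

/-- Complements of K and L have equal dimension as well, so isomorphisms of the two pairs of
summands can be added. -/
theorem exists_linearEquiv_mem_iff {V : Type} [AddCommGroup V] [Module ℂ V]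
    [FiniteDimensional ℂ V] {K L : Submodule ℂ V}
    (h : Module.finrank ℂ K = Module.finrank ℂ L) : ∃ g : V ≃ₗ[ℂ] V, ∀ x, g x ∈ K ↔ x ∈ L := by
  obtain ⟨K', hK⟩ := K.exists_isCompl
  obtain ⟨L', hL⟩ := L.exists_isCompl
  have h' : Module.finrank ℂ L' = Module.finrank ℂ K' := by
    have h1 := Submodule.finrank_add_eq_of_isCompl hK
    have h2 := Submodule.finrank_add_eq_of_isCompl hL
    omega
  let θ := LinearEquiv.ofFinrankEq _ _ h.symm
  let ψ := LinearEquiv.ofFinrankEq _ _ h'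
  refine ⟨(Submodule.prodEquivOfIsCompl L L' hL).symm ≪≫ₗ (θ.prodCongr ψ) ≪≫ₗ
    Submodule.prodEquivOfIsCompl K K' hK, fun x => ?_⟩
  obtain ⟨⟨a, b⟩, rfl⟩ := (Submodule.prodEquivOfIsCompl L L' hL).surjective x
  rw [LinearEquiv.trans_apply, LinearEquiv.trans_apply, LinearEquiv.symm_apply_apply]
  change (θ a : V) + ψ b ∈ K ↔ (a : V) + b ∈ L
  rw [K.add_mem_iff_right (θ a).2, L.add_mem_iff_right a.2]
  have key : ∀ {M M' : Submodule ℂ V}, IsCompl M M' → ∀ c : M', (c : V) ∈ M ↔ c = 0 := by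
    intro M M' hM c
    constructor
    · intro hc
      exact Subtype.ext (Submodule.disjoint_def.mp hM.disjoint c hc c.2)
    · rintro rfl
      exact M.zero_mem
  rw [key hK, key hL, LinearEquiv.map_eq_zero_iff]

theorem exists_matrix_mul_ker_eq {m n : ℕ} {A : Matrix (Fin (m + 1)) (Fin (n + 1)) ℂ}
    {B : Matrix (Fin (n + 1)) (Fin (m + 1)) ℂ} (hAB : A * B = 1)
    (L : Submodule ℂ (Fin (n + 1) → ℂ)) (hL : Module.finrank ℂ L + m = n) :
    ∃ g g' : Matrix (Fin (n + 1)) (Fin (n + 1)) ℂ,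
      g' * g = 1 ∧ LinearMap.ker (A * g).mulVecLin = L := by
  have hsurj : Function.Surjective A.mulVecLin := by
    intro v
    refine ⟨B.mulVec v, ?_⟩
    rw [Matrix.mulVecLin_apply, Matrix.mulVec_mulVec, hAB, Matrix.one_mulVec]
  have h1 : Module.finrank ℂ (LinearMap.ker A.mulVecLin) = Module.finrank ℂ L := by
    have := A.mulVecLin.finrank_range_add_finrank_ker
    rw [LinearMap.range_eq_top.mpr hsurj, finrank_top, Module.finrank_fin_fun,
      Module.finrank_fin_fun] at this
    omega
  obtain ⟨g, hg⟩ := exists_linearEquiv_mem_iff h1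
  refine ⟨LinearMap.toMatrix' g.toLinearMap, LinearMap.toMatrix' g.symm.toLinearMap, ?_, ?_⟩
  · rw [← LinearMap.toMatrix'_comp, LinearEquiv.symm_comp, LinearMap.toMatrix'_id]
  · ext x
    rw [← hg x, Matrix.mulVecLin_mul, LinearMap.mem_ker, LinearMap.comp_apply, LinearMap.mem_ker]
    have : (LinearMap.toMatrix' g.toLinearMap).mulVecLin = g.toLinearMap := by
      rw [← Matrix.toLin'_apply', Matrix.toLin'_toMatrix']
    rw [this]
    rfl

end

/-! ### Supports of Laurent polynomials -/

section

theorem exists_eq_single_of_sum_eq_one {N : ℕ} {c : Fin N → ℤ} (h0 : ∀ k, 0 ≤ c k)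
    (h1 : ∑ k, c k = 1) : ∃ k, c = Pi.single k 1 := by
  obtain ⟨k, hk⟩ : ∃ k, c k ≠ 0 := by
    by_contra! h
    simp [h] at h1
  have hk1 : 1 ≤ c k := by have := h0 k; omega
  have h2 : c k + ∑ l ∈ Finset.univ.erase k, c l = 1 := by
    rw [Finset.add_sum_erase _ _ (Finset.mem_univ k), h1]
  have h3 : 0 ≤ ∑ l ∈ Finset.univ.erase k, c l := Finset.sum_nonneg fun l _ => h0 l
  have h4 : ∑ l ∈ Finset.univ.erase k, c l = 0 := by omega
  rw [Finset.sum_eq_zero_iff_of_nonneg fun l _ => h0 l] at h4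
  refine ⟨k, funext fun l => ?_⟩
  by_cases hl : l = k
  · subst hl
    rw [Pi.single_eq_same]
    omega
  · rw [Pi.single_eq_of_ne hl]
    exact h4 l (Finset.mem_erase.mpr ⟨hl, Finset.mem_univ l⟩)

/-- The coefficients of a section of `Q` that vanish at the monomials that occur in constant
sections vanish identically. -/
theorem coefficients_eq_zero {m : ℕ} {d : Fin (m + 1) → Fin (m + 1) → (Fin (m + 1) → ℤ) → ℂ}
    (hself : ∀ i a, d i i a = 0)
    (hsupp : ∀ i q a, d i q a ≠ 0 → (∀ k, k ≠ i → 0 ≤ a k) ∧ ∑ k, a k = 0)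
    (hrel : ∀ i i' q a, d i q a = d i' q a - d i' i (a - Pi.single q 1 + Pi.single i 1))
    (h0 : ∀ q, ∃ i, i ≠ q ∧ d i q 0 = 0) (i q : Fin (m + 1)) (a : Fin (m + 1) → ℤ) :
    d i q a = 0 := by
  have hneg : ∀ i q a k, k ≠ i → a k < 0 → d i q a = 0 := by
    intro i q a k hk ha
    by_contra h
    have := (hsupp i q a h).1 k hk
    omega
  -- Passing from chart l to chart i adds a term with exponent -1 at q ≠ l, which lies outside the
  -- support on chart l.
  have hzero : ∀ i q, i ≠ q → d i q 0 = 0 := by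
    intro i q hiq
    obtain ⟨l, hlq, hl⟩ := h0 q
    rw [hrel i l q, hl, hneg l i _ q hlq.symm (by simp [hiq.symm]), sub_zero]
  by_cases hiq : i = q
  · rw [hiq, hself]
  -- The case i' = q of the relation: it exchanges i and q, and so also bounds the exponent at i
  -- from below by -1.
  have hdual : ∀ a, d i q a = - d q i (a - Pi.single q 1 + Pi.single i 1) := by
    intro a
    rw [hrel i q q, hself, zero_sub]
  by_contra h
  obtain ⟨h1, h2⟩ := hsupp i q a h
  have h3 : 0 ≤ a i + 1 := by
    have h4 := h
    rw [hdual, neg_eq_zero] at h4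
    have := (hsupp _ _ _ h4).1 i hiq
    simpa [hiq] using this
  -- Now a + eᵢ is nonnegative with sum 1, so a = eₖ - eᵢ. The cases k = i and k = q reduce to
  -- exponent zero; for other k, chart k excludes both terms of the relation.
  obtain ⟨k, hk⟩ := exists_eq_single_of_sum_eq_one (c := a + Pi.single i 1) (by
    intro k
    by_cases hki : k = i
    · subst hki
      simpa using h3
    · simpa [hki] using h1 k hki) (by simp [Finset.sum_add_distrib, h2])
  have ha : a = Pi.single k 1 - Pi.single i 1 := by rw [← hk, add_sub_cancel_right]
  by_cases hki : k = i
  · apply h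
    rw [ha, hki, sub_self, hzero i q hiq]
  by_cases hkq : k = q
  · apply h
    rw [hdual, ha, hkq, show (Pi.single q 1 - Pi.single i 1 - Pi.single q 1 + Pi.single i 1 :
      Fin (m + 1) → ℤ) = 0 by abel, hzero q i (Ne.symm hiq), neg_zero]
  · apply h
    rw [hrel i k q, hneg k q a i (Ne.symm hki) (by simp [ha, Ne.symm hki]),
      hneg k i _ q (Ne.symm hkq) (by simp [ha, Ne.symm hkq, Ne.symm hiq]), sub_zero]

end

/-! ### Functions on the charts as Laurent polynomials -/

section

variable {m n : ℕ}

theorem exists_prod_point {T : Scheme.{0}} (τ : T ⟶ Spec (.of ℂ)) (i : Fin (m + 1))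
    (j : Fin (n + 1)) (y : Fin (m + 1) → Γ(T, ⊤)) (x : Fin (n + 1) → Γ(T, ⊤)) (hy : y i = 1)
    (hx : x j = 1) :
    ∃ k : T ⟶ PPprod m n, (k ≫ pr₁ m n) ≫ (PP m ↘ Spec (.of ℂ)) = τ ∧
      (k ≫ pr₂ m n) ≫ (PP n ↘ Spec (.of ℂ)) = τ ∧
      (∃ hi : ⊤ ≤ (k ≫ pr₁ m n) ⁻¹ᵁ chart m i, ∀ q, coord (k ≫ pr₁ m n) hi q = y q) ∧
      ∃ hj : ⊤ ≤ (k ≫ pr₂ m n) ⁻¹ᵁ chart n j, ∀ p, coord (k ≫ pr₂ m n) hj p = x p := by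
  obtain ⟨Y, hYτ, hYi, hY⟩ := exists_point τ i y hy
  obtain ⟨X, hXτ, hXj, hX⟩ := exists_point τ j x hx
  have hk₁ : Limits.pullback.lift Y X (hYτ.trans hXτ.symm) ≫ pr₁ m n = Y :=
    Limits.pullback.lift_fst _ _ _
  have hk₂ : Limits.pullback.lift Y X (hYτ.trans hXτ.symm) ≫ pr₂ m n = X :=
    Limits.pullback.lift_snd _ _ _
  refine ⟨Limits.pullback.lift Y X (hYτ.trans hXτ.symm), by rw [hk₁, hYτ], by rw [hk₂, hXτ],
    ?_, ?_⟩
  · rw [hk₁]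
    exact ⟨hYi, hY⟩
  · rw [hk₂]
    exact ⟨hXj, hX⟩

theorem prod_point_ext {T : Scheme.{0}} {k k' : T ⟶ PPprod m n} {i : Fin (m + 1)}
    {j : Fin (n + 1)} (e : (k ≫ pr₁ m n) ≫ (PP m ↘ Spec (.of ℂ)) =
      (k' ≫ pr₁ m n) ≫ (PP m ↘ Spec (.of ℂ)))
    (hi : ⊤ ≤ (k ≫ pr₁ m n) ⁻¹ᵁ chart m i) (hi' : ⊤ ≤ (k' ≫ pr₁ m n) ⁻¹ᵁ chart m i)
    (hj : ⊤ ≤ (k ≫ pr₂ m n) ⁻¹ᵁ chart n j) (hj' : ⊤ ≤ (k' ≫ pr₂ m n) ⁻¹ᵁ chart n j)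
    (h₁ : ∀ q, coord (k ≫ pr₁ m n) hi q = coord (k' ≫ pr₁ m n) hi' q)
    (h₂ : ∀ p, coord (k ≫ pr₂ m n) hj p = coord (k' ≫ pr₂ m n) hj' p) : k = k' := by
  apply Limits.pullback.hom_ext
  · exact point_ext i e hi hi' h₁
  · refine point_ext j ?_ hj hj' h₂
    have : ∀ l : T ⟶ PPprod m n, (l ≫ pr₂ m n) ≫ (PP n ↘ Spec (.of ℂ)) =
        (l ≫ pr₁ m n) ≫ (PP m ↘ Spec (.of ℂ)) := by
      intro l
      rw [Category.assoc, Category.assoc, Limits.pullback.condition]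
    exact (this k).trans (e.trans (this k').symm)

/-- Exponents of Laurent monomials in `y₀, …, yₘ` and `x₀, …, xₙ`. -/
abbrev Exponent (m n : ℕ) : Type := (Fin (m + 1) → ℤ) × (Fin (n + 1) → ℤ)

/-- The exponent of `y_q / y_i`. -/
def yExp (q i : Fin (m + 1)) : Exponent m n := (Pi.single q 1 - Pi.single i 1, 0)

/-- The exponent of `x_p / x_j`. -/
def xExp (p j : Fin (n + 1)) : Exponent m n := (0, Pi.single p 1 - Pi.single j 1)

/-- The exponents of the monomials in the functions `y_q / y_i` and `x_p / x_j`. -/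
def cone (i : Fin (m + 1)) (j : Fin (n + 1)) : AddSubmonoid (Exponent m n) where
  carrier := {e | ((∀ q, q ≠ i → 0 ≤ e.1 q) ∧ ∑ q, e.1 q = 0) ∧
    (∀ p, p ≠ j → 0 ≤ e.2 p) ∧ ∑ p, e.2 p = 0}
  add_mem' := by
    rintro a b ⟨⟨h1, h2⟩, h3, h4⟩ ⟨⟨h1', h2'⟩, h3', h4'⟩
    refine ⟨⟨fun q hq => add_nonneg (h1 q hq) (h1' q hq), ?_⟩,
      fun p hp => add_nonneg (h3 p hp) (h3' p hp), ?_⟩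
    · simp [Finset.sum_add_distrib, h2, h2']
    · simp [Finset.sum_add_distrib, h4, h4']
  zero_mem' := by simp

theorem yExp_mem_cone (q i : Fin (m + 1)) (j : Fin (n + 1)) : yExp q i ∈ cone i j := by
  refine ⟨⟨fun k hk => ?_, by simp [yExp]⟩, by simp [yExp], by simp [yExp]⟩
  simp only [yExp, Pi.sub_apply, Pi.single_eq_of_ne hk, sub_zero, Pi.single_apply]
  split_ifs <;> simp

theorem xExp_mem_cone (p j : Fin (n + 1)) (i : Fin (m + 1)) : xExp p j ∈ cone i j := by
  refine ⟨⟨by simp [xExp], by simp [xExp]⟩, fun k hk => ?_, by simp [xExp]⟩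
  simp only [xExp, Pi.sub_apply, Pi.single_eq_of_ne hk, sub_zero, Pi.single_apply]
  split_ifs <;> simp

/-! ### Monoid algebras of the cones as rings of functions on charts -/

/-- Only the exponent at i may be negative, and there the base is 1, so truncation by `Int.toNat`
does no harm. -/
theorem prod_pow_toNat_add {R : Type} [CommRing R] {N : ℕ} {y : Fin N → R} {i : Fin N}
    (hy : y i = 1) {a b : Fin N → ℤ} (ha : ∀ q, q ≠ i → 0 ≤ a q) (hb : ∀ q, q ≠ i → 0 ≤ b q) :
    ∏ q, y q ^ ((a + b) q).toNat = (∏ q, y q ^ (a q).toNat) * ∏ q, y q ^ (b q).toNat := by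
  rw [← Finset.prod_mul_distrib]
  refine Finset.prod_congr rfl fun q _ => ?_
  by_cases hq : q = i
  · rw [hq, hy, one_pow, one_pow, one_pow, one_mul]
  · rw [← pow_add, Pi.add_apply, Int.toNat_add (ha q hq) (hb q hq)]

theorem prod_pow_toNat_single {R : Type} [CommRing R] {N : ℕ} {y : Fin N → R} {i : Fin N}
    (hy : y i = 1) (p : Fin N) :
    ∏ q, y q ^ ((Pi.single p 1 - Pi.single i 1 : Fin N → ℤ) q).toNat = y p := by
  rw [Finset.prod_eq_single p]
  · by_cases hp : p = i
    · rw [hp, hy, one_pow]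
    · simp [hp]
  · intro q _ hq
    by_cases hi : q = i
    · rw [hi, hy, one_pow]
    · simp [hq, hi]
  · simp

/-- Evaluating monomials is multiplicative on the cone by `prod_pow_toNat_add`. This provides the
morphism from a chart to the spectrum of the cone algebra. -/
theorem exists_cone_lift {R : Type} [CommRing R] (ρ : ℂ →+* R) {i : Fin (m + 1)}
    {j : Fin (n + 1)} {y : Fin (m + 1) → R} {x : Fin (n + 1) → R} (hy : y i = 1) (hx : x j = 1) :
    ∃ φ : AddMonoidAlgebra ℂ (cone i j) →+* R,
      (∀ c, φ (AddMonoidAlgebra.single 0 c) = ρ c) ∧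
      (∀ q, φ (AddMonoidAlgebra.single ⟨yExp q i, yExp_mem_cone q i j⟩ 1) = y q) ∧
      ∀ p, φ (AddMonoidAlgebra.single ⟨xExp p j, xExp_mem_cone p j i⟩ 1) = x p := by
  let g : Multiplicative (cone i j) →* R :=
    { toFun := fun e => (∏ q, y q ^ (e.toAdd.1.1 q).toNat) * ∏ p, x p ^ (e.toAdd.1.2 p).toNat
      map_one' := by simp
      map_mul' := fun a b => by
        have h1 := prod_pow_toNat_add hy a.toAdd.2.1.1 b.toAdd.2.1.1
        have h2 := prod_pow_toNat_add hx a.toAdd.2.2.1 b.toAdd.2.2.1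
        refine (congrArg₂ (· * ·) h1 h2).trans ?_
        exact mul_mul_mul_comm _ _ _ _ }
  refine ⟨AddMonoidAlgebra.liftNCRingHom ρ g fun _ _ => Commute.all _ _, fun c => ?_, fun q => ?_,
    fun p => ?_⟩
  · rw [AddMonoidAlgebra.liftNCRingHom_single]
    exact (congrArg (ρ c * ·) (map_one g)).trans (mul_one _)
  · rw [AddMonoidAlgebra.liftNCRingHom_single, map_one, one_mul]
    refine (congrArg (· * _) (prod_pow_toNat_single hy q)).trans ?_
    simp [yExp]
  · rw [AddMonoidAlgebra.liftNCRingHom_single, map_one, one_mul]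
    refine (congrArg (_ * ·) (prod_pow_toNat_single hx p)).trans ?_
    simp [xExp]

/-! ### The torus and the Laurent expansion of functions -/

/-- The ring of Laurent polynomials in `y₀, …, yₘ` and `x₀, …, xₙ`. -/
abbrev laurent (m n : ℕ) : CommRingCat.{0} := .of (AddMonoidAlgebra ℂ (Exponent m n))

/-- Laurent monomials. -/
def monomial (e : Exponent m n) : laurent m n := AddMonoidAlgebra.single e (1 : ℂ)

theorem monomial_mul (e e' : Exponent m n) : monomial e * monomial e' = monomial (e + e') := by
  refine (AddMonoidAlgebra.single_mul_single _ _ _ _).trans ?_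
  rw [mul_one]
  rfl

theorem monomial_zero : monomial (0 : Exponent m n) = 1 := rfl

/-- The structure morphism of the spectrum of the ring of Laurent polynomials. -/
def laurentStr (m n : ℕ) : Spec (laurent m n) ⟶ Spec (.of ℂ) :=
  toSpec (R := .of ℂ) ((specFun (laurent m n)).comp AddMonoidAlgebra.singleZeroRingHom)

theorem scalar_laurentStr (c : ℂ) : scalar (laurentStr m n) ⊤ c =
    specFun (laurent m n) (AddMonoidAlgebra.single (0 : Exponent m n) c) :=
  pull_toSpec (R := .of ℂ) ((specFun (laurent m n)).comp AddMonoidAlgebra.singleZeroRingHom) c _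

/-- The point is defined in the charts with index 0. Its coordinates are Laurent monomials, hence
units, so it lies in all charts at once. -/
theorem exists_torus (m n : ℕ) : ∃ ρ : Spec (laurent m n) ⟶ PPprod m n,
    ((ρ ≫ pr₁ m n) ≫ (PP m ↘ Spec (.of ℂ)) = laurentStr m n ∧
      (ρ ≫ pr₂ m n) ≫ (PP n ↘ Spec (.of ℂ)) = laurentStr m n) ∧
    (∀ i, ∃ hi : ⊤ ≤ (ρ ≫ pr₁ m n) ⁻¹ᵁ chart m i, ∀ q,
      coord (ρ ≫ pr₁ m n) hi q = specFun (laurent m n) (monomial (yExp q i))) ∧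
    ∀ j, ∃ hj : ⊤ ≤ (ρ ≫ pr₂ m n) ⁻¹ᵁ chart n j, ∀ p,
      coord (ρ ≫ pr₂ m n) hj p = specFun (laurent m n) (monomial (xExp p j)) := by
  obtain ⟨ρ, hτ, hτ', ⟨hi, hiq⟩, hj, hjp⟩ := exists_prod_point (laurentStr m n) 0 0
    (fun q => specFun (laurent m n) (monomial (yExp q 0)))
    (fun p => specFun (laurent m n) (monomial (xExp p 0)))
    (by rw [yExp, sub_self, ← Prod.zero_eq_mk, monomial_zero, map_one])
    (by rw [xExp, sub_self, ← Prod.zero_eq_mk, monomial_zero, map_one])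
  refine ⟨ρ, ⟨hτ, hτ'⟩, fun i => ?_, fun j => ?_⟩
  · have hmul : ∀ q, monomial (yExp i 0 : Exponent m n) * monomial (yExp q i) =
        monomial (yExp q 0) := by
      intro q
      rw [monomial_mul]
      congr 1
      simp [yExp]
    have hu : IsUnit (specFun (laurent m n) (monomial (yExp i 0 : Exponent m n))) := by
      refine IsUnit.map _ (IsUnit.of_mul_eq_one (monomial (yExp 0 i)) ?_)
      rw [hmul, yExp, sub_self, ← Prod.zero_eq_mk, monomial_zero]
    have hi' := le_preimage_chart_of_isUnit (ρ ≫ pr₁ m n) hi (j := i) (by rwa [hiq])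
    refine ⟨hi', fun q => ?_⟩
    have := coord_mul_coord (ρ ≫ pr₁ m n) hi hi' q
    rw [hiq, hiq, ← hmul q, map_mul] at this
    exact hu.mul_left_cancel this
  · have hmul : ∀ p, monomial (xExp j 0 : Exponent m n) * monomial (xExp p j) =
        monomial (xExp p 0) := by
      intro q
      rw [monomial_mul]
      congr 1
      simp [xExp]
    have hu : IsUnit (specFun (laurent m n) (monomial (xExp j 0 : Exponent m n))) := by
      refine IsUnit.map _ (IsUnit.of_mul_eq_one (monomial (xExp 0 j)) ?_)
      rw [hmul, xExp, sub_self, ← Prod.zero_eq_mk, monomial_zero]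
    have hj' := le_preimage_chart_of_isUnit (ρ ≫ pr₂ m n) hj (j := j) (by rwa [hjp])
    refine ⟨hj', fun q => ?_⟩
    have := coord_mul_coord (ρ ≫ pr₂ m n) hj hj' q
    rw [hjp, hjp, ← hmul q, map_mul] at this
    exact hu.mul_left_cancel this

theorem specFun_bijective (R : CommRingCat.{0}) : Function.Bijective (specFun R) :=
  ConcreteCategory.bijective_of_isIso (Scheme.ΓSpecIso R).inv

/-- The generic point of the torus in `ℙᵐ × ℙⁿ`. -/
def torus (m n : ℕ) : Spec (laurent m n) ⟶ PPprod m n := (exists_torus m n).choose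

theorem torus_over : (torus m n ≫ pr₁ m n) ≫ (PP m ↘ Spec (.of ℂ)) = laurentStr m n :=
  (exists_torus m n).choose_spec.1.1

theorem torus_over' : (torus m n ≫ pr₂ m n) ≫ (PP n ↘ Spec (.of ℂ)) = laurentStr m n :=
  (exists_torus m n).choose_spec.1.2

theorem le_torus_preimage₁ (i : Fin (m + 1)) : ⊤ ≤ (torus m n ≫ pr₁ m n) ⁻¹ᵁ chart m i :=
  ((exists_torus m n).choose_spec.2.1 i).choose

theorem le_torus_preimage₂ (j : Fin (n + 1)) : ⊤ ≤ (torus m n ≫ pr₂ m n) ⁻¹ᵁ chart n j :=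
  ((exists_torus m n).choose_spec.2.2 j).choose

theorem coord_torus₁ (i q : Fin (m + 1)) :
    coord (torus m n ≫ pr₁ m n) (le_torus_preimage₁ i) q =
      specFun (laurent m n) (monomial (yExp q i)) :=
  ((exists_torus m n).choose_spec.2.1 i).choose_spec q

theorem coord_torus₂ (j p : Fin (n + 1)) :
    coord (torus m n ≫ pr₂ m n) (le_torus_preimage₂ j) p =
      specFun (laurent m n) (monomial (xExp p j)) :=
  ((exists_torus m n).choose_spec.2.2 j).choose_spec p

theorem le_preimage_prodChart {T : Scheme.{0}} {k : T ⟶ PPprod m n} {V : T.Opens}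
    {i : Fin (m + 1)} {j : Fin (n + 1)} (hi : V ≤ (k ≫ pr₁ m n) ⁻¹ᵁ chart m i)
    (hj : V ≤ (k ≫ pr₂ m n) ⁻¹ᵁ chart n j) : V ≤ k ⁻¹ᵁ prodChart m n i j :=
  fun _ hx => ⟨hi hx, hj hx⟩

theorem le_torus_preimage (i : Fin (m + 1)) (j : Fin (n + 1)) :
    ⊤ ≤ torus m n ⁻¹ᵁ prodChart m n i j :=
  le_preimage_prodChart (le_torus_preimage₁ i) (le_torus_preimage₂ j)

/-- The functions on a chart of `ℙᵐ × ℙⁿ` are Laurent polynomials with exponents in the cone of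
that chart. -/
theorem exists_factor_torus (i : Fin (m + 1)) (j : Fin (n + 1)) :
    ∃ ψ : Γ(PPprod m n, prodChart m n i j) →+* AddMonoidAlgebra ℂ (cone i j),
      Function.Injective ψ ∧ ∀ a, pull (torus m n) (le_torus_preimage i j) a =
        specFun (laurent m n) (AddMonoidAlgebra.mapDomainRingHom ℂ (cone i j).subtype (ψ a)) := by
  let E : CommRingCat.{0} := .of (AddMonoidAlgebra ℂ (cone i j))
  let δ : E →+* laurent m n := AddMonoidAlgebra.mapDomainRingHom ℂ (cone i j).subtype
  let τ : Spec E ⟶ Spec (.of ℂ) :=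
    toSpec (R := .of ℂ) ((specFun E).comp AddMonoidAlgebra.singleZeroRingHom)
  have hτ : ∀ c, scalar τ ⊤ c = specFun E (AddMonoidAlgebra.single (0 : cone i j) c) := fun c =>
    pull_toSpec (R := .of ℂ) ((specFun E).comp AddMonoidAlgebra.singleZeroRingHom) c _
  let Y : Fin (m + 1) → E := fun q =>
    AddMonoidAlgebra.single (⟨yExp q i, yExp_mem_cone q i j⟩ : cone i j) (1 : ℂ)
  let X : Fin (n + 1) → E := fun p =>
    AddMonoidAlgebra.single (⟨xExp p j, xExp_mem_cone p j i⟩ : cone i j) (1 : ℂ)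
  have hY : Y i = 1 := by
    have : (⟨yExp i i, yExp_mem_cone i i j⟩ : cone i j) = 0 := Subtype.ext (by simp [yExp])
    simp only [Y, this]
    rfl
  have hX : X j = 1 := by
    have : (⟨xExp j j, xExp_mem_cone j j i⟩ : cone i j) = 0 := Subtype.ext (by simp [xExp])
    simp only [X, this]
    rfl
  have hδY : ∀ q, δ (Y q) = monomial (yExp q i) := fun q => AddMonoidAlgebra.mapDomain_single
  have hδX : ∀ q, δ (X q) = monomial (xExp q j) := fun q => AddMonoidAlgebra.mapDomain_single
  obtain ⟨e, he₁, he₂, ⟨hi, hiq⟩, hj, hjp⟩ := exists_prod_point τ i j (fun q => specFun E (Y q))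
    (fun p => specFun E (X p)) (by rw [hY, map_one]) (by rw [hX, map_one])
  have heU : ⊤ ≤ e ⁻¹ᵁ prodChart m n i j := le_preimage_prodChart hi hj
  -- the inclusion of the chart factors through `e`
  let U := prodChart m n i j
  have hU₁ : ⊤ ≤ (U.ι ≫ pr₁ m n) ⁻¹ᵁ chart m i :=
    (le_ι_preimage U).trans (Scheme.Hom.preimage_mono U.ι inf_le_left)
  have hU₂ : ⊤ ≤ (U.ι ≫ pr₂ m n) ⁻¹ᵁ chart n j :=
    (le_ι_preimage U).trans (Scheme.Hom.preimage_mono U.ι inf_le_right)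
  obtain ⟨φ, hφ, hφY, hφX⟩ := exists_cone_lift
    (scalar ((U.ι ≫ pr₁ m n) ≫ (PP m ↘ Spec (.of ℂ))) ⊤)
    (coord_self (U.ι ≫ pr₁ m n) hU₁) (coord_self (U.ι ≫ pr₂ m n) hU₂)
  let b : U.toScheme ⟶ Spec E := toSpec (R := E) φ
  have hb := le_preimage_top b ⊤
  have hbe : b ≫ e = U.ι := by
    refine prod_point_ext (i := i) (j := j) ?_ (hb.trans (Scheme.Hom.preimage_mono b hi)) hU₁
      (hb.trans (Scheme.Hom.preimage_mono b hj)) hU₂ (fun q => ?_) fun p => ?_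
    · rw [Category.assoc b, Category.assoc b, he₁]
      apply scalar_injective_hom
      intro c
      rw [← pull_scalar b τ hb, hτ, pull_toSpec, hφ]
    · rw [coord_congr (Category.assoc b e (pr₁ m n)) _ (hb.trans (Scheme.Hom.preimage_mono b hi)),
        ← pull_coord b (e ≫ pr₁ m n) hi hb, hiq, pull_toSpec, hφY]
    · rw [coord_congr (Category.assoc b e (pr₂ m n)) _ (hb.trans (Scheme.Hom.preimage_mono b hj)),
        ← pull_coord b (e ≫ pr₂ m n) hj hb, hjp, pull_toSpec, hφX]
  have hinj := pull_injective_of_section e heU b hb hbe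
  -- the torus maps to the chart through `e`
  let κ : Spec (laurent m n) ⟶ Spec E := toSpec (R := E) ((specFun (laurent m n)).comp δ)
  have hκ := le_preimage_top κ ⊤
  have hκe : κ ≫ e = torus m n := by
    refine prod_point_ext (i := i) (j := j) ?_ (hκ.trans (Scheme.Hom.preimage_mono κ hi))
      (le_torus_preimage₁ i) (hκ.trans (Scheme.Hom.preimage_mono κ hj)) (le_torus_preimage₂ j)
      (fun q => ?_) fun p => ?_
    · rw [Category.assoc κ, Category.assoc κ, he₁, torus_over]
      apply scalar_injective_hom
      intro c
      rw [← pull_scalar κ τ hκ, hτ, pull_toSpec, scalar_laurentStr]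
      exact congrArg (specFun (laurent m n)) AddMonoidAlgebra.mapDomain_single
    · rw [coord_congr (Category.assoc κ e (pr₁ m n)) _ (hκ.trans (Scheme.Hom.preimage_mono κ hi)),
        ← pull_coord κ (e ≫ pr₁ m n) hi hκ, hiq, pull_toSpec, coord_torus₁, RingHom.comp_apply,
        hδY]
    · rw [coord_congr (Category.assoc κ e (pr₂ m n)) _ (hκ.trans (Scheme.Hom.preimage_mono κ hj)),
        ← pull_coord κ (e ≫ pr₂ m n) hj hκ, hjp, pull_toSpec, coord_torus₂, RingHom.comp_apply,
        hδX]
  -- The map ψ is pull-back along e, injective because the inclusion of the chart factors through e.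
  -- Factoring the torus through e confines the exponents to the cone.
  let ε := RingEquiv.ofBijective (specFun E) (specFun_bijective E)
  refine ⟨ε.symm.toRingHom.comp (pull e heU), ε.symm.injective.comp hinj, fun a => ?_⟩
  obtain ⟨c, hc⟩ := (specFun_bijective E).2 (pull e heU a)
  have h1 : ε.symm.toRingHom.comp (pull e heU) a = c := by
    rw [RingHom.comp_apply, ← hc]
    exact ε.symm_apply_apply c
  have h2 : ⊤ ≤ (κ ≫ e) ⁻¹ᵁ prodChart m n i j := hκ.trans (Scheme.Hom.preimage_mono κ heU)
  rw [h1, ← pull_congr hκe h2, ← pull_pull κ e heU hκ, ← hc, pull_toSpec]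
  rfl

end

/-! ### The global sections of `Q(0,1)` -/

section

variable {m n : ℕ}

/-- The Laurent polynomial of a function on a chart of `ℙᵐ × ℙⁿ`. -/
def toLaurent (i : Fin (m + 1)) (j : Fin (n + 1)) :
    Γ(PPprod m n, prodChart m n i j) →+* laurent m n :=
  (RingEquiv.ofBijective _ (specFun_bijective (laurent m n))).symm.toRingHom.comp
    (pull (torus m n) (le_torus_preimage i j))

theorem specFun_toLaurent (i : Fin (m + 1)) (j : Fin (n + 1))
    (a : Γ(PPprod m n, prodChart m n i j)) :
    specFun (laurent m n) (toLaurent i j a) = pull (torus m n) (le_torus_preimage i j) a :=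
  (RingEquiv.ofBijective _ (specFun_bijective (laurent m n))).apply_symm_apply _

theorem toLaurent_eq_iff {i : Fin (m + 1)} {j : Fin (n + 1)}
    {a : Γ(PPprod m n, prodChart m n i j)} {x : laurent m n} :
    toLaurent i j a = x ↔
      pull (torus m n) (le_torus_preimage i j) a = specFun (laurent m n) x := by
  rw [← specFun_toLaurent]
  exact (specFun_bijective (laurent m n)).1.eq_iff.symm

theorem toLaurent_injective (i : Fin (m + 1)) (j : Fin (n + 1)) :
    Function.Injective (toLaurent (m := m) (n := n) i j) := by
  obtain ⟨ψ, hψ, h⟩ := exists_factor_torus i j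
  intro a b hab
  rw [toLaurent_eq_iff, specFun_toLaurent, h, h] at hab
  exact hψ (AddMonoidAlgebra.mapDomain_injective Subtype.val_injective
    ((specFun_bijective (laurent m n)).1 hab))

/-- The coefficients of a function on a chart of `ℙᵐ × ℙⁿ`. -/
def coefficient (i : Fin (m + 1)) (j : Fin (n + 1)) (a : Γ(PPprod m n, prodChart m n i j))
    (e : Exponent m n) : ℂ :=
  AddMonoidAlgebra.coeff (toLaurent i j a) e

theorem eq_zero_of_coefficient {i : Fin (m + 1)} {j : Fin (n + 1)}
    {a : Γ(PPprod m n, prodChart m n i j)} (h : ∀ e, coefficient i j a e = 0) : a = 0 := by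
  apply toLaurent_injective i j
  rw [map_zero]
  exact AddMonoidAlgebra.coeff_injective (Finsupp.ext h)

theorem mem_cone_of_coefficient_ne_zero {i : Fin (m + 1)} {j : Fin (n + 1)}
    {a : Γ(PPprod m n, prodChart m n i j)} {e : Exponent m n} (h : coefficient i j a e ≠ 0) :
    e ∈ cone i j := by
  obtain ⟨ψ, -, hψ⟩ := exists_factor_torus i j
  rw [coefficient, toLaurent_eq_iff.mpr (hψ a)] at h
  by_contra he
  refine h (Finsupp.mapDomain_of_notMem_range _ _ ?_)
  rintro ⟨x, rfl⟩
  exact he x.2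

theorem coefficient_add (i : Fin (m + 1)) (j : Fin (n + 1))
    (a b : Γ(PPprod m n, prodChart m n i j)) (e : Exponent m n) :
    coefficient i j (a + b) e = coefficient i j a e + coefficient i j b e := by
  rw [coefficient, map_add]
  rfl

theorem coefficient_sub (i : Fin (m + 1)) (j : Fin (n + 1))
    (a b : Γ(PPprod m n, prodChart m n i j)) (e : Exponent m n) :
    coefficient i j (a - b) e = coefficient i j a e - coefficient i j b e := by
  rw [coefficient, map_sub]
  rfl

theorem coefficient_smul (i : Fin (m + 1)) (j : Fin (n + 1)) (c : ℂ)
    (a : Γ(PPprod m n, prodChart m n i j)) (e : Exponent m n) :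
    coefficient i j (c • a) e = c * coefficient i j a e := by
  have h1 : toLaurent i j (c • a) =
      (AddMonoidAlgebra.single (0 : Exponent m n) c : AddMonoidAlgebra ℂ (Exponent m n)) *
        toLaurent i j a := by
    rw [toLaurent_eq_iff, smul_eq_scalar_mul, map_mul, pull_scalar, map_mul, specFun_toLaurent]
    congr 1
    rw [← scalar_laurentStr, ← torus_over, Category.assoc]
    rfl
  rw [coefficient, h1]
  exact AddMonoidAlgebra.coeff_single_zero_mul _ _ _

theorem coeff_monomial_mul (e₀ e : Exponent m n) (x : laurent m n) :
    AddMonoidAlgebra.coeff (monomial e₀ * x : laurent m n) e =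
      AddMonoidAlgebra.coeff x (-e₀ + e) :=
  (AddMonoidAlgebra.coeff_single_mul_apply _ _ _ _).trans (one_mul _)

theorem toLaurent_of_isCompatible {c : ∀ (i : Fin (m + 1)) (j : Fin (n + 1)),
    Fin (m + 1) → Γ(PPprod m n, prodChart m n i j)} (h : IsCompatible c) (i i' : Fin (m + 1))
    (j j' : Fin (n + 1)) (q : Fin (m + 1)) :
    toLaurent i j (c i j q) = monomial (xExp j' j) *
      (toLaurent i' j' (c i' j' q) - monomial (yExp q i) * toLaurent i' j' (c i' j' i)) := by
  have hO : ⊤ ≤ torus m n ⁻¹ᵁ (prodChart m n i j ⊓ prodChart m n i' j') :=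
    (le_inf (le_torus_preimage i j) (le_torus_preimage i' j')).trans (le_preimage_inf _)
  have h1 := congrArg (pull (torus m n) hO) (h i i' j j' q)
  rw [toLaurent_eq_iff, map_mul, map_sub, map_mul, specFun_toLaurent, specFun_toLaurent,
    ← coord_torus₁, ← coord_torus₂]
  rw [map_mul, map_sub, map_mul, pull_res, pull_res, pull_res, pull_coord, pull_coord] at h1
  exact h1

/-- The shift by eⱼ homogenizes: b is the exponent of a degree-one form in x, whose coordinate on
chart j is the form divided by xⱼ. With this indexing the factor from 𝒪(1) disappears and only the
cocycle of Q remains. -/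
theorem coefficient_of_isCompatible {c : ∀ (i : Fin (m + 1)) (j : Fin (n + 1)),
    Fin (m + 1) → Γ(PPprod m n, prodChart m n i j)} (h : IsCompatible c) (i i' : Fin (m + 1))
    (j j' : Fin (n + 1)) (q : Fin (m + 1)) (a : Fin (m + 1) → ℤ) (b : Fin (n + 1) → ℤ) :
    coefficient i j (c i j q) (a, b - Pi.single j 1) =
      coefficient i' j' (c i' j' q) (a, b - Pi.single j' 1) -
        coefficient i' j' (c i' j' i) (a - Pi.single q 1 + Pi.single i 1, b - Pi.single j' 1) := by
  rw [coefficient, toLaurent_of_isCompatible h i i' j j' q, coeff_monomial_mul]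
  have h1 : -xExp j' j + (a, b - Pi.single j 1) = (a, b - Pi.single j' 1) := by
    simp only [xExp, Prod.neg_mk, Prod.mk_add_mk, neg_zero, zero_add]
    congr 1
    abel
  have h2 : -yExp q i + (a, b - Pi.single j' 1) =
      (a - Pi.single q 1 + Pi.single i 1, b - Pi.single j' 1) := by
    simp only [yExp, Prod.neg_mk, Prod.mk_add_mk, neg_zero, zero_add]
    congr 1
    abel
  rw [h1, ← h2]
  exact congrArg (coefficient i' j' (c i' j' q) (a, b - Pi.single j' 1) - ·)
    (coeff_monomial_mul _ _ _)

/-- A section of `Q(0,1)` vanishes if the coefficients that determine its matrix vanish. -/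
theorem eq_zero_of_isCompatible (hn : 0 < n) {c : ∀ (i : Fin (m + 1)) (j : Fin (n + 1)),
    Fin (m + 1) → Γ(PPprod m n, prodChart m n i j)} (hc : IsCompatible c)
    (hself : ∀ i j, c i j i = 0)
    (h0 : ∀ q l, ∃ i, i ≠ q ∧ coefficient i 0 (c i 0 q) (xExp l 0) = 0)
    (i : Fin (m + 1)) (j : Fin (n + 1)) (q : Fin (m + 1)) : c i j q = 0 := by
  have hz : ∀ i j e, coefficient i j (c i j i) e = 0 := by
    intro i j e
    rw [hself, coefficient, map_zero]
    rfl
  have hj : ∀ i j j' q (a : Fin (m + 1) → ℤ) (b : Fin (n + 1) → ℤ),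
      coefficient i j (c i j q) (a, b - Pi.single j 1) =
      coefficient i j' (c i j' q) (a, b - Pi.single j' 1) := by
    intro i j j' q a b
    rw [coefficient_of_isCompatible hc i i j j', hz, sub_zero]
  have hl : ∀ l i q a, coefficient i 0 (c i 0 q) (a, Pi.single l 1 - Pi.single 0 1) = 0 := by
    intro l
    apply coefficients_eq_zero
    · intro i a
      exact hz i 0 _
    · intro i q a h
      exact (mem_cone_of_coefficient_ne_zero h).1
    · intro i i' q a
      exact coefficient_of_isCompatible hc i i' 0 0 q a _
    · intro q
      exact h0 q l
  apply eq_zero_of_coefficient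
  rintro ⟨a, b⟩
  obtain ⟨b, rfl⟩ : ∃ b', b = b' - Pi.single j 1 := ⟨b + Pi.single j 1, by simp⟩
  by_contra h
  -- The coefficient is the same in all charts j', so b satisfies all cone conditions. For each p a
  -- chart j' ≠ p gives b_p ≥ 0, and the sum is 1; hence b is a basis vector and the form is linear.
  have hcone : ∀ j', ((a, b - Pi.single j' 1) : Exponent m n) ∈ cone i j' := by
    intro j'
    rw [hj i j j'] at h
    exact mem_cone_of_coefficient_ne_zero h
  obtain ⟨l, rfl⟩ := exists_eq_single_of_sum_eq_one (c := b) (by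
    intro p
    have : Nontrivial (Fin (n + 1)) := Fin.nontrivial_iff_two_le.mpr (by omega)
    obtain ⟨p', hp⟩ := exists_ne p
    simpa [Pi.single_eq_of_ne hp.symm] using (hcone p').2.1 p hp.symm) (by
    have := (hcone j).2.2
    simpa [Finset.sum_sub_distrib, sub_eq_zero] using this)
  apply h
  rw [hj i j 0, hl]

/-! ### The matrix of a section -/

/-- An index different from `q`, if there is one. -/
def otherIndex (q : Fin (m + 1)) : Fin (m + 1) := if q = 0 then Fin.last m else 0

theorem otherIndex_ne (hm : 0 < m) (q : Fin (m + 1)) : otherIndex q ≠ q := by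
  unfold otherIndex
  split_ifs with h
  · subst h
    intro h
    have := congrArg Fin.val h
    simp at this
    omega
  · exact Ne.symm h

theorem extCoord_add (s t : (Q01 m n).globalSections) (i : Fin (m + 1)) (j : Fin (n + 1))
    (q : Fin (m + 1)) : extCoord (s + t) i j q = extCoord s i j q + extCoord t i j q := by
  unfold extCoord
  split_ifs
  · rfl
  · rw [add_zero]

theorem extCoord_smul (c : ℂ) (s : (Q01 m n).globalSections) (i : Fin (m + 1)) (j : Fin (n + 1))
    (q : Fin (m + 1)) : extCoord (c • s) i j q = c • extCoord s i j q := by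
  unfold extCoord
  split_ifs
  · rfl
  · rw [smul_zero]

/-- The entries of the matrix of a section of `Q(0,1)`. -/
def matrixEntry (q : Fin (m + 1)) (l : Fin (n + 1)) :
    Module.Dual ℂ (Q01 m n).globalSections where
  toFun s := coefficient (otherIndex q) 0 (extCoord s (otherIndex q) 0 q) (xExp l 0)
  map_add' s t := by rw [extCoord_add, coefficient_add]
  map_smul' c s := by
    rw [extCoord_smul, coefficient_smul]
    rfl

theorem toLaurent_formValues (A : Matrix (Fin (m + 1)) (Fin (n + 1)) ℂ) (i : Fin (m + 1))
    (j : Fin (n + 1)) (q : Fin (m + 1)) :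
    toLaurent i j (formValues A (pr₂ m n) inf_le_right q) =
      (∑ p, AddMonoidAlgebra.single (xExp p j : Exponent m n) (A q p) :
        AddMonoidAlgebra ℂ (Exponent m n)) := by
  rw [toLaurent_eq_iff, pull_formValues, formValues, torus_over', Matrix.mulVec, dotProduct, map_sum]
  refine Finset.sum_congr rfl fun p _ => ?_
  rw [Matrix.map_apply, scalar_laurentStr, coord_torus₂, ← map_mul]
  congr 1
  refine (AddMonoidAlgebra.single_mul_single _ _ _ _).trans ?_
  rw [zero_add, mul_one]

/-- The correction term carries the factor y_q/yᵢ with q ≠ i, so it contributes nothing at exponents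
without y. -/
theorem coefficient_matrixCoord (A : Matrix (Fin (m + 1)) (Fin (n + 1)) ℂ) {i q : Fin (m + 1)}
    (hq : i ≠ q) (l : Fin (n + 1)) :
    coefficient i 0 (matrixCoord A i 0 q) (xExp l 0) = A q l := by
  have h1 : toLaurent i 0 (coord (pr₁ m n) inf_le_left q : Γ(PPprod m n, prodChart m n i 0)) =
      monomial (yExp q i) := by
    rw [toLaurent_eq_iff, pull_coord, coord_torus₁]
  have hsingle : ∀ p : Fin (n + 1),
      (Pi.single p 1 : Fin (n + 1) → ℤ) = Pi.single l 1 ↔ p = l := by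
    intro p
    refine ⟨fun h => ?_, fun h => by rw [h]⟩
    by_contra hp
    have := congrFun h p
    simp [Pi.single_eq_of_ne hp] at this
  have h2 : ∀ (a : Fin (m + 1) → ℤ) (q : Fin (m + 1)), AddMonoidAlgebra.coeff
      (∑ p, AddMonoidAlgebra.single (xExp p 0 : Exponent m n) (A q p) :
        AddMonoidAlgebra ℂ (Exponent m n)) (a, Pi.single l 1 - Pi.single 0 1) =
      if a = 0 then A q l else 0 := by
    intro a q
    rw [AddMonoidAlgebra.coeff_sum, Finsupp.finsetSum_apply]
    simp only [AddMonoidAlgebra.coeff_single, Finsupp.single_apply, xExp, Prod.mk.injEq,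
      sub_left_inj, hsingle]
    split_ifs with h
    · subst h
      simp
    · simp [Ne.symm h]
  rw [matrixCoord, coefficient_sub, coefficient, toLaurent_formValues, coefficient, map_mul, h1,
    toLaurent_formValues, coeff_monomial_mul]
  have h3 : -yExp q i + xExp l 0 = ((Pi.single i 1 - Pi.single q 1,
      Pi.single l 1 - Pi.single 0 1) : Exponent m n) := by
    simp [yExp, xExp]
  rw [h3, h2, xExp, h2, if_pos rfl, if_neg, sub_zero]
  intro h
  have := congrFun h i
  simp [hq] at this

theorem matrixEntry_eq (hm : 0 < m) {A : Matrix (Fin (m + 1)) (Fin (n + 1)) ℂ}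
    {s : (Q01 m n).globalSections} (hs : IsMatrixSection A s) (q : Fin (m + 1))
    (l : Fin (n + 1)) : matrixEntry q l s = A q l := by
  have hq := otherIndex_ne hm q
  have h1 : extCoord s (otherIndex q) 0 q = matrixCoord A (otherIndex q) 0 q :=
    (extCoord_of_ne s _ 0 ⟨q, hq.symm⟩).trans (hs _ _ _)
  change coefficient _ _ (extCoord s (otherIndex q) 0 q) _ = _
  rw [h1, coefficient_matrixCoord A hq]

/-- Every section of `Q(0,1)` is given by a matrix. -/
theorem isMatrixSection (hm : 0 < m) (hn : 0 < n) (s : (Q01 m n).globalSections) :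
    IsMatrixSection (Matrix.of fun q l => matrixEntry q l s) s := by
  obtain ⟨t, ht⟩ := exists_isMatrixSection (Matrix.of fun q l => matrixEntry q l s)
  have h1 : ∀ q l, matrixEntry q l (s - t) = 0 := by
    intro q l
    rw [map_sub, matrixEntry_eq hm ht, Matrix.of_apply, sub_self]
  -- The difference between s and the section built from its own matrix entries has zero entries, so
  -- it vanishes.
  have h2 := eq_zero_of_isCompatible hn (isCompatible_extCoord (s - t)) (extCoord_self _)
    fun q l => ⟨otherIndex q, otherIndex_ne hm q, h1 q l⟩
  intro i j q
  rw [← ht i j q, ← sub_eq_zero]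
  exact (extCoord_of_ne (s - t) i j q).symm.trans (h2 i j q)

end

/-! ### General sections -/

section

variable {m n : ℕ}

/-- The subspace L need not be ker A: the two have equal dimension, so L = ker(Ag) for an invertible
g, and the blow-ups correspond under the automorphism g. -/
theorem exists_iso_zeroLocus {A : Matrix (Fin (m + 1)) (Fin (n + 1)) ℂ}
    {B : Matrix (Fin (n + 1)) (Fin (m + 1)) ℂ} (hAB : A * B = 1)
    {s : (Q01 m n).globalSections} (hs : IsMatrixSection A s)
    (L : Submodule ℂ (Fin (n + 1) → ℂ)) (hL : Module.finrank ℂ L + m = n) {Y : Scheme.{0}}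
    {π : Y ⟶ PP n} (hπ : IsBlowUp (linearSubspaceIdeal n L) π) :
    Nonempty (Over.mk (π ≫ (PP n ↘ Spec (.of ℂ))) ≅
      Over.mk ((Q01 m n).zeroLocusι s ≫ (PPprod m n ↘ Spec (.of ℂ)))) := by
  obtain ⟨g, g', hg, rfl⟩ := exists_matrix_mul_ker_eq hAB L hL
  have h := exists_iso_of_isBlowUp hg hπ (isBlowUp_zeroLocus hAB hs)
  have e : ((Q01 m n).zeroLocusι s ≫ pr₂ m n) ≫ (PP n ↘ Spec (.of ℂ)) =
      (Q01 m n).zeroLocusι s ≫ (PPprod m n ↘ Spec (.of ℂ)) := by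
    rw [Category.assoc, ← Limits.pullback.condition]
    rfl
  rwa [e] at h

/-- The right inverse is the inverse of the chosen square submatrix, placed in the rows selected by
f. -/
theorem exists_rightInverse_of_det_ne_zero {A : Matrix (Fin (m + 1)) (Fin (n + 1)) ℂ}
    (f : Fin (m + 1) → Fin (n + 1)) (h : (A.submatrix id f).det ≠ 0) :
    ∃ B : Matrix (Fin (n + 1)) (Fin (m + 1)) ℂ, A * B = 1 := by
  refine ⟨(1 : Matrix (Fin (n + 1)) (Fin (n + 1)) ℂ).submatrix id f * (A.submatrix id f)⁻¹, ?_⟩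
  have h1 : A * (1 : Matrix (Fin (n + 1)) (Fin (n + 1)) ℂ).submatrix id f = A.submatrix id f := by
    ext q p
    simp [Matrix.mul_apply, Matrix.one_apply]
  rw [← Matrix.mul_assoc, h1, Matrix.mul_nonsing_inv _ h.isUnit]

theorem det_submatrix_one (h : m ≤ n) :
    (((1 : Matrix (Fin (n + 1)) (Fin (n + 1)) ℂ).submatrix (Fin.castLE (Nat.succ_le_succ h))
      id).submatrix id (Fin.castLE (Nat.succ_le_succ h))).det ≠ 0 := by
  rw [Matrix.submatrix_submatrix, Function.comp_id, Function.id_comp,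
    Matrix.submatrix_one _ (Fin.castLE_injective _), Matrix.det_one]
  exact one_ne_zero

/-- For m > 0 the polynomial is the minor on the first m+1 columns, with the linear forms
`matrixEntry` as entries. It is nonzero at the section of the matrix formed by the first m+1 rows of
the identity. -/
theorem holdsForGeneral_exists_matrix (h : m ≤ n) :
    HoldsForGeneral fun s : (Q01 m n).globalSections =>
      ∃ (A : Matrix (Fin (m + 1)) (Fin (n + 1)) ℂ) (B : Matrix (Fin (n + 1)) (Fin (m + 1)) ℂ),
        A * B = 1 ∧ IsMatrixSection A s := by
  let f : Fin (m + 1) → Fin (n + 1) := Fin.castLE (Nat.succ_le_succ h)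
  let A₀ : Matrix (Fin (m + 1)) (Fin (n + 1)) ℂ := (1 : Matrix _ _ ℂ).submatrix f id
  have hA₀ : (A₀.submatrix id f).det ≠ 0 := det_submatrix_one h
  rcases Nat.eq_zero_or_pos m with hm | hm
  -- For m = 0 the frame of Q is empty, so being the section of a given matrix is a vacuous
  -- condition and the constant polynomial 1 suffices.
  · refine ⟨1, ⟨0, by simp⟩, fun s _ => ?_⟩
    obtain ⟨B, hB⟩ := exists_rightInverse_of_det_ne_zero f hA₀
    refine ⟨A₀, B, hB, fun i j q => (q.2 ?_).elim⟩
    ext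
    have := q.1.2
    have := i.2
    omega
  · let M : Matrix (Fin (m + 1)) (Fin (m + 1))
        (MvPolynomial (Module.Dual ℂ (Q01 m n).globalSections) ℂ) :=
      Matrix.of fun q q' => MvPolynomial.X (matrixEntry q (f q'))
    have hM : ∀ s : (Q01 m n).globalSections, MvPolynomial.eval (fun φ => φ s) M.det =
        ((Matrix.of fun q l => matrixEntry q l s).submatrix id f).det := by
      intro s
      rw [RingHom.map_det]
      congr 1
      ext q q'
      simp [M]
    refine ⟨M.det, ?_, fun s hs => ?_⟩
    · obtain ⟨s, hs⟩ := exists_isMatrixSection A₀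
      refine ⟨s, ?_⟩
      have : (Matrix.of fun q l => matrixEntry q l s) = A₀ :=
        Matrix.ext fun q l => matrixEntry_eq hm hs q l
      rwa [hM, this]
    · rw [hM] at hs
      obtain ⟨B, hB⟩ := exists_rightInverse_of_det_ne_zero f hs
      exact ⟨_, B, hB, isMatrixSection hm (by omega) s⟩

end

end BlowUpLinear

end

theorem lemma2p1 (n r : ℕ) (hr : r ≤ n) :
    (∀ L : Submodule ℂ (Fin (n + 1) → ℂ), Module.finrank ℂ L = r →
      ∃ (B : Scheme.{0}) (π : B ⟶ PP n), IsBlowUp (linearSubspaceIdeal n L) π) ∧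
    HoldsForGeneral fun s : (Q01 (n - r) n).globalSections =>
      ∀ L : Submodule ℂ (Fin (n + 1) → ℂ), Module.finrank ℂ L = r →
        ∀ (B : Scheme.{0}) (π : B ⟶ PP n), IsBlowUp (linearSubspaceIdeal n L) π →
          Nonempty (Over.mk (π ≫ (PP n ↘ Spec (.of ℂ))) ≅
            Over.mk ((Q01 (n - r) n).zeroLocusι s ≫ (PPprod (n - r) n ↘ Spec (.of ℂ)))) := by
  refine ⟨fun L hL => ?_, ?_⟩
  · obtain ⟨A, B, hAB, rfl⟩ := exists_matrix_of_submodule hr L hL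
    obtain ⟨s, hs⟩ := exists_isMatrixSection A
    exact ⟨_, _, isBlowUp_zeroLocus hAB hs⟩
  -- The polynomial is chosen before L, so one open set works for all subspaces of dimension r.
  · obtain ⟨p, hp, h⟩ := holdsForGeneral_exists_matrix (Nat.sub_le n r)
    refine ⟨p, hp, fun s hs L hL B π hπ => ?_⟩
    obtain ⟨A, C, hAC, hA⟩ := h s hs
    exact exists_iso_zeroLocus hAC hA L (by omega) hπ
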